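/- **Definitions.** For $B\in\mathbb R^{d\times d}$ let $\lambda_{1,\mathrm{bin}}(B)=\min\{\|Bz-Bz'\|_2 : z\ne z'\in\{-1,1\}^d\}$. An instance of $\mathsf{BinaryBDD}_{d,\alpha}$ is a pair $(B,t)$ with $B\in\mathbb R^{d\times d}$, $\lambda_{1,\mathrm{bin}}(B)>0$, and $t=Bz+e$ for some $z\in\{-1,1\}^d$ and $\|e\|_2\le\alpha\,\lambda_{1,\mathrm{bin}}(B)$; the task is to output $z$. An instance of $k$-$\mathsf{SLR}$ in dimension $n$ with $m$ samples is a triple $(X,y,\delta)$ with $X\in\mathbb R^{m\times n}$, $y\in\mathbb R^m$, $\delta>0$; a solution is a $\theta\in\mathbb R^n$ with at most $k$ nonzero entries and $\frac1m\|X\theta-y\|_2^2\le\delta^2$; the instance is valid if it has a solution, and a solver must return a solution of every valid instance (its answers on other instances are arbitrary). For $k\mid d$ and $n=k2^{d/k}$ let $G_{\mathsf{sparse}}\in\mathbb R^{d\times n}$ be the block diagonal matrix with $k$ identical blocks of size $(d/k)\times 2^{d/k}$ whose columns are all vectors of $\{-1,1\}^{d/k}$ (in binary order), and let $G_{\mathsf{partite}}\in\mathbb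 R^{k\times n}$ be the block diagonal matrix with $k$ identical blocks $(1,\dots,1)\in\mathbb R^{1\times n/k}$. Running time is counted in the real-number model: one fixed program for all $d,k,m$, with unit-cost addition and subtraction of natural numbers, unit-cost exact $+,-,\times,/$ and comparisons on reals (no rounding or root extraction), unit-cost sampling from $N(0,1)$, and calls to a $k$-$\mathsf{SLR}$ oracle (in dimension $n$ with $m$ samples), each charged the number of reals exchanged. **Theorem.** Let $d,k,m,n$ be integers with $d\ge1$, $k\mid d$, $k\ge 1$, $m\ge17d$ and $n=k\cdot2^{d/k}$. There is a $\mathrm{poly}(n,m)$-time randomized reduction from $\mathsf{BinaryBDD}_{d,\alpha}$, for every $\alpha\le1/10$, to $k$-$\mathsf{SLR}$ in dimension $n$ with $m$ samples, which succeeds with probability $1-e^{-\Omega(m)}$. Precisely, there are universal constants $a\in\mathbb N$ and $c,C_1,C_2>0$ for which the following two statements hold. 1. *(Instance map, given an estimate of $\lambda_{1,\mathrm{bin}}$.)* There is a program which on every input $(B,t,\widehat\lambda)$ halts within $a(n+m)^a$ steps, and which, if $(B,t)$ is a $\mathsf{BinaryBDD}_{d,\alpha}$ instance with solution $z$ and $\alpha\le1/10$,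 and $\lambda_{1,\mathrm{bin}}(B)\le\widehat\lambda<2\lambda_{1,\mathrm{bin}}(B)$, makes exactly one query $(X,y,\delta)$. Here $\delta$ and a scalar $\gamma>0$ depend only on $d,k,m,B,\widehat\lambda$, $$C_1\lambda_{1,\mathrm{bin}}(B)\le\delta\le C_2\lambda_{1,\mathrm{bin}}(B),\qquad X=\begin{pmatrix}X_1\\ \gamma\,G_{\mathsf{partite}}\end{pmatrix},$$ and the $m-k$ rows of the random matrix $X_1$ are i.i.d. $N(0,\,G_{\mathsf{sparse}}^\top B^\top B\,G_{\mathsf{sparse}})$. With probability at least $1-e^{-cm}$ the query is a valid $k$-$\mathsf{SLR}$ instance and, whichever solution of it the oracle returns, the program outputs $z$. 2. *(Reduction without an estimate.)* There is a program which on every input $(B,t)$ and with every oracle halts within $a(n+m)^a$ steps, and which, if $(B,t)$ is a $\mathsf{BinaryBDD}_{d,\alpha}$ instance with solution $z$ and $\alpha\le1/10$, has the following properties. There is a random matrix $X_1$, which depends on $B$ and the random coins only and has $m-k$ i.i.d. rows $N(0,\,G_{\mathsf{sparse}}^\top B^\top B\,G_{\mathsf{sparse}})$, such that every query has $\delta>0$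 and a design matrix $\begin{pmatrix}X_1\\ \gamma\,G_{\mathsf{partite}}\end{pmatrix}$ for some scalar $\gamma>0$. With probability at least $1-e^{-cm}$ over the coins, the program outputs $z$ with every oracle that solves $k$-$\mathsf{SLR}$. -/

import Mathlib

open MeasureTheory ProbabilityTheory
open scoped Matrix

noncomputable section

namespace BDDtoSLR

/-! ## Norm, sign vectors, binary bounded distance decoding -/

/-- The Euclidean norm of a real vector. -/
def l2norm {ι : Type*} [Fintype ι] (v : ι → ℝ) : ℝ := ‖WithLp.toLp 2 v‖

/-- `z ∈ {-1, 1}^d`. -/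
def IsSign {d : ℕ} (z : Fin d → ℝ) : Prop := ∀ i, z i = -1 ∨ z i = 1

/-- The binary minimum distance of `B`: the minimum of `‖B z - B z'‖₂` over distinct
`z, z' ∈ {-1, 1}^d`. -/
def lambdaBin {d : ℕ} (B : Matrix (Fin d) (Fin d) ℝ) : ℝ :=
  sInf {r | ∃ z z' : Fin d → ℝ, IsSign z ∧ IsSign z' ∧ z ≠ z' ∧ r = l2norm (B *ᵥ z - B *ᵥ z')}

/-- `(B, t)` is an instance of binary bounded distance decoding with parameter `α` whose solution
is `z`: `z ∈ {-1, 1}^d` and `t = B z + e` with `‖e‖₂ ≤ α * lambdaBin B`. -/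
def IsBinaryBDD {d : ℕ} (α : ℝ) (B : Matrix (Fin d) (Fin d) ℝ) (t z : Fin d → ℝ) : Prop :=
  IsSign z ∧ ∃ e : Fin d → ℝ, t = B *ᵥ z + e ∧ l2norm e ≤ α * lambdaBin B

/-! ## Sparse linear regression -/

/-- `v` has at most `k` nonzero entries. -/
def IsSparse {n : ℕ} (k : ℕ) (v : Fin n → ℝ) : Prop := {j | v j ≠ 0}.ncard ≤ k

/-- An instance of sparse linear regression in dimension `n` with `m` samples: the design matrix,
the target vector and the error parameter. -/
structure SLRInstance (m n : ℕ) where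
  X : Matrix (Fin m) (Fin n) ℝ
  y : Fin m → ℝ
  δ : ℝ

/-- `θ` is a `k`-sparse vector with mean squared error at most `δ ^ 2`. -/
def SLRInstance.IsSolution {m n : ℕ} (k : ℕ) (q : SLRInstance m n) (θ : Fin n → ℝ) : Prop :=
  IsSparse k θ ∧ l2norm (q.X *ᵥ θ - q.y) ^ 2 / m ≤ q.δ ^ 2

/-- The promise of `k`-sparse linear regression: `δ > 0` and a solution exists. -/
def SLRInstance.IsValid {m n : ℕ} (k : ℕ) (q : SLRInstance m n) : Prop :=
  0 < q.δ ∧ ∃ θ, q.IsSolution k θ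

/-- `S` solves `k`-sparse linear regression in dimension `n` with `m` samples: it returns a
solution of every valid instance (and anything at all on the other ones). -/
def SolvesSLR {m n : ℕ} (k : ℕ) (S : SLRInstance m n → Fin n → ℝ) : Prop :=
  ∀ q : SLRInstance m n, q.IsValid k → q.IsSolution k (S q)

/-! ## The gadget matrices -/

/-- The block diagonal `d × n` matrix with `k` identical blocks of size `(d/k) × (n/k)`. When
`n/k = 2^(d/k)`, the columns of a block are all the vectors of `{-1, 1}^(d/k)`, in binary order. -/
def gSparse (d k n : ℕ) : Matrix (Fin d) (Fin n) ℝ := fun i j =>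
  if (i : ℕ) / (d / k) = (j : ℕ) / (n / k) then
    if ((j : ℕ) % (n / k)).testBit ((i : ℕ) % (d / k)) then 1 else -1
  else 0

/-- The block diagonal `k × n` matrix with `k` identical blocks, each of them the all-ones row of
length `n/k`. -/
def gPartite (n k : ℕ) : Matrix (Fin k) (Fin n) ℝ := fun i j =>
  if (i : ℕ) = (j : ℕ) / (n / k) then 1 else 0

/-- The `m × n` matrix with top block `X₁` (`m - k` rows) and bottom block `X₂` (`k` rows). -/
def stack {m n k : ℕ} (X₁ : Matrix (Fin (m - k)) (Fin n) ℝ) (X₂ : Matrix (Fin k) (Fin n) ℝ) :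
    Matrix (Fin m) (Fin n) ℝ := fun i j =>
  if h : (i : ℕ) < m - k then X₁ ⟨i, h⟩ j else X₂ ⟨(i : ℕ) - (m - k), by omega⟩ j

/-! ## Randomness -/

/-- The law of an infinite sequence of independent standard Gaussians. -/
def gaussianTape : Measure (ℕ → ℝ) := Measure.infinitePi fun _ => gaussianReal 0 1

/-- The rows of the random matrix `X₁` are independent with law `N(0, Σ)`. -/
def HasIIDGaussianRows {p n : ℕ} (X₁ : (ℕ → ℝ) → Matrix (Fin p) (Fin n) ℝ)
    (Sigma : Matrix (Fin n) (Fin n) ℝ) : Prop :=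
  HasLaw (fun ω (i : Fin p) => (WithLp.toLp 2 (X₁ ω i) : EuclideanSpace ℝ (Fin n)))
    (Measure.pi fun _ : Fin p => multivariateGaussian 0 Sigma) gaussianTape

/-! ## Real-number programs with Gaussian sampling and a regression oracle

The machine has registers for natural numbers and two-dimensional arrays of reals, indexed by the
contents of registers. It can add and subtract natural numbers, compute `+ - * /` and compare
exactly on reals (no rounding), draw a fresh standard Gaussian, and call the oracle. -/

/-- Entry `(reg row, reg col)` of the real array number `name`. -/
structure Loc where
  name : ℕ
  row : ℕ
  col : ℕ

inductive RealOp
  | plus | minus | times | quot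

def RealOp.eval : RealOp → ℝ → ℝ → ℝ
  | .plus, x, y => x + y
  | .minus, x, y => x - y
  | .times, x, y => x * y
  | .quot, x, y => x / y

inductive Test
  | natLt (a b : ℕ)
  | realLt (x y : Loc)

/-- Programs. The letters `r, a, b` are names of registers; in `query aX ay aδ aθ` the arguments are
names of real arrays. A program is a finite object which does not depend on the input. -/
inductive Prog
  | natConst (r c : ℕ)
  | natAdd (r a b : ℕ)
  | natSub (r a b : ℕ)
  | realConst (x : Loc) (c : ℚ)
  | realOp (o : RealOp) (x y z : Loc)
  | gauss (x : Loc)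
  | query (aX ay aδ aθ : ℕ)
  | seq (P Q : Prog)
  | ite (b : Test) (P Q : Prog)
  | while (b : Test) (P : Prog)

/-- A state of the machine: registers, real arrays, the number of Gaussians drawn so far, and the
list of oracle queries made so far (which programs cannot read). -/
structure State (m n : ℕ) where
  reg : ℕ → ℕ
  arr : ℕ → ℕ → ℕ → ℝ
  drawn : ℕ
  log : List (SLRInstance m n)

namespace State

variable {m n : ℕ}

def get (s : State m n) (x : Loc) : ℝ := s.arr x.name (s.reg x.row) (s.reg x.col)

def setReg (s : State m n) (r v : ℕ) : State m n :=
  { s with reg := fun r' => if r' = r then v else s.reg r' }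

def set (s : State m n) (x : Loc) (v : ℝ) : State m n :=
  { s with arr := fun a i j =>
      if a = x.name ∧ i = s.reg x.row ∧ j = s.reg x.col then v else s.arr a i j }

/-- The regression instance stored in the arrays `aX`, `ay` (column `0`), `aδ` (entry `(0, 0)`). -/
def readQuery (s : State m n) (aX ay aδ : ℕ) : SLRInstance m n where
  X := fun i j => s.arr aX i j
  y := fun i => s.arr ay i 0
  δ := s.arr aδ 0 0

/-- Record the query `q` and store the answer `θ` in column `0` of the array `aθ`. -/
def answer (s : State m n) (q : SLRInstance m n) (aθ : ℕ) (θ : Fin n → ℝ) : State m n :=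
  { s with
    arr := fun a i j =>
      if h : i < n then (if a = aθ ∧ j = 0 then θ ⟨i, h⟩ else s.arr a i j) else s.arr a i j
    log := s.log ++ [q] }

end State

def Test.Holds {m n : ℕ} (s : State m n) : Test → Prop
  | .natLt a b => s.reg a < s.reg b
  | .realLt x y => s.get x < s.get y

/-- `Exec ω S P s s' T`: with Gaussian tape `ω` and oracle `S`, the program `P` started in `s` halts
in `s'` after exactly `T` steps. Every elementary operation, draw and test is one step; an oracle
call costs the number of reals passed to and from the oracle. -/
inductive Exec {m n : ℕ} (ω : ℕ → ℝ) (S : SLRInstance m n → Fin n → ℝ) :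
    Prog → State m n → State m n → ℕ → Prop
  | natConst (s : State m n) (r c : ℕ) : Exec ω S (.natConst r c) s (s.setReg r c) 1
  | natAdd (s : State m n) (r a b : ℕ) :
      Exec ω S (.natAdd r a b) s (s.setReg r (s.reg a + s.reg b)) 1
  | natSub (s : State m n) (r a b : ℕ) :
      Exec ω S (.natSub r a b) s (s.setReg r (s.reg a - s.reg b)) 1
  | realConst (s : State m n) (x : Loc) (c : ℚ) : Exec ω S (.realConst x c) s (s.set x (c : ℝ)) 1
  | realOp (s : State m n) (o : RealOp) (x y z : Loc) :
      Exec ω S (.realOp o x y z) s (s.set x (o.eval (s.get y) (s.get z))) 1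
  | gauss (s : State m n) (x : Loc) :
      Exec ω S (.gauss x) s { s.set x (ω s.drawn) with drawn := s.drawn + 1 } 1
  | query (s : State m n) (aX ay aδ aθ : ℕ) :
      Exec ω S (.query aX ay aδ aθ) s
        (s.answer (s.readQuery aX ay aδ) aθ (S (s.readQuery aX ay aδ))) (m * n + m + n + 1)
  | seq {P Q : Prog} {s s' s'' : State m n} {T T' : ℕ} :
      Exec ω S P s s' T → Exec ω S Q s' s'' T' → Exec ω S (.seq P Q) s s'' (T + T')
  | ite_true {b : Test} {P Q : Prog} {s s' : State m n} {T : ℕ} :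
      b.Holds s → Exec ω S P s s' T → Exec ω S (.ite b P Q) s s' (T + 1)
  | ite_false {b : Test} {P Q : Prog} {s s' : State m n} {T : ℕ} :
      ¬ b.Holds s → Exec ω S Q s s' T → Exec ω S (.ite b P Q) s s' (T + 1)
  | while_true {b : Test} {P : Prog} {s s' s'' : State m n} {T T' : ℕ} :
      b.Holds s → Exec ω S P s s' T → Exec ω S (.while b P) s' s'' T' →
      Exec ω S (.while b P) s s'' (T + T' + 1)
  | while_false {b : Test} {P : Prog} {s : State m n} :
      ¬ b.Holds s → Exec ω S (.while b P) s s 1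

/-- The start state: `d, k, m` in the registers `0, 1, 2`; the matrix `B` in array `0`; the vector
`t` in column `0` of array `1`; the number `est` in entry `(0, 0)` of array `2`; `0` elsewhere. -/
def startState {m n d : ℕ} (k : ℕ) (B : Matrix (Fin d) (Fin d) ℝ) (t : Fin d → ℝ) (est : ℝ) :
    State m n where
  reg := fun r => if r = 0 then d else if r = 1 then k else if r = 2 then m else 0
  arr := fun a i j =>
    if a = 0 then (if h : i < d ∧ j < d then B ⟨i, h.1⟩ ⟨j, h.2⟩ else 0)
    else if a = 1 then (if h : i < d ∧ j = 0 then t ⟨i, h.1⟩ else 0)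
    else if a = 2 then (if i = 0 ∧ j = 0 then est else 0)
    else 0
  drawn := 0
  log := []

/-- The output vector: the first `d` entries of column `0` of array `3`. -/
def State.output {m n : ℕ} (s : State m n) (d : ℕ) : Fin d → ℝ := fun i => s.arr 3 i 0

/-- `P` started in `s` halts within `T` steps, in a state with property `Q`. -/
def HaltsWithin {m n : ℕ} (ω : ℕ → ℝ) (S : SLRInstance m n → Fin n → ℝ) (P : Prog)
    (s : State m n) (T : ℕ) (Q : State m n → Prop) : Prop :=
  ∃ (s' : State m n) (T' : ℕ), Exec ω S P s s' T' ∧ T' ≤ T ∧ Q s'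

end BDDtoSLR

end

open BDDtoSLR

/-! Let `R` be a Gaussian matrix with `m - k` rows. The query has top block `R B G_sparse` with
target `R t`, and bottom block `γ G_partite` with every target entry `γ`. By `slrQuery_residual` the
squared residual of `θ` is `‖R (B G_sparse θ - t)‖² + γ² ‖G_partite θ - 1‖²`. If `θ` is `k`-sparse
and all block sums are near `1`, then each of the `k` blocks has exactly one nonzero entry, and that
entry is near `1`. So `G_sparse θ` is near a sign vector (`decode_close`), and every sign vector
arises exactly (`exists_encoding`). The rows of the top block have the required law because a linear
image of a standard Gaussian is Gaussian with the Gram matrix as covariance (`map_vecMul_gaussian`).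

With probability `1 - e^{-m/10}` (`goodEvent_prob`) three things hold: `R` does not stretch `B z -
t` much; it does not shrink `B z' - t` much for any of the `2^d` sign vectors `z'` (a union bound,
paid for by `m ≥ 17 d`); and its Frobenius norm is moderate, which controls the rounding error. On
this event a query with `δ ≥ (3/2) ‖B z - t‖` is valid (`slrQuery_isValid`), and any solution
decodes to a sign vector with residual at most `(11/5) δ` (`solution_close`). Writing `λ` for
`lambdaBin B`, the noise is at most `λ/10` and every wrong sign vector has residual at least
`9λ/10`. An estimate of `λ` up to a factor `2` thus gives `δ = est/6` in `[λ/6, λ/3)`, for which the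
query is valid and the only possible decoding is `z`.

Without an estimate, the residual length `r` of a current candidate `z'` plays the role of `λ`. As
long as `z' ≠ z`, the noise is at most `r/9`, so any `δ` in `[r/6, r/3]` gives a valid query, and
its answer shrinks the residual by the factor `11/15`. The solution `z` is a fixed point of this
iteration. The good event involves only `R`, `B`, `t`, `z`, so one sample of `R` serves all
adaptively chosen queries.

The number of rounds is bounded independently of `B`. Before `z` is reached, the residual is
comparable to `‖B (z' - z)‖`, and `(z' - z)/2` has entries in `{-1, 0, 1}`. Were the iteration long,
there would be `d + 1` such vectors in dimension `d` with rapidly decreasing images; Siegel's lemma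
gives them an integer relation with coefficients at most `(d + 1)^d`, in which the longest image
cannot be cancelled (`no_rapid_decrease`).

The remaining work is a small program logic: `WP` couples a postcondition with a running time `(n +
m)^e`, where `e` is read off the program text, and `Exec.agree` is its frame rule. -/

namespace BDDtoSLR

/-! ## Program logic -/

namespace Prog

/-- Whether the register `x` is assigned in the program. -/
def writesReg : Prog → ℕ → Bool
  | .natConst r _, x => r == x
  | .natAdd r _ _, x => r == x
  | .natSub r _ _, x => r == x
  | .realConst _ _, _ => false
  | .realOp _ _ _ _, _ => false
  | .gauss _, _ => false
  | .query _ _ _ _, _ => false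
  | .seq P Q, x => P.writesReg x || Q.writesReg x
  | .ite _ P Q, x => P.writesReg x || Q.writesReg x
  | .while _ P, x => P.writesReg x

/-- Whether the array `a` is assigned in the program. -/
def writesArr : Prog → ℕ → Bool
  | .natConst _ _, _ => false
  | .natAdd _ _ _, _ => false
  | .natSub _ _ _, _ => false
  | .realConst x _, a => x.name == a
  | .realOp _ x _ _, a => x.name == a
  | .gauss x, a => x.name == a
  | .query _ _ _ aθ, a => aθ == a
  | .seq P Q, a => P.writesArr a || Q.writesArr a
  | .ite _ P Q, a => P.writesArr a || Q.writesArr a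
  | .while _ P, a => P.writesArr a

/-- Whether the program contains a sampling instruction. -/
def draws : Prog → Bool
  | .gauss _ => true
  | .seq P Q => P.draws || Q.draws
  | .ite _ P Q => P.draws || Q.draws
  | .while _ P => P.draws
  | _ => false

/-- Whether the program contains an oracle call. -/
def asks : Prog → Bool
  | .query _ _ _ _ => true
  | .seq P Q => P.asks || Q.asks
  | .ite _ P Q => P.asks || Q.asks
  | .while _ P => P.asks
  | _ => false

/-- An exponent `e` such that the program runs in time `(n + m) ^ e` when each of its loops makes at
most `(n + m) ^ 3` iterations. -/
def exponent : Prog → ℕ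
  | .query _ _ _ _ => 2
  | .seq P Q => max P.exponent Q.exponent + 1
  | .ite _ P Q => max P.exponent Q.exponent + 1
  | .while _ P => P.exponent + 5
  | _ => 0

/-- `for i in 0, ..., reg N - 1 do P`; register `199` is used for the increment. -/
def loop (i N : ℕ) (P : Prog) : Prog :=
  .seq (.natConst i 0) (.while (.natLt i N) (.seq P (.seq (.natConst 199 1) (.natAdd i i 199))))

/-- The program that does nothing useful. -/
def skip : Prog := .natConst 199 0

end Prog

variable {m n : ℕ} {ω : ℕ → ℝ} {S : SLRInstance m n → Fin n → ℝ}

/-- The states `s` and `s'` agree except on what `P` may change. -/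
structure Agree (P : Prog) (s s' : State m n) : Prop where
  reg : ∀ r, P.writesReg r = false → s'.reg r = s.reg r
  arr : ∀ a, P.writesArr a = false → s'.arr a = s.arr a
  drawn : P.draws = false → s'.drawn = s.drawn
  log : P.asks = false → s'.log = s.log

theorem Agree.refl (P : Prog) (s : State m n) : Agree P s s :=
  ⟨fun _ _ => rfl, fun _ _ => rfl, fun _ => rfl, fun _ => rfl⟩

theorem Agree.trans {P : Prog} {s s' s'' : State m n} (h : Agree P s s') (h' : Agree P s' s'') :
    Agree P s s'' :=
  ⟨fun r hr => (h'.reg r hr).trans (h.reg r hr), fun r hr => (h'.arr r hr).trans (h.arr r hr),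
    fun hr => (h'.drawn hr).trans (h.drawn hr), fun hr => (h'.log hr).trans (h.log hr)⟩

theorem Agree.mono {P Q : Prog} {s s' : State m n} (h : Agree P s s')
    (hr : ∀ r, Q.writesReg r = false → P.writesReg r = false)
    (ha : ∀ r, Q.writesArr r = false → P.writesArr r = false)
    (hd : Q.draws = false → P.draws = false) (hl : Q.asks = false → P.asks = false) :
    Agree Q s s' :=
  ⟨fun r h1 => h.reg r (hr r h1), fun r h1 => h.arr r (ha r h1), fun h1 => h.drawn (hd h1),
    fun h1 => h.log (hl h1)⟩

theorem State.set_arr_of_ne (s : State m n) (x : Loc) (v : ℝ) {a : ℕ} (h : x.name ≠ a) :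
    (s.set x v).arr a = s.arr a := by
  funext i j
  have : ¬ a = x.name := fun h' => h h'.symm
  simp [State.set, this]

/-- The frame rule. It turns the preservation of a register or an array into a syntactic check on
the program, which `rfl` or `decide` settles for a concrete program. -/
theorem Exec.agree {P : Prog} {s s' : State m n} {T : ℕ} (h : Exec ω S P s s' T) :
    Agree P s s' := by
  induction h with
  | natConst s r c =>
    refine ⟨fun x hx => ?_, fun _ _ => rfl, fun _ => rfl, fun _ => rfl⟩
    have : ¬ x = r := fun h => by simp [Prog.writesReg, h] at hx
    simp [State.setReg, this]
  | natAdd s r a b =>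
    refine ⟨fun x hx => ?_, fun _ _ => rfl, fun _ => rfl, fun _ => rfl⟩
    have : ¬ x = r := fun h => by simp [Prog.writesReg, h] at hx
    simp [State.setReg, this]
  | natSub s r a b =>
    refine ⟨fun x hx => ?_, fun _ _ => rfl, fun _ => rfl, fun _ => rfl⟩
    have : ¬ x = r := fun h => by simp [Prog.writesReg, h] at hx
    simp [State.setReg, this]
  | realConst s x c =>
    refine ⟨fun _ _ => rfl, fun a ha => ?_, fun _ => rfl, fun _ => rfl⟩
    exact s.set_arr_of_ne _ _ fun h => by simp [Prog.writesArr, h] at ha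
  | realOp s o x y z =>
    refine ⟨fun _ _ => rfl, fun a ha => ?_, fun _ => rfl, fun _ => rfl⟩
    exact s.set_arr_of_ne _ _ fun h => by simp [Prog.writesArr, h] at ha
  | gauss s x =>
    refine ⟨fun _ _ => rfl, fun a ha => ?_, fun h => by simp [Prog.draws] at h, fun _ => rfl⟩
    exact s.set_arr_of_ne x (ω s.drawn) fun h => by simp [Prog.writesArr, h] at ha
  | query s aX ay aδ aθ =>
    refine ⟨fun _ _ => rfl, fun a ha => ?_, fun _ => rfl, fun h => by simp [Prog.asks] at h⟩
    have : ¬ a = aθ := fun h => by simp [Prog.writesArr, h] at ha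
    funext i j
    simp [State.answer, this]
  | seq h₁ h₂ ih₁ ih₂ =>
    refine Agree.trans (ih₁.mono ?_ ?_ ?_ ?_) (ih₂.mono ?_ ?_ ?_ ?_) <;>
      simp +contextual [Prog.writesReg, Prog.writesArr, Prog.draws, Prog.asks]
  | ite_true hb h ih =>
    refine ih.mono ?_ ?_ ?_ ?_ <;>
      simp +contextual [Prog.writesReg, Prog.writesArr, Prog.draws, Prog.asks]
  | ite_false hb h ih =>
    refine ih.mono ?_ ?_ ?_ ?_ <;>
      simp +contextual [Prog.writesReg, Prog.writesArr, Prog.draws, Prog.asks]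
  | while_true hb h₁ h₂ ih₁ ih₂ =>
    refine Agree.trans (ih₁.mono ?_ ?_ ?_ ?_) ih₂ <;>
      simp +contextual [Prog.writesReg, Prog.writesArr, Prog.draws, Prog.asks]
  | while_false hb => exact Agree.refl _ _

/-- `P` started in `s` halts within `(n + m) ^ P.exponent` steps, in a state with property `Q`. -/
def WP (ω : ℕ → ℝ) (S : SLRInstance m n → Fin n → ℝ) (P : Prog) (s : State m n)
    (Q : State m n → Prop) : Prop :=
  HaltsWithin ω S P s ((n + m) ^ P.exponent) Q

theorem WP.conseq {P : Prog} {s : State m n} {Q R : State m n → Prop} (h : WP ω S P s Q)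
    (hQR : ∀ s', Agree P s s' → Q s' → R s') : WP ω S P s R := by
  obtain ⟨s', T, he, hT, hQ⟩ := h
  exact ⟨s', T, he, hT, hQR s' he.agree hQ⟩

/-! ### Proof rules for instructions, branching and counting loops. -/

section basic

variable {s : State m n} {Q : State m n → Prop}

theorem wp_natConst (hM : 2 ≤ n + m) {r c : ℕ} (h : Q (s.setReg r c)) :
    WP ω S (.natConst r c) s Q :=
  ⟨_, _, .natConst s r c, Nat.one_le_pow _ _ (by omega), h⟩

theorem wp_natAdd (hM : 2 ≤ n + m) {r a b : ℕ} (h : Q (s.setReg r (s.reg a + s.reg b))) :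
    WP ω S (.natAdd r a b) s Q :=
  ⟨_, _, .natAdd s r a b, Nat.one_le_pow _ _ (by omega), h⟩

theorem wp_natSub (hM : 2 ≤ n + m) {r a b : ℕ} (h : Q (s.setReg r (s.reg a - s.reg b))) :
    WP ω S (.natSub r a b) s Q :=
  ⟨_, _, .natSub s r a b, Nat.one_le_pow _ _ (by omega), h⟩

theorem wp_realConst (hM : 2 ≤ n + m) {x : Loc} {c : ℚ} (h : Q (s.set x (c : ℝ))) :
    WP ω S (.realConst x c) s Q :=
  ⟨_, _, .realConst s x c, Nat.one_le_pow _ _ (by omega), h⟩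

theorem wp_realOp (hM : 2 ≤ n + m) {o : RealOp} {x y z : Loc}
    (h : Q (s.set x (o.eval (s.get y) (s.get z)))) : WP ω S (.realOp o x y z) s Q :=
  ⟨_, _, .realOp s o x y z, Nat.one_le_pow _ _ (by omega), h⟩

theorem wp_gauss (hM : 2 ≤ n + m) {x : Loc}
    (h : Q { s.set x (ω s.drawn) with drawn := s.drawn + 1 }) : WP ω S (.gauss x) s Q :=
  ⟨_, _, .gauss s x, Nat.one_le_pow _ _ (by omega), h⟩

theorem wp_skip (hM : 2 ≤ n + m) (h : Q (s.setReg 199 0)) : WP ω S .skip s Q :=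
  wp_natConst hM h

theorem wp_query (hn : 1 ≤ n) (hm : 2 ≤ m) {aX ay aδ aθ : ℕ}
    (h : Q (s.answer (s.readQuery aX ay aδ) aθ (S (s.readQuery aX ay aδ)))) :
    WP ω S (.query aX ay aδ aθ) s Q := by
  refine ⟨_, _, .query s aX ay aδ aθ, ?_, h⟩
  change _ ≤ (n + m) ^ 2
  nlinarith

/-- Since `n + m ≥ 2`, two running times with exponents at most `e` add up to at most `(n + m) ^ (e
+ 1)`. This is why composition raises the exponent by one. -/
theorem wp_seq (hM : 2 ≤ n + m) {P P' : Prog} (h : WP ω S P s fun s' => WP ω S P' s' Q) :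
    WP ω S (.seq P P') s Q := by
  obtain ⟨s', T, he, hT, s'', T', he', hT', hQ⟩ := h
  refine ⟨s'', _, .seq he he', ?_, hQ⟩
  have h1 : (n + m) ^ P.exponent ≤ (n + m) ^ max P.exponent P'.exponent :=
    Nat.pow_le_pow_right (by omega) (le_max_left _ _)
  have h2 : (n + m) ^ P'.exponent ≤ (n + m) ^ max P.exponent P'.exponent :=
    Nat.pow_le_pow_right (by omega) (le_max_right _ _)
  rw [Prog.exponent, pow_succ]
  nlinarith

theorem wp_ite (hM : 2 ≤ n + m) {b : Test} {P P' : Prog} (h₁ : b.Holds s → WP ω S P s Q)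
    (h₂ : ¬ b.Holds s → WP ω S P' s Q) : WP ω S (.ite b P P') s Q := by
  have h3 : (n + m) ^ P.exponent ≤ (n + m) ^ max P.exponent P'.exponent :=
    Nat.pow_le_pow_right (by omega) (le_max_left _ _)
  have h4 : (n + m) ^ P'.exponent ≤ (n + m) ^ max P.exponent P'.exponent :=
    Nat.pow_le_pow_right (by omega) (le_max_right _ _)
  have h5 : 1 ≤ (n + m) ^ max P.exponent P'.exponent := Nat.one_le_pow _ _ (by omega)
  by_cases hb : b.Holds s
  · obtain ⟨s', T, he, hT, hQ⟩ := h₁ hb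
    refine ⟨s', _, .ite_true hb he, ?_, hQ⟩
    rw [Prog.exponent, pow_succ]
    nlinarith
  · obtain ⟨s', T, he, hT, hQ⟩ := h₂ hb
    refine ⟨s', _, .ite_false hb he, ?_, hQ⟩
    rw [Prog.exponent, pow_succ]
    nlinarith

/-- `J j` describes the state before round `j`; the induction is on the number of remaining rounds.
Each round costs its body plus one test, and the last `+ 1` is the failing test. -/
theorem exec_while (K : ℕ) {b : Test} {P : Prog} {J : ℕ → State m n → Prop} (N : ℕ)
    (hstep : ∀ j < N, ∀ s, J j s → b.Holds s ∧ ∃ s' T, Exec ω S P s s' T ∧ T ≤ K ∧ J (j + 1) s')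
    (hend : ∀ s, J N s → ¬ b.Holds s) (j : ℕ) (hj : j ≤ N) (s : State m n) (hs : J j s) :
    ∃ s' T, Exec ω S (.while b P) s s' T ∧ T ≤ (N - j) * (K + 1) + 1 ∧ J N s' := by
  induction hk : N - j generalizing j s with
  | zero =>
    obtain rfl : j = N := by omega
    exact ⟨s, 1, .while_false (hend s hs), by omega, hs⟩
  | succ l ih =>
    obtain ⟨hb, s', T, he, hT, hJ⟩ := hstep j (by omega) s hs
    obtain ⟨s'', T', he', hT', hJ'⟩ := ih (j + 1) (by omega) s' hJ (by omega)
    refine ⟨s'', _, .while_true hb he he', ?_, hJ'⟩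
    rw [add_mul]
    omega

/-- The rule for counting loops. -/
theorem wp_for (hM : 2 ≤ n + m) {i r : ℕ} {P : Prog} (I : ℕ → State m n → Prop)
    (hN : s.reg r ≤ (n + m) ^ 3)
    (hi : P.writesReg i = false) (hr : P.writesReg r = false) (hir : i ≠ r)
    (hi' : i ≠ 199) (hr' : r ≠ 199)
    (h0 : I 0 (s.setReg i 0))
    (hstep : ∀ j < s.reg r, ∀ s', Agree (.loop i r P) s s' → s'.reg i = j → I j s' →
      WP ω S P s' fun s'' => I (j + 1) ((s''.setReg 199 1).setReg i (j + 1)))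
    (hQ : ∀ s', Agree (.loop i r P) s s' → I (s.reg r) s' → Q s') :
    WP ω S (.loop i r P) s Q := by
  set N := s.reg r with hNdef
  set K := (n + m) ^ P.exponent + 2 with hK
  have hA0 : Agree (.loop i r P) s (s.setReg i 0) := by
    have := (Exec.natConst (ω := ω) (S := S) s i 0).agree
    refine this.mono ?_ ?_ ?_ ?_ <;>
      simp +contextual [Prog.loop, Prog.writesReg, Prog.writesArr, Prog.draws, Prog.asks]
  have key := exec_while (ω := ω) (S := S) K (b := .natLt i r)
    (P := .seq P (.seq (.natConst 199 1) (.natAdd i i 199)))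
    (J := fun j s' => Agree (.loop i r P) s s' ∧ s'.reg i = j ∧ s'.reg r = N ∧ I j s') N ?_ ?_ 0
    (Nat.zero_le _) (s.setReg i 0) ⟨hA0, ?_, ?_, h0⟩
  · obtain ⟨s', T, he, hT, hA, -, -, hI⟩ := key
    refine ⟨s', _, .seq (.natConst s i 0) he, ?_, hQ s' hA hI⟩
    have e : (Prog.loop i r P).exponent = (max P.exponent 1 + 1 + 5) + 1 := by
      simp [Prog.loop, Prog.exponent]
    rw [e]
    set F := (n + m) ^ max P.exponent 1 with hF
    have h1 : (n + m) ^ P.exponent ≤ F := Nat.pow_le_pow_right (by omega) (le_max_left _ _)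
    have h2 : (n + m) ^ (max P.exponent 1 + 1 + 5 + 1) = F * (n + m) ^ 3 * (n + m) ^ 4 := by
      rw [hF, ← pow_add, ← pow_add]
    -- A round costs at most `K + 1 ≤ 4 * F` steps and there are at most `(n + m) ^ 3` rounds. The
    -- spare factor `(n + m) ^ 4 ≥ 16` absorbs the `4` and the constant overhead.
    have h3 : 2 ^ 4 ≤ (n + m) ^ 4 := Nat.pow_le_pow_left hM 4
    have h4 : 1 ≤ F := Nat.one_le_pow _ _ (by omega)
    have h5 : 1 ≤ (n + m) ^ 3 := Nat.one_le_pow _ _ (by omega)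
    have h6 : (N - 0) * (K + 1) ≤ (n + m) ^ 3 * (4 * F) :=
      Nat.mul_le_mul (by omega) (by omega)
    have h7 : F * (n + m) ^ 3 * 2 ^ 4 ≤ F * (n + m) ^ 3 * (n + m) ^ 4 := Nat.mul_le_mul_left _ h3
    have h8 : 1 * 1 ≤ F * (n + m) ^ 3 := Nat.mul_le_mul h4 h5
    rw [h2]
    nlinarith
  · rintro j hj s' ⟨hA, hij, hrN, hI⟩
    refine ⟨by simp [Test.Holds, hij, hrN, hj], ?_⟩
    obtain ⟨s'', T, he, hT, hI'⟩ := hstep j hj s' hA hij hI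
    have hA'' := he.agree
    have hij' : s''.reg i = j := by rw [hA''.reg i hi, hij]
    refine ⟨_, _, .seq he (.seq (.natConst _ 199 1) (.natAdd _ i i 199)), by omega, ?_, ?_, ?_, ?_⟩
    · refine hA.trans (Agree.trans (hA''.mono ?_ ?_ ?_ ?_) ⟨fun x hx => ?_, fun _ _ => rfl, fun _ => rfl, fun _ => rfl⟩)
      iterate 4 simp +contextual [Prog.loop, Prog.writesReg, Prog.writesArr, Prog.draws, Prog.asks]
      have h1 : ¬ x = i ∧ ¬ x = 199 := by
        constructor <;> rintro rfl <;> simp [Prog.loop, Prog.writesReg] at hx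
      simp [State.setReg, h1.1, h1.2]
    · simp [State.setReg, hij', hi']
    · have h1 : ¬ r = i := fun h => hir h.symm
      simp [State.setReg, h1, hr', hA''.reg r hr, hrN]
    · convert hI' using 2
      simp [State.setReg, hij', hi']
  · rintro s' ⟨-, h1, h2, -⟩
    simp [Test.Holds, h1, h2]
  · simp [State.setReg]
  · have h1 : ¬ r = i := fun h => hir h.symm
    simp [State.setReg, h1, hNdef]

end basic

end BDDtoSLR

namespace BDDtoSLR

variable {m n : ℕ} {ω : ℕ → ℝ} {S : SLRInstance m n → Fin n → ℝ}

/-! ### Proof rules for filling arrays and accumulating sums. -/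

section rules

variable {s : State m n}

theorem Agree.of_loop {i r : ℕ} {P : Prog} {s s' : State m n} (h : Agree P s s') :
    Agree (.loop i r P) s s' := by
  refine h.mono ?_ ?_ ?_ ?_ <;>
    simp +contextual [Prog.loop, Prog.writesReg, Prog.writesArr, Prog.draws, Prog.asks]

/-- The rule for filling a block of the array `C` entry by entry. -/
theorem wp_fill (hM : 2 ≤ n + m) {i r j c : ℕ} {P : Prog} (C o : ℕ) (f : ℕ → ℕ → ℝ)
    (hr : s.reg r ≤ (n + m) ^ 3) (hc : s.reg c ≤ (n + m) ^ 3)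
    (hPi : P.writesReg i = false) (hPr : P.writesReg r = false)
    (hPj : P.writesReg j = false) (hPc : P.writesReg c = false)
    (hd : [i, r, j, c, 199].Nodup)
    (hstep : ∀ a < s.reg r, ∀ b < s.reg c, ∀ s', Agree (.loop i r (.loop j c P)) s s' →
      s'.reg i = a → s'.reg j = b → s'.arr C (o + a) b = s.arr C (o + a) b →
      WP ω S P s' fun s'' => s''.arr C =
        fun x y => if x = o + a ∧ y = b then f a b else s'.arr C x y) :
    WP ω S (.loop i r (.loop j c P)) s fun s' => s'.arr C =
      fun x y => if o ≤ x ∧ x < o + s.reg r ∧ y < s.reg c then f (x - o) y else s.arr C x y := by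
  simp only [List.nodup_cons, List.mem_cons, not_or, List.not_mem_nil, not_false_eq_true,
    and_true, List.nodup_nil] at hd
  obtain ⟨⟨h1, h2, h3, h4⟩, ⟨h5, h6, h7⟩, ⟨h8, h9⟩, h10⟩ := hd
  have e1 : ∀ x, (Prog.loop j c P).writesReg x = false ↔ x ≠ j ∧ x ≠ 199 ∧ P.writesReg x = false := by
    intro x
    simp only [Prog.loop, Prog.writesReg, Bool.or_eq_false_iff, beq_eq_false_iff_ne]
    grind
  refine wp_for hM (fun a s' => s'.arr C = fun x y =>
    if o ≤ x ∧ x < o + a ∧ y < s.reg c then f (x - o) y else s.arr C x y) hr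
    ((e1 i).2 ⟨h2, h4, hPi⟩) ((e1 r).2 ⟨h5, h7, hPr⟩) h1 h4 h7 ?_ ?_ ?_
  · funext x y
    have : ¬ (o ≤ x ∧ x < o + 0 ∧ y < s.reg c) := by omega
    rw [if_neg this]
    rfl
  · intro a ha s1 hA1 hi1 hI1
    have hc1 : s1.reg c = s.reg c := by
      refine hA1.reg c ?_
      have := (e1 c).2 ⟨fun h => h8 h.symm, h10, hPc⟩
      simp only [Prog.loop, Prog.writesReg, Bool.or_eq_false_iff, beq_eq_false_iff_ne] at this ⊢
      grind
    -- Invariant of the inner loop: the rows before `a` are complete, and row `a` is complete up to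
    -- column `b`.
    refine wp_for hM (fun b s' => s'.arr C = fun x y =>
      if (o ≤ x ∧ x < o + a ∧ y < s.reg c) ∨ (x = o + a ∧ y < b) then f (x - o) y
      else s.arr C x y) (hc1 ▸ hc) hPj hPc h8 h9 h10 ?_ ?_ ?_
    · refine hI1.trans ?_
      funext x y
      refine if_congr ?_ rfl rfl
      omega
    · intro b hb s2 hA2 hj2 hI2
      refine (hstep a ha b (hc1 ▸ hb) s2 (hA1.trans hA2.of_loop) ?_ hj2 ?_).conseq ?_
      · rw [hA2.reg i ((e1 i).2 ⟨h2, h4, hPi⟩), hi1]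
      -- The entry about to be filled still has its initial value. This lets a loop body update the
      -- array `C` in place.
      · rw [hI2]
        exact if_neg (by omega)
      · intro s3 _ h3
        refine h3.trans ?_
        funext x y
        rw [hI2]
        by_cases hx : x = o + a ∧ y = b
        · rw [if_pos hx, if_pos (by omega), hx.1, hx.2]
          simp
        · rw [if_neg hx]
          refine if_congr ?_ rfl rfl
          omega
    · intro s2 hA2 hI2
      refine hI2.trans ?_
      funext x y
      refine if_congr ?_ rfl rfl
      omega
  · intro s' _ h
    exact h

/-- The rule for accumulating a sum in the entry `(x₀, y₀)` of the array `C`. -/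
theorem wp_sum (hM : 2 ≤ n + m) {i r : ℕ} {P : Prog} (C x₀ y₀ : ℕ) (g : ℕ → ℝ)
    (hr : s.reg r ≤ (n + m) ^ 3)
    (hPi : P.writesReg i = false) (hPr : P.writesReg r = false) (hd : [i, r, 199].Nodup)
    (hstep : ∀ a < s.reg r, ∀ s', Agree (.loop i r P) s s' → s'.reg i = a →
      WP ω S P s' fun s'' => s''.arr C =
        fun x y => if x = x₀ ∧ y = y₀ then s'.arr C x₀ y₀ + g a else s'.arr C x y) :
    WP ω S (.loop i r P) s fun s' => s'.arr C =
      fun x y => if x = x₀ ∧ y = y₀ then s.arr C x₀ y₀ + ∑ a ∈ Finset.range (s.reg r), g a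
        else s.arr C x y := by
  simp only [List.nodup_cons, List.mem_cons, not_or, List.not_mem_nil, not_false_eq_true,
    and_true, List.nodup_nil] at hd
  refine wp_for hM (fun N s' => s'.arr C = fun x y => if x = x₀ ∧ y = y₀ then
    s.arr C x₀ y₀ + ∑ a ∈ Finset.range N, g a else s.arr C x y) hr hPi hPr hd.1.1 hd.1.2 hd.2
    ?_ ?_ ?_
  · funext x y
    by_cases h : x = x₀ ∧ y = y₀
    · rw [if_pos h, h.1, h.2]
      simp [State.setReg]
    · rw [if_neg h]
      rfl
  · intro a ha s' hA hi hI
    refine (hstep a ha s' hA hi).conseq fun s'' _ h => ?_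
    refine h.trans ?_
    funext x y
    rw [hI]
    by_cases h : x = x₀ ∧ y = y₀
    · simp only [if_pos h, Finset.sum_range_succ, and_self, if_true]
      ring
    · simp only [if_neg h]
  · intro s' _ h
    exact h

end rules

/-! ## Arithmetic of natural numbers -/

namespace Prog

/-- Register `112` becomes the product of the registers `110` and `111`. -/
def mul : Prog := .seq (.natConst 112 0) (.loop 114 110 (.natAdd 112 112 111))

/-- Register `112` becomes `2` to the power of register `110`. -/
def powTwo : Prog := .seq (.natConst 112 1) (.loop 114 110 (.natAdd 112 112 112))

/-- The registers `112`, `113` become the quotient and the remainder of register `110` divided by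
register `111`. -/
def divMod : Prog :=
  .seq (.natConst 112 0) (.seq (.natAdd 113 110 112) (.loop 114 110
    (.ite (.natLt 113 111) .skip
      (.seq (.natSub 113 113 111) (.seq (.natConst 115 1) (.natAdd 112 112 115))))))

end Prog

section nat

variable {s : State m n}

theorem wp_mul (hM : 2 ≤ n + m) (h : s.reg 110 ≤ (n + m) ^ 3) :
    WP ω S .mul s fun s' => s'.reg 112 = s.reg 110 * s.reg 111 := by
  refine wp_seq hM (wp_natConst hM ?_)
  refine wp_for hM (fun j s' => s'.reg 112 = j * s.reg 111) ?_ rfl rfl (by decide) (by decide)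
    (by decide) ?_ ?_ ?_
  · simpa [State.setReg] using h
  · simp [State.setReg]
  · intro j hj s' hA _ hI
    have h1 : s'.reg 111 = s.reg 111 := by rw [hA.reg 111 rfl]; rfl
    refine wp_natAdd hM ?_
    simp [State.setReg, hI, h1]
    ring
  · intro s' hA h
    simpa [State.setReg] using h

theorem wp_powTwo (hM : 2 ≤ n + m) (h : s.reg 110 ≤ (n + m) ^ 3) :
    WP ω S .powTwo s fun s' => s'.reg 112 = 2 ^ s.reg 110 := by
  refine wp_seq hM (wp_natConst hM ?_)
  refine wp_for hM (fun j s' => s'.reg 112 = 2 ^ j) ?_ rfl rfl (by decide) (by decide)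
    (by decide) ?_ ?_ ?_
  · simpa [State.setReg] using h
  · simp [State.setReg]
  · intro j hj s' hA _ hI
    refine wp_natAdd hM ?_
    simp [State.setReg, hI]
    ring
  · intro s' hA h
    simpa [State.setReg] using h

/-- Division by repeated subtraction, with the dividend itself as the number of rounds. The
invariant says that after `j` rounds either the remainder is already reduced or the quotient has
reached `j`. -/
theorem wp_divMod (hM : 2 ≤ n + m) (h : s.reg 110 ≤ (n + m) ^ 3) (h0 : 0 < s.reg 111) :
    WP ω S .divMod s fun s' =>
      s'.reg 112 = s.reg 110 / s.reg 111 ∧ s'.reg 113 = s.reg 110 % s.reg 111 := by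
  refine wp_seq hM (wp_natConst hM (wp_seq hM (wp_natAdd hM ?_)))
  refine wp_for hM (fun j s' => s.reg 111 * s'.reg 112 + s'.reg 113 = s.reg 110 ∧
    (s'.reg 113 < s.reg 111 ∨ j ≤ s'.reg 112)) ?_ rfl rfl (by decide) (by decide)
    (by decide) ?_ ?_ ?_
  · simpa [State.setReg] using h
  · simp [State.setReg]
  · intro j hj s' hA _ hI
    have h1 : s'.reg 111 = s.reg 111 := by rw [hA.reg 111 rfl]; rfl
    refine wp_ite hM (fun hb => wp_skip hM ?_) (fun hb => wp_seq hM (wp_natSub hM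
      (wp_seq hM (wp_natConst hM (wp_natAdd hM ?_)))))
    · simp only [Test.Holds, h1] at hb
      simpa [State.setReg, hb] using hI.1
    · simp only [Test.Holds, h1] at hb
      simp only [State.setReg, Nat.reduceEqDiff, ite_true, ite_false, h1, mul_add]
      omega
  · intro s' hA hI
    simp only [State.setReg, Nat.reduceEqDiff, ite_false] at hI
    have h2 : s'.reg 113 < s.reg 111 := by
      rcases hI.2 with h | h
      · exact h
      -- If the quotient has reached the dividend, then divisor times quotient is already at least
      -- the dividend, so the remainder is `0`.
      · have := Nat.le_mul_of_pos_left (s'.reg 112) h0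
        omega
    rw [← hI.1]
    constructor
    · rw [Nat.mul_add_div h0, Nat.div_eq_of_lt h2, add_zero]
    · rw [Nat.mul_add_mod, Nat.mod_eq_of_lt h2]

end nat

/-! ## Matrix arithmetic -/

namespace Prog

/-- The array `C` becomes the product of the arrays `A` and `B`, of sizes `reg r₁ × reg r₂` and
`reg r₂ × reg r₃`. -/
def matMul (C A B r₁ r₂ r₃ : ℕ) : Prog :=
  .seq (.natAdd 120 r₁ 8) (.seq (.natAdd 121 r₂ 8) (.seq (.natAdd 122 r₃ 8)
    (.loop 123 120 (.loop 124 122 (.seq (.realConst ⟨C, 123, 124⟩ 0) (.loop 125 121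
      (.seq (.realOp .times ⟨90, 8, 8⟩ ⟨A, 123, 125⟩ ⟨B, 125, 124⟩)
        (.realOp .plus ⟨C, 123, 124⟩ ⟨C, 123, 124⟩ ⟨90, 8, 8⟩))))))))

end Prog

/-- Register `8` holds `0`: adding it copies a register, and the index pair `8, 8` addresses entry
`(0, 0)`. The bounds `r₂, r₃ < 100` ensure that copying the earlier dimensions into scratch
registers does not destroy the later ones; the conditions on array names exclude aliasing with the
factors and with the scratch array `90`. -/
theorem wp_matMul (hM : 2 ≤ n + m) {s : State m n} {C A B r₁ r₂ r₃ : ℕ}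
    (h₁ : s.reg r₁ ≤ (n + m) ^ 3) (h₂ : s.reg r₂ ≤ (n + m) ^ 3) (h₃ : s.reg r₃ ≤ (n + m) ^ 3)
    (hr₂ : r₂ < 100) (hr₃ : r₃ < 100) (h8 : s.reg 8 = 0)
    (hCA : C ≠ A) (hCB : C ≠ B) (hC : C ≠ 90) (hA : A ≠ 90) (hB : B ≠ 90) :
    WP ω S (.matMul C A B r₁ r₂ r₃) s fun s' => s'.arr C = fun x y =>
      if x < s.reg r₁ ∧ y < s.reg r₃ then
        ∑ l ∈ Finset.range (s.reg r₂), s.arr A x l * s.arr B l y else s.arr C x y := by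
  have e1 : ¬ r₂ = 120 := by omega
  have e2 : ¬ r₃ = 120 := by omega
  have e3 : ¬ r₃ = 121 := by omega
  refine wp_seq hM (wp_natAdd hM (wp_seq hM (wp_natAdd hM (wp_seq hM (wp_natAdd hM ?_)))))
  set s₁ := ((s.setReg 120 _).setReg 121 _).setReg 122 _ with hs₁
  have k1 : s₁.reg 120 = s.reg r₁ := by simp [hs₁, State.setReg, h8]
  have k2 : s₁.reg 121 = s.reg r₂ := by simp [hs₁, State.setReg, h8, e1]
  have k3 : s₁.reg 122 = s.reg r₃ := by simp [hs₁, State.setReg, h8, e2, e3]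
  have k8 : s₁.reg 8 = 0 := by simp [hs₁, State.setReg, h8]
  have ka : s₁.arr = s.arr := rfl
  clear_value s₁
  refine (wp_fill hM C 0 (fun x y => ∑ l ∈ Finset.range (s.reg r₂), s.arr A x l * s.arr B l y)
    (k1 ▸ h₁) (k3 ▸ h₃) rfl rfl rfl rfl (by decide) ?_).conseq ?_
  · intro a ha b hb s₂ hA₂ hi hj _
    have q2 : s₂.reg 121 = s.reg r₂ := by rw [hA₂.reg 121 rfl, k2]
    have q8 : s₂.reg 8 = 0 := by rw [hA₂.reg 8 rfl, k8]
    have qA : s₂.arr A = s.arr A := by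
      rw [hA₂.arr A (by simp [Prog.loop, Prog.writesArr, hCA, hA.symm]), ka]
    have qB : s₂.arr B = s.arr B := by
      rw [hA₂.arr B (by simp [Prog.loop, Prog.writesArr, hCB, hB.symm]), ka]
    refine wp_seq hM (wp_realConst hM ?_)
    refine (wp_sum hM C a b (fun l => s.arr A a l * s.arr B l b) ?_ rfl rfl (by decide) ?_).conseq ?_
    · exact (q2 ▸ h₂ : s₂.reg 121 ≤ _)
    · intro l hl s₃ hA₃ hl3
      have p1 : s₃.reg 123 = a := by rw [hA₃.reg 123 rfl]; exact hi
      have p2 : s₃.reg 124 = b := by rw [hA₃.reg 124 rfl]; exact hj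
      have p8 : s₃.reg 8 = 0 := by rw [hA₃.reg 8 rfl]; exact q8
      have pA : s₃.arr A = s.arr A := by
        rw [hA₃.arr A (by simp [Prog.loop, Prog.writesArr, hCA, hA.symm]), ← qA,
          s₂.set_arr_of_ne _ _ hCA]
      have pB : s₃.arr B = s.arr B := by
        rw [hA₃.arr B (by simp [Prog.loop, Prog.writesArr, hCB, hB.symm]), ← qB,
          s₂.set_arr_of_ne _ _ hCB]
      refine wp_seq hM (wp_realOp hM (wp_realOp hM ?_))
      funext x y
      simp [State.set, State.get, RealOp.eval, p1, p2, p8, hl3, pA, pB, hC]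
    · intro s₃ hA₃ h3
      rw [h3]
      funext x y
      have t2 : (s₂.set ⟨C, 123, 124⟩ ((0 : ℚ) : ℝ)).reg 121 = s.reg r₂ := q2
      simp only [t2]
      simp +contextual [State.set, hi, hj]
  · intro s₂ hA₂ h
    rw [h]
    simp [k1, k3, ka]

end BDDtoSLR

namespace BDDtoSLR

/-! ## The reduction as a function -/

section pure

variable {m n d : ℕ}

/-- The Gaussian matrix read off the random tape, row by row. -/
def gaussMat (p d : ℕ) (ω : ℕ → ℝ) : Matrix (Fin p) (Fin d) ℝ := fun i j => ω (i * d + j)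

/-- An upper bound for the sum of the absolute values of the entries of `B`. -/
def entryBound (B : Matrix (Fin d) (Fin d) ℝ) : ℝ := ∑ i, ∑ j, (1 + B i j * B i j)

/-- The weight of the partite block of the design matrix. -/
def weight (m : ℕ) (B : Matrix (Fin d) (Fin d) ℝ) (δ : ℝ) : ℝ :=
  ∑ _i ∈ Finset.range m, (entryBound B + δ) * 100

/-- The top block of the design matrix. -/
def topBlock (k m n : ℕ) (B : Matrix (Fin d) (Fin d) ℝ) (ω : ℕ → ℝ) :
    Matrix (Fin (m - k)) (Fin n) ℝ :=
  gaussMat (m - k) d ω * B * gSparse d k n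

/-- The regression instance with error parameter `δ`. -/
def slrQuery (k m n : ℕ) (B : Matrix (Fin d) (Fin d) ℝ) (t : Fin d → ℝ) (ω : ℕ → ℝ) (δ : ℝ) :
    SLRInstance m n where
  X := stack (topBlock k m n B ω) (weight m B δ • gPartite n k)
  y := fun i => if h : (i : ℕ) < m - k then (gaussMat (m - k) d ω *ᵥ t) ⟨i, h⟩ else weight m B δ
  δ := δ

/-- The sign vector encoded by a sparse vector. -/
noncomputable def decode (d k : ℕ) {n : ℕ} (θ : Fin n → ℝ) : Fin d → ℝ := fun i =>
  if 0 < (gSparse d k n *ᵥ θ) i then 1 else -1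

/-- The squared length of a vector. -/
def sqSum (v : Fin d → ℝ) : ℝ := ∑ i, v i * v i

/-- Halve `w` if its square exceeds `4 * σ`. -/
noncomputable def halveIf (σ w : ℝ) : ℝ := if 4 * σ < w * w then w / 2 else w

/-- An approximation from above, up to a factor `2`, of the length of a vector. -/
noncomputable def approxNorm (v : Fin d → ℝ) : ℝ := (halveIf (sqSum v))^[d] (∑ i, |v i|)

/-- The error parameter chosen when the current residual is `v`. -/
noncomputable def errParam (v : Fin d → ℝ) : ℝ := if 0 < approxNorm v then approxNorm v / 6 else 1

/-- One step of the iterative improvement of a candidate solution. -/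
noncomputable def improve (k m n : ℕ) (B : Matrix (Fin d) (Fin d) ℝ) (t : Fin d → ℝ) (ω : ℕ → ℝ)
    (S : SLRInstance m n → Fin n → ℝ) (z : Fin d → ℝ) : Fin d → ℝ :=
  if sqSum (B *ᵥ (decode d k (S (slrQuery k m n B t ω (errParam (B *ᵥ z - t))))) - t) <
    sqSum (B *ᵥ z - t) then decode d k (S (slrQuery k m n B t ω (errParam (B *ᵥ z - t)))) else z

end pure

/-! ## The programs -/

namespace Prog

/-- Register `r` becomes the quotient of the registers `a` and `b`, and `r'` the remainder. -/
def quoRem (r r' a b : ℕ) : Prog :=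
  .seq (.natAdd 110 a 8) (.seq (.natAdd 111 b 8) (.seq .divMod
    (.seq (.natAdd r 112 8) (.natAdd r' 113 8))))

/-- Register `r` becomes the product of the registers `a` and `b`. -/
def prod (r a b : ℕ) : Prog :=
  .seq (.natAdd 110 a 8) (.seq (.natAdd 111 b 8) (.seq .mul (.natAdd r 112 8)))

/-- Register `r` becomes `2` to the power of register `a`. -/
def powOf (r a : ℕ) : Prog := .seq (.natAdd 110 a 8) (.seq .powTwo (.natAdd r 112 8))

/-- Compute the dimensions `n`, `d / k`, `n / k`, `m - k`. -/
def dims : Prog :=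
  .seq (.natConst 7 1) (.seq (.quoRem 4 20 0 1) (.seq (.powOf 5 4)
    (.seq (.prod 3 1 5) (.natSub 6 2 1))))

/-- Entry `(reg 10, reg 11)` of `gSparse`. -/
def sparseEntry : Prog :=
  .seq (.quoRem 20 21 10 4) (.seq (.quoRem 22 23 11 5)
    (.ite (.natLt 20 22) (.realConst ⟨4, 10, 11⟩ 0)
      (.ite (.natLt 22 20) (.realConst ⟨4, 10, 11⟩ 0)
        (.seq (.powOf 24 21) (.seq (.quoRem 25 26 23 24) (.seq (.natConst 27 2)
          (.seq (.quoRem 28 29 25 27)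
            (.ite (.natLt 8 29) (.realConst ⟨4, 10, 11⟩ 1) (.realConst ⟨4, 10, 11⟩ (-1))))))))))

/-- Array `4` becomes `gSparse`. -/
def sparseMat : Prog := .loop 10 0 (.loop 11 3 .sparseEntry)

/-- Array `5` becomes a Gaussian matrix. -/
def sample : Prog := .loop 10 6 (.loop 11 0 (.gauss ⟨5, 10, 11⟩))

/-- Array `91` becomes `entryBound B`. -/
def bound : Prog :=
  .seq (.realConst ⟨91, 8, 8⟩ 0) (.loop 10 0 (.loop 11 0
    (.seq (.realConst ⟨93, 8, 8⟩ 1) (.seq (.realOp .times ⟨90, 8, 8⟩ ⟨0, 10, 11⟩ ⟨0, 10, 11⟩)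
      (.seq (.realOp .plus ⟨90, 8, 8⟩ ⟨93, 8, 8⟩ ⟨90, 8, 8⟩)
        (.realOp .plus ⟨91, 8, 8⟩ ⟨91, 8, 8⟩ ⟨90, 8, 8⟩))))))

/-- Compute everything that does not depend on the error parameter. -/
def prepare : Prog :=
  .seq .dims (.seq .sparseMat (.seq .sample (.seq (.matMul 6 5 0 6 0 0)
    (.seq (.matMul 7 6 4 6 0 3) (.seq (.matMul 8 5 1 6 0 7) .bound)))))

/-- Array `92` becomes the weight of the partite block. -/
def setWeight : Prog :=
  .seq (.realOp .plus ⟨93, 8, 8⟩ ⟨91, 8, 8⟩ ⟨9, 8, 8⟩) (.seq (.realConst ⟨94, 8, 8⟩ 100)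
    (.seq (.realOp .times ⟨93, 8, 8⟩ ⟨93, 8, 8⟩ ⟨94, 8, 8⟩) (.seq (.realConst ⟨92, 8, 8⟩ 0)
      (.loop 10 2 (.realOp .plus ⟨92, 8, 8⟩ ⟨92, 8, 8⟩ ⟨93, 8, 8⟩)))))

/-- Fill in the bottom block of the design matrix. -/
def fillPartite : Prog :=
  .loop 10 1 (.loop 11 3 (.seq (.natAdd 12 6 10) (.seq (.quoRem 20 21 11 5)
    (.ite (.natLt 10 20) (.realConst ⟨7, 12, 11⟩ 0) (.ite (.natLt 20 10) (.realConst ⟨7, 12, 11⟩ 0)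
      (.seq (.realConst ⟨7, 12, 11⟩ 0) (.realOp .plus ⟨7, 12, 11⟩ ⟨7, 12, 11⟩ ⟨92, 8, 8⟩)))))))

/-- Fill in the bottom part of the target vector. -/
def fillTarget : Prog :=
  .loop 10 1 (.loop 11 7 (.seq (.natAdd 12 6 10) (.seq (.realConst ⟨8, 12, 11⟩ 0)
    (.realOp .plus ⟨8, 12, 11⟩ ⟨8, 12, 11⟩ ⟨92, 8, 8⟩))))

/-- Array `12` becomes the sign vector encoded by the array `10`. -/
def decodeAnswer : Prog :=
  .seq (.matMul 11 4 10 0 3 7) (.seq (.realConst ⟨95, 8, 8⟩ 0) (.loop 10 0 (.loop 11 7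
    (.ite (.realLt ⟨95, 8, 8⟩ ⟨11, 10, 11⟩) (.realConst ⟨12, 10, 11⟩ 1)
      (.realConst ⟨12, 10, 11⟩ (-1))))))

/-- Query the oracle with the error parameter in array `9` and decode the answer. -/
def ask : Prog :=
  .seq .setWeight (.seq .fillPartite (.seq .fillTarget (.seq (.query 7 8 9 10) .decodeAnswer)))

/-- Copy the vector in array `12` to array `3`. -/
def copy : Prog :=
  .loop 10 0 (.loop 11 7 (.seq (.realConst ⟨3, 10, 11⟩ 0)
    (.realOp .plus ⟨3, 10, 11⟩ ⟨3, 10, 11⟩ ⟨12, 10, 11⟩)))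

/-- The instance map. -/
def instanceMap : Prog :=
  .seq .prepare (.seq (.realConst ⟨93, 8, 8⟩ 6) (.seq (.realOp .quot ⟨9, 8, 8⟩ ⟨2, 8, 8⟩ ⟨93, 8, 8⟩)
    (.seq .ask .copy)))

/-- Array `13` becomes `B * z - t`, with `z` in array `Z`, and array `o` its squared length. -/
def residual (Z o : ℕ) : Prog :=
  .seq (.matMul 13 0 Z 0 0 7) (.seq (.loop 10 0 (.loop 11 7
    (.realOp .minus ⟨13, 10, 11⟩ ⟨13, 10, 11⟩ ⟨1, 10, 11⟩))) (.seq (.realConst ⟨o, 8, 8⟩ 0)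
      (.loop 10 0 (.seq (.realOp .times ⟨90, 8, 8⟩ ⟨13, 10, 8⟩ ⟨13, 10, 8⟩)
        (.realOp .plus ⟨o, 8, 8⟩ ⟨o, 8, 8⟩ ⟨90, 8, 8⟩)))))

/-- Array `16` becomes the sum of the absolute values of the entries of the vector in array `13`. -/
def absSum : Prog :=
  .seq (.realConst ⟨16, 8, 8⟩ 0) (.seq (.realConst ⟨95, 8, 8⟩ 0) (.loop 10 0
    (.ite (.realLt ⟨13, 10, 8⟩ ⟨95, 8, 8⟩) (.realOp .minus ⟨16, 8, 8⟩ ⟨16, 8, 8⟩ ⟨13, 10, 8⟩)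
      (.realOp .plus ⟨16, 8, 8⟩ ⟨16, 8, 8⟩ ⟨13, 10, 8⟩))))

/-- Halve array `16` until its square is at most four times array `15`. -/
def halve : Prog :=
  .seq (.realConst ⟨97, 8, 8⟩ 4) (.seq (.realOp .times ⟨97, 8, 8⟩ ⟨97, 8, 8⟩ ⟨15, 8, 8⟩)
    (.seq (.realConst ⟨98, 8, 8⟩ 2) (.loop 10 0
      (.seq (.realOp .times ⟨90, 8, 8⟩ ⟨16, 8, 8⟩ ⟨16, 8, 8⟩)
        (.ite (.realLt ⟨97, 8, 8⟩ ⟨90, 8, 8⟩)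
          (.realOp .quot ⟨16, 8, 8⟩ ⟨16, 8, 8⟩ ⟨98, 8, 8⟩) .skip)))))

/-- Array `9` becomes the error parameter for the residual in the arrays `13` and `15`. -/
def setErrParam : Prog :=
  .seq .absSum (.seq .halve (.seq (.realConst ⟨95, 8, 8⟩ 0)
    (.ite (.realLt ⟨95, 8, 8⟩ ⟨16, 8, 8⟩)
      (.seq (.realConst ⟨98, 8, 8⟩ 6) (.realOp .quot ⟨9, 8, 8⟩ ⟨16, 8, 8⟩ ⟨98, 8, 8⟩))
      (.realConst ⟨9, 8, 8⟩ 1))))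

/-- One improvement of the candidate solution in array `3`. -/
def improvement : Prog :=
  .seq (.residual 3 15) (.seq .setErrParam (.seq .ask (.seq (.residual 12 17)
    (.ite (.realLt ⟨17, 8, 8⟩ ⟨15, 8, 8⟩) .copy .skip))))

/-- The reduction without an estimate. -/
def reduction : Prog :=
  .seq .prepare (.seq (.loop 10 0 (.loop 11 7 (.realConst ⟨3, 10, 11⟩ 1)))
    (.seq (.prod 9 2 2) (.seq (.prod 9 2 9) (.loop 13 9 .improvement))))

end Prog

/-! ## Correctness of the programs -/

variable {m n : ℕ} {ω : ℕ → ℝ} {S : SLRInstance m n → Fin n → ℝ}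

section nat

variable {s : State m n} {Q : State m n → Prop}

theorem wp_quoRem (hM : 2 ≤ n + m) {r r' a b : ℕ} (h8 : s.reg 8 = 0)
    (ha : s.reg a ≤ (n + m) ^ 3) (hb : 0 < s.reg b) (hb' : b < 100) (hr : r < 100) (hrr : r ≠ r')
    (hr8 : r ≠ 8) :
    WP ω S (.quoRem r r' a b) s fun s' =>
      s'.reg r = s.reg a / s.reg b ∧ s'.reg r' = s.reg a % s.reg b := by
  have e1 : ¬ b = 110 := by omega
  have e2 : ¬ r = 113 := by omega
  refine wp_seq hM (wp_natAdd hM (wp_seq hM (wp_natAdd hM (wp_seq hM ?_))))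
  refine (wp_divMod hM ?_ ?_).conseq fun s' hA h => ?_
  · simpa [State.setReg, h8] using ha
  · simpa [State.setReg, h8, e1] using hb
  · have h8' : s'.reg 8 = 0 := by rw [hA.reg 8 rfl]; simpa [State.setReg] using h8
    refine wp_seq hM (wp_natAdd hM (wp_natAdd hM ?_))
    simp only [State.setReg, h8, e1] at h
    simp [State.setReg, h, h8', hrr, Ne.symm e2, Ne.symm hr8]

theorem wp_prod (hM : 2 ≤ n + m) {r a b : ℕ} (h8 : s.reg 8 = 0)
    (ha : s.reg a ≤ (n + m) ^ 3) (hb' : b < 100) :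
    WP ω S (.prod r a b) s fun s' => s'.reg r = s.reg a * s.reg b := by
  have e1 : ¬ b = 110 := by omega
  refine wp_seq hM (wp_natAdd hM (wp_seq hM (wp_natAdd hM (wp_seq hM ?_))))
  refine (wp_mul hM ?_).conseq fun s' hA h => ?_
  · simpa [State.setReg, h8] using ha
  · have h8' : s'.reg 8 = 0 := by rw [hA.reg 8 rfl]; simpa [State.setReg] using h8
    refine wp_natAdd hM ?_
    simp only [State.setReg, h8, e1] at h
    simp [State.setReg, h, h8']

theorem wp_powOf (hM : 2 ≤ n + m) {r a : ℕ} (h8 : s.reg 8 = 0) (ha : s.reg a ≤ (n + m) ^ 3) :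
    WP ω S (.powOf r a) s fun s' => s'.reg r = 2 ^ s.reg a := by
  refine wp_seq hM (wp_natAdd hM (wp_seq hM ?_))
  refine (wp_powTwo hM ?_).conseq fun s' hA h => ?_
  · simpa [State.setReg, h8] using ha
  · have h8' : s'.reg 8 = 0 := by rw [hA.reg 8 rfl]; simpa [State.setReg] using h8
    refine wp_natAdd hM ?_
    simp only [State.setReg, h8] at h
    simp [State.setReg, h, h8']

end nat

/-- The arithmetic relations between the parameters. -/
structure Params (d k m n : ℕ) : Prop where
  d_pos : 0 < d
  dvd : k ∣ d
  le : 17 * d ≤ m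
  eq : n = k * 2 ^ (d / k)

namespace Params

variable {d k m n : ℕ} (h : Params d k m n)
include h

theorem k_pos : 0 < k := Nat.pos_of_dvd_of_pos h.dvd h.d_pos

theorem k_le : k ≤ d := Nat.le_of_dvd h.d_pos h.dvd

theorem div_pos : 0 < d / k := Nat.div_pos h.k_le h.k_pos

theorem n_div : n / k = 2 ^ (d / k) := by rw [h.eq, Nat.mul_div_cancel_left _ h.k_pos]

theorem n_div_pos : 0 < n / k := by rw [h.n_div]; positivity

theorem mul_n_div : k * (n / k) = n := by rw [h.n_div, h.eq]

theorem mul_div : k * (d / k) = d := Nat.mul_div_cancel' h.dvd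

theorem n_pos : 0 < n := by rw [← h.mul_n_div]; exact Nat.mul_pos h.k_pos h.n_div_pos

theorem two_le : 2 ≤ n + m := by have := h.n_pos; have := h.d_pos; have := h.le; omega

end Params

theorem le_cube_of_le {m n x : ℕ} (hx : x ≤ n + m) : x ≤ (n + m) ^ 3 :=
  hx.trans (Nat.le_self_pow (by norm_num) _)

/-- The contents of the registers holding the dimensions. -/
structure Dims (d k m n : ℕ) (s : State m n) : Prop where
  r0 : s.reg 0 = d
  r1 : s.reg 1 = k
  r2 : s.reg 2 = m
  r3 : s.reg 3 = n
  r4 : s.reg 4 = d / k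
  r5 : s.reg 5 = n / k
  r6 : s.reg 6 = m - k
  r7 : s.reg 7 = 1
  r8 : s.reg 8 = 0

/-- Registers below `9` are reserved for the dimensions and the constants `0` and `1`; after
`Prog.dims` no program writes to them. -/
theorem Dims.of_agree {d k : ℕ} {P : Prog} {s s' : State m n} (h : Dims d k m n s)
    (hA : Agree P s s') (hP : ∀ r < 9, P.writesReg r = false) : Dims d k m n s' := by
  obtain ⟨h0, h1, h2, h3, h4, h5, h6, h7, h8⟩ := h
  constructor <;> rwa [hA.reg _ (hP _ (by norm_num))]

theorem Dims.setReg {d k : ℕ} {s : State m n} (h : Dims d k m n s) {r v : ℕ} (hr : 9 ≤ r) :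
    Dims d k m n (s.setReg r v) :=
  h.of_agree (Exec.natConst (ω := 0) (S := fun _ _ => 0) s r v).agree fun x hx => by
    simp only [Prog.writesReg, beq_eq_false_iff_ne]
    omega

variable {d k : ℕ}

theorem wp_dims (hp : Params d k m n) {s : State m n} (h0 : s.reg 0 = d) (h1 : s.reg 1 = k)
    (h2 : s.reg 2 = m) (h8 : s.reg 8 = 0) : WP ω S .dims s (Dims d k m n) := by
  have hM := hp.two_le
  have hk := hp.k_le
  have hle := hp.le
  have hdd : d / k ≤ d := Nat.div_le_self _ _
  refine wp_seq hM (wp_natConst hM (wp_seq hM ?_))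
  refine (wp_quoRem hM ?_ ?_ ?_ (by norm_num) (by norm_num) (by norm_num) (by norm_num)).conseq
    fun s₁ hA₁ h₁ => ?_
  · simpa [State.setReg] using h8
  · simpa [State.setReg, h0] using le_cube_of_le (by omega : d ≤ n + m)
  · simpa [State.setReg, h1] using hp.k_pos
  simp only [State.setReg, h0, h1, ite_false, OfNat.zero_ne_ofNat,
    OfNat.one_ne_ofNat] at h₁
  refine wp_seq hM ?_
  refine (wp_powOf hM (by rw [hA₁.reg 8 rfl]; exact h8) ?_).conseq fun s₂ hA₂ h₂ => ?_
  · rw [h₁.1]; exact le_cube_of_le (by omega)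
  refine wp_seq hM ?_
  refine (wp_prod hM ?_ ?_ (by norm_num)).conseq fun s₃ hA₃ h₃ => ?_
  · rw [hA₂.reg 8 rfl, hA₁.reg 8 rfl]; exact h8
  · rw [hA₂.reg 1 rfl, hA₁.reg 1 rfl]
    exact (show k ≤ _ from le_cube_of_le (by omega)).trans' h1.le
  rw [h₁.1] at h₂
  have g1 : s₂.reg 1 = k := by rw [hA₂.reg 1 rfl, hA₁.reg 1 rfl]; exact h1
  rw [h₂, g1, ← hp.eq] at h₃
  refine wp_natSub hM ?_
  constructor <;> simp only [State.setReg, Nat.reduceEqDiff, ite_true, ite_false,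
    OfNat.zero_ne_ofNat, OfNat.one_ne_ofNat]
  · rw [hA₃.reg 0 rfl, hA₂.reg 0 rfl, hA₁.reg 0 rfl]; exact h0
  · rw [hA₃.reg 1 rfl, hA₂.reg 1 rfl, hA₁.reg 1 rfl]; exact h1
  · rw [hA₃.reg 2 rfl, hA₂.reg 2 rfl, hA₁.reg 2 rfl]; exact h2
  · exact h₃
  · rw [hA₃.reg 4 rfl, hA₂.reg 4 rfl, h₁.1]
  · rw [hA₃.reg 5 rfl, h₂, hp.n_div]
  · rw [hA₃.reg 2 rfl, hA₂.reg 2 rfl, hA₁.reg 2 rfl, hA₃.reg 1 rfl, g1]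
    exact congrArg (· - k) h2
  · rw [hA₃.reg 7 rfl, hA₂.reg 7 rfl, hA₁.reg 7 rfl]; rfl
  · rw [hA₃.reg 8 rfl, hA₂.reg 8 rfl, hA₁.reg 8 rfl]; exact h8

/-- The entries of `gSparse`, indexed by natural numbers. -/
def sparseCoeff (d k n i j : ℕ) : ℝ :=
  if i / (d / k) = j / (n / k) then if (j % (n / k)).testBit (i % (d / k)) then 1 else -1 else 0

/-- The machine tests only strict inequality, so equality of the two block indices is recognised by
the failure of both comparisons. A bit is read as the parity of the quotient by a power of two. -/
theorem wp_sparseEntry (hp : Params d k m n) {s : State m n} (hs : Dims d k m n s)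
    {a b : ℕ} (ha : a < d) (hb : b < n) (hsa : s.reg 10 = a) (hsb : s.reg 11 = b) :
    WP ω S .sparseEntry s fun s' => s'.arr 4 =
      fun x y => if x = a ∧ y = b then sparseCoeff d k n a b else s.arr 4 x y := by
  have hM := hp.two_le
  have hle := hp.le
  have e1 : a ≤ (n + m) ^ 3 := le_cube_of_le (by omega)
  have e2 : b ≤ (n + m) ^ 3 := le_cube_of_le (by omega)
  refine wp_seq hM ((wp_quoRem hM hs.r8 (hsa ▸ e1) (hs.r4 ▸ hp.div_pos) (by norm_num)
    (by norm_num) (by norm_num) (by norm_num)).conseq fun s₁ hA₁ h₁ => ?_)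
  have hs₁ := hs.of_agree hA₁ (by decide)
  have g10 : s₁.reg 10 = a := by rw [hA₁.reg 10 rfl, hsa]
  have g11 : s₁.reg 11 = b := by rw [hA₁.reg 11 rfl, hsb]
  have ga : s₁.arr 4 = s.arr 4 := hA₁.arr 4 rfl
  rw [hsa, hs.r4] at h₁
  refine wp_seq hM ((wp_quoRem hM hs₁.r8 (g11 ▸ e2) (hs₁.r5 ▸ hp.n_div_pos) (by norm_num)
    (by norm_num) (by norm_num) (by norm_num)).conseq fun s₂ hA₂ h₂ => ?_)
  have hs₂ := hs₁.of_agree hA₂ (by decide)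
  rw [← hA₁.arr 4 rfl, ← hA₂.arr 4 rfl]
  have q10 : s₂.reg 10 = a := by rw [hA₂.reg 10 rfl, g10]
  have q11 : s₂.reg 11 = b := by rw [hA₂.reg 11 rfl, g11]
  rw [g11, hs₁.r5] at h₂
  have q20 : s₂.reg 20 = a / (d / k) := by rw [hA₂.reg 20 rfl, h₁.1]
  have q21 : s₂.reg 21 = a % (d / k) := by rw [hA₂.reg 21 rfl, h₁.2]
  obtain ⟨q22, q23⟩ := h₂
  have fin : ∀ (s₃ : State m n) (c : ℚ), s₃.reg 10 = a → s₃.reg 11 = b → s₃.arr 4 = s₂.arr 4 →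
      ((c : ℝ) = sparseCoeff d k n a b) → (s₃.set ⟨4, 10, 11⟩ (c : ℝ)).arr 4 =
        fun x y => if x = a ∧ y = b then sparseCoeff d k n a b else s₂.arr 4 x y := by
    intro s₃ c h10 h11 ha hc
    funext x y
    simp [State.set, h10, h11, ha, hc]
  refine wp_ite hM (fun hlt => wp_realConst hM (fin s₂ 0 q10 q11 rfl ?_)) (fun hlt =>
    wp_ite hM (fun hlt' => wp_realConst hM (fin s₂ 0 q10 q11 rfl ?_)) fun hlt' => ?_)
  · simp only [Test.Holds, q20, q22] at hlt
    simp [sparseCoeff, hlt.ne]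
  · simp only [Test.Holds, q20, q22] at hlt'
    simp [sparseCoeff, hlt'.ne']
  simp only [Test.Holds, q20, q22] at hlt hlt'
  have heq : a / (d / k) = b / (n / k) := by omega
  have e3 : a % (d / k) ≤ (n + m) ^ 3 := (Nat.mod_le _ _).trans e1
  have e4 : b % (n / k) ≤ (n + m) ^ 3 := (Nat.mod_le _ _).trans e2
  refine wp_seq hM ((wp_powOf hM hs₂.r8 (q21 ▸ e3)).conseq fun s₃ hA₃ h₃ => ?_)
  have hs₃ := hs₂.of_agree hA₃ (by decide)
  rw [q21] at h₃
  have g23 : s₃.reg 23 = b % (n / k) := by rw [hA₃.reg 23 rfl, q23]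
  refine wp_seq hM ((wp_quoRem hM hs₃.r8 (g23 ▸ e4) (by rw [h₃]; positivity) (by norm_num)
    (by norm_num) (by norm_num) (by norm_num)).conseq fun s₄ hA₄ h₄ => ?_)
  have hs₄ := hs₃.of_agree hA₄ (by decide)
  rw [g23, h₃] at h₄
  refine wp_seq hM (wp_natConst hM (wp_seq hM ((wp_quoRem hM ?_ ?_ ?_ (by norm_num)
    (by norm_num) (by norm_num) (by norm_num)).conseq fun s₅ hA₅ h₅ => ?_)))
  · exact hs₄.r8
  · refine le_trans (le_of_eq h₄.1) ((Nat.div_le_self _ _).trans e4)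
  · simp [State.setReg]
  · simp only [State.setReg, Nat.reduceEqDiff, ite_true, ite_false, h₄.1] at h₅
    have k8 : s₅.reg 8 = 0 := by rw [hA₅.reg 8 rfl]; exact hs₄.r8
    have k10 : s₅.reg 10 = a := by
      rw [hA₅.reg 10 rfl]
      exact (hA₄.reg 10 rfl).trans ((hA₃.reg 10 rfl).trans q10)
    have k11 : s₅.reg 11 = b := by
      rw [hA₅.reg 11 rfl]
      exact (hA₄.reg 11 rfl).trans ((hA₃.reg 11 rfl).trans q11)
    have ka : s₅.arr 4 = s₂.arr 4 := by
      rw [hA₅.arr 4 rfl]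
      exact (hA₄.arr 4 rfl).trans (hA₃.arr 4 rfl)
    refine wp_ite hM (fun hb => wp_realConst hM (fin s₅ 1 k10 k11 ka ?_))
      (fun hb => wp_realConst hM (fin s₅ (-1) k10 k11 ka ?_))
    · simp only [Test.Holds, k8, h₅.2] at hb
      have : (b % (n / k)).testBit (a % (d / k)) = true := by
        rw [Nat.testBit_eq_decide_div_mod_eq, decide_eq_true_iff]
        omega
      simp [sparseCoeff, heq, this]
    · simp only [Test.Holds, k8, h₅.2] at hb
      have : (b % (n / k)).testBit (a % (d / k)) = false := by
        rw [Nat.testBit_eq_decide_div_mod_eq, decide_eq_false_iff_not]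
        omega
      simp [sparseCoeff, heq, this]

theorem wp_sparseMat (hp : Params d k m n) {s : State m n} (hs : Dims d k m n s) :
    WP ω S .sparseMat s fun s' => ∀ (i : Fin d) (j : Fin n), s'.arr 4 i j = gSparse d k n i j := by
  have hM := hp.two_le
  have hle := hp.le
  refine (wp_fill hM 4 0 (sparseCoeff d k n) ?_ ?_ rfl rfl rfl rfl (by decide) ?_).conseq ?_
  · exact hs.r0 ▸ le_cube_of_le (by omega)
  · exact hs.r3.le.trans (le_cube_of_le (by omega))
  · intro a ha b hb s₁ hA hi hj _
    rw [hs.r0] at ha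
    rw [hs.r3] at hb
    refine (wp_sparseEntry hp (hs.of_agree hA (by decide)) ha hb hi hj).conseq fun s₂ _ h => ?_
    rw [h]
    simp
  · intro s' _ h i j
    rw [h]
    simp [hs.r0, hs.r3, sparseCoeff, gSparse]

/-- The draw counter belongs to the invariant: entry `(x, y)` receives the tape value at position `x
* d + y` only because nothing was drawn before. -/
theorem wp_sample (hp : Params d k m n) {s : State m n} (hs : Dims d k m n s)
    (h0 : s.drawn = 0) : WP ω S .sample s fun s' =>
      ∀ (i : Fin (m - k)) (j : Fin d), s'.arr 5 i j = gaussMat (m - k) d ω i j := by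
  have hM := hp.two_le
  have hle := hp.le
  refine wp_for hM (fun a s' => s'.drawn = a * d ∧ ∀ x < a, ∀ y < d, s'.arr 5 x y = ω (x * d + y))
    ?_ rfl rfl (by decide) (by decide) (by decide) ?_ ?_ ?_
  · exact hs.r6 ▸ le_cube_of_le (by omega)
  · exact ⟨by simp [State.setReg, h0], by simp⟩
  · intro a ha s₁ hA₁ hi hI
    have hs₁ := hs.of_agree hA₁ (by decide)
    refine wp_for hM (fun b s' => s'.drawn = a * d + b ∧
      ∀ x y, (x < a ∧ y < d) ∨ (x = a ∧ y < b) → s'.arr 5 x y = ω (x * d + y))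
      ?_ rfl rfl (by decide) (by decide) (by decide) ?_ ?_ ?_
    · exact hs₁.r0 ▸ le_cube_of_le (by omega)
    · refine ⟨hI.1, fun x y h => ?_⟩
      exact hI.2 x (by omega) y (by omega)
    · intro b hb s₂ hA₂ hj hI₂
      rw [hs₁.r0] at hb
      refine wp_gauss hM ⟨?_, ?_⟩
      · simp [State.setReg, hI₂.1, add_assoc]
      · intro x y hxy
        have h10 : s₂.reg 10 = a := by rw [hA₂.reg 10 rfl, hi]
        simp only [State.setReg, State.set, true_and, h10, hj]
        by_cases hxy' : x = a ∧ y = b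
        · rw [if_pos hxy', hI₂.1, hxy'.1, hxy'.2]
        · rw [if_neg hxy']
          exact hI₂.2 x y (by omega)
    · intro s₂ hA₂ h
      rw [hs₁.r0] at h
      refine ⟨?_, fun x hx y hy => h.2 x y (by omega)⟩
      rw [add_mul, one_mul]
      exact h.1
  · intro s' _ h i j
    rw [hs.r6] at h
    exact h.2 i i.2 j j.2

end BDDtoSLR

namespace BDDtoSLR

/-! ### Preparation, construction of a query, and decoding of its answer. -/

variable {m n d k : ℕ} {ω : ℕ → ℝ} {S : SLRInstance m n → Fin n → ℝ}

/-- The state after the preparation: everything that does not depend on the error parameter has been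
computed. -/
structure Ready (k : ℕ) (B : Matrix (Fin d) (Fin d) ℝ) (t : Fin d → ℝ) (ω : ℕ → ℝ)
    (s : State m n) : Prop where
  dims : Dims d k m n s
  mat : ∀ i j : Fin d, s.arr 0 i j = B i j
  target : ∀ i : Fin d, s.arr 1 i 0 = t i
  gadget : ∀ (i : Fin d) (j : Fin n), s.arr 4 i j = gSparse d k n i j
  top : ∀ (i : Fin (m - k)) (j : Fin n), s.arr 7 i j = topBlock k m n B ω i j
  rhs : ∀ i : Fin (m - k), s.arr 8 i 0 = (gaussMat (m - k) d ω *ᵥ t) i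
  bound : s.arr 91 0 0 = entryBound B

variable {B : Matrix (Fin d) (Fin d) ℝ} {t : Fin d → ℝ}

theorem Ready.of_agree {P : Prog} {s s' : State m n} (h : Ready k B t ω s)
    (hA : Agree P s s') (hP : ∀ r < 9, P.writesReg r = false)
    (hP' : ∀ a ∈ [0, 1, 4, 7, 8, 91], P.writesArr a = false) : Ready k B t ω s' := by
  obtain ⟨h0, h1, h2, h3, h4, h5, h6⟩ := h
  refine ⟨h0.of_agree hA hP, ?_, ?_, ?_, ?_, ?_, ?_⟩ <;> rwa [hA.arr _ (hP' _ (by decide))]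

theorem wp_bound (hp : Params d k m n) {s : State m n} (hs : Dims d k m n s)
    (hB : ∀ i j : Fin d, s.arr 0 i j = B i j) :
    WP ω S .bound s fun s' => s'.arr 91 0 0 = entryBound B := by
  have hM := hp.two_le
  have hle := hp.le
  have hd : d ≤ (n + m) ^ 3 := le_cube_of_le (by omega)
  refine wp_seq hM (wp_realConst hM ?_)
  refine (wp_sum hM 91 0 0
    (fun x => ∑ y ∈ Finset.range d, (1 + s.arr 0 x y * s.arr 0 x y)) ?_ rfl rfl (by decide) ?_).conseq ?_
  · exact hs.r0.le.trans hd
  · intro a ha s₁ hA₁ h10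
    have hs₁ : Dims d k m n s₁ := Dims.of_agree (s := s.set ⟨91, 8, 8⟩ ((0 : ℚ) : ℝ))
      ⟨hs.1, hs.2, hs.3, hs.4, hs.5, hs.6, hs.7, hs.8, hs.9⟩ hA₁ (by decide)
    have ha0 : s₁.arr 0 = s.arr 0 := by
      rw [hA₁.arr 0 rfl]
      exact s.set_arr_of_ne _ _ (by decide)
    have key := wp_sum (ω := ω) (S := S) hM (i := 11) (r := 0) (s := s₁) 91 0 0
      (P := .seq (.realConst ⟨93, 8, 8⟩ 1) (.seq (.realOp .times ⟨90, 8, 8⟩ ⟨0, 10, 11⟩ ⟨0, 10, 11⟩)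
      (.seq (.realOp .plus ⟨90, 8, 8⟩ ⟨93, 8, 8⟩ ⟨90, 8, 8⟩)
        (.realOp .plus ⟨91, 8, 8⟩ ⟨91, 8, 8⟩ ⟨90, 8, 8⟩))))
      (fun y => (1 + s.arr 0 a y * s.arr 0 a y)) (hs₁.r0.le.trans hd) rfl rfl (by decide) ?_
    · refine key.conseq fun s₂ _ h => ?_
      rw [h, hs₁.r0]
    · intro b hb s₂ hA₂ h11
      have h8 : s₂.reg 8 = 0 := (hs₁.of_agree hA₂ (by decide)).r8
      have p10 : s₂.reg 10 = a := by rw [hA₂.reg 10 rfl, h10]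
      have pa : s₂.arr 0 = s.arr 0 := by rw [hA₂.arr 0 rfl, ha0]
      refine wp_seq hM (wp_realConst hM (wp_seq hM (wp_realOp hM (wp_seq hM (wp_realOp hM
        (wp_realOp hM ?_))))))
      funext x y
      simp [State.set, State.get, RealOp.eval, h8, p10, h11, pa]
  · intro s' _ h
    rw [h]
    have e : (s.set ⟨91, 8, 8⟩ ((0 : ℚ) : ℝ)).reg 0 = d := hs.r0
    simp only [e, and_self, if_true]
    rw [Finset.sum_range]
    simp only [Finset.sum_range, hB]
    simp [State.set, hs.r8, entryBound]

theorem wp_prepare (hp : Params d k m n) (est : ℝ) :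
    WP ω S .prepare (startState k B t est) fun s' =>
      Ready k B t ω s' ∧ s'.log = [] ∧ s'.arr 2 0 0 = est := by
  have hM := hp.two_le
  have hle := hp.le
  have cd : d ≤ (n + m) ^ 3 := le_cube_of_le (by omega)
  have cp : m - k ≤ (n + m) ^ 3 := le_cube_of_le (by omega)
  have cn : n ≤ (n + m) ^ 3 := le_cube_of_le (by omega)
  have c1 : 1 ≤ (n + m) ^ 3 := le_cube_of_le (by omega)
  have h2 : (startState (m := m) (n := n) k B t est).arr 2 0 0 = est := by simp [startState]
  refine wp_seq hM ((wp_dims hp (by simp [startState]) (by simp [startState])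
    (by simp [startState]) (by simp [startState])).conseq fun s₁ hA₁ hs₁ => ?_)
  refine wp_seq hM ((wp_sparseMat hp hs₁).conseq fun s₂ hA₂ h₂ => ?_)
  have hs₂ := hs₁.of_agree hA₂ (by decide)
  refine wp_seq hM ((wp_sample hp hs₂ ?_).conseq fun s₃ hA₃ h₃ => ?_)
  · rw [hA₂.drawn rfl, hA₁.drawn rfl]; rfl
  have hs₃ := hs₂.of_agree hA₃ (by decide)
  have B₃ : ∀ i j : Fin d, s₃.arr 0 i j = B i j := by
    intro i j
    rw [hA₃.arr 0 rfl, hA₂.arr 0 rfl, hA₁.arr 0 rfl]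
    simp [startState]
  have t₃ : ∀ i : Fin d, s₃.arr 1 i 0 = t i := by
    intro i
    rw [hA₃.arr 1 rfl, hA₂.arr 1 rfl, hA₁.arr 1 rfl]
    simp [startState]
  have G₃ : ∀ (i : Fin d) (j : Fin n), s₃.arr 4 i j = gSparse d k n i j := by
    intro i j
    rw [hA₃.arr 4 rfl, h₂]
  refine wp_seq hM ((wp_matMul hM (hs₃.r6.le.trans cp) (hs₃.r0.le.trans cd) (hs₃.r0.le.trans cd)
    (by norm_num) (by norm_num) hs₃.r8 (by norm_num) (by norm_num) (by norm_num) (by norm_num)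
    (by norm_num)).conseq fun s₄ hA₄ h₄ => ?_)
  have hs₄ := hs₃.of_agree hA₄ (by decide)
  have RB₄ : ∀ (i : Fin (m - k)) (j : Fin d), s₄.arr 6 i j = (gaussMat (m - k) d ω * B) i j := by
    intro i j
    rw [h₄]
    simp [hs₃.r6, hs₃.r0, Matrix.mul_apply, Finset.sum_range, h₃, B₃]
  refine wp_seq hM ((wp_matMul hM (hs₄.r6.le.trans cp) (hs₄.r0.le.trans cd) (hs₄.r3.le.trans cn)
    (by norm_num) (by norm_num) hs₄.r8 (by norm_num) (by norm_num) (by norm_num) (by norm_num)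
    (by norm_num)).conseq fun s₅ hA₅ h₅ => ?_)
  have hs₅ := hs₄.of_agree hA₅ (by decide)
  have X₅ : ∀ (i : Fin (m - k)) (j : Fin n), s₅.arr 7 i j = topBlock k m n B ω i j := by
    intro i j
    rw [h₅]
    rw [hA₄.arr 4 rfl]
    simp [hs₄.r6, hs₄.r0, hs₄.r3, topBlock, Finset.sum_range, G₃, RB₄]
    exact (Matrix.mul_apply).symm
  refine wp_seq hM ((wp_matMul hM (hs₅.r6.le.trans cp) (hs₅.r0.le.trans cd) (hs₅.r7.le.trans c1)
    (by norm_num) (by norm_num) hs₅.r8 (by norm_num) (by norm_num) (by norm_num) (by norm_num)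
    (by norm_num)).conseq fun s₆ hA₆ h₆ => ?_)
  have hs₆ := hs₅.of_agree hA₆ (by decide)
  have y₆ : ∀ i : Fin (m - k), s₆.arr 8 i 0 = (gaussMat (m - k) d ω *ᵥ t) i := by
    intro i
    rw [h₆]
    rw [hA₅.arr 1 rfl, hA₄.arr 1 rfl, hA₅.arr 5 rfl, hA₄.arr 5 rfl]
    simp [hs₅.r6, hs₅.r0, hs₅.r7, Matrix.mulVec, dotProduct, Finset.sum_range, t₃, h₃]
  have B₆ : ∀ i j : Fin d, s₆.arr 0 i j = B i j := by
    intro i j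
    rw [hA₆.arr 0 rfl, hA₅.arr 0 rfl, hA₄.arr 0 rfl, B₃]
  refine (wp_bound hp hs₆ B₆).conseq fun s₇ hA₇ h₇ => ⟨⟨?_, ?_, ?_, ?_, ?_, ?_, ?_⟩, ?_, ?_⟩
  · exact hs₆.of_agree hA₇ (by decide)
  · rwa [hA₇.arr 0 rfl]
  · rwa [hA₇.arr 1 rfl, hA₆.arr 1 rfl, hA₅.arr 1 rfl, hA₄.arr 1 rfl]
  · rwa [hA₇.arr 4 rfl, hA₆.arr 4 rfl, hA₅.arr 4 rfl, hA₄.arr 4 rfl]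
  · rwa [hA₇.arr 7 rfl, hA₆.arr 7 rfl]
  · rwa [hA₇.arr 8 rfl]
  · exact h₇
  · rw [hA₇.log rfl, hA₆.log rfl, hA₅.log rfl, hA₄.log rfl, hA₃.log rfl, hA₂.log rfl, hA₁.log rfl]
    rfl
  · rw [hA₇.arr 2 rfl, hA₆.arr 2 rfl, hA₅.arr 2 rfl, hA₄.arr 2 rfl, hA₃.arr 2 rfl, hA₂.arr 2 rfl,
      hA₁.arr 2 rfl, h2]

/-- The factor `m` in the weight is produced by repeated addition, since no instruction turns the
contents of a register into a real number. -/
theorem wp_setWeight (hp : Params d k m n) {s : State m n} (hs : Ready k B t ω s) {δ : ℝ}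
    (hδ : s.arr 9 0 0 = δ) :
    WP ω S .setWeight s fun s' => s'.arr 92 0 0 = weight m B δ := by
  have hM := hp.two_le
  have h8 := hs.dims.r8
  refine wp_seq hM (wp_realOp hM (wp_seq hM (wp_realConst hM (wp_seq hM (wp_realOp hM
    (wp_seq hM (wp_realConst hM ?_)))))))
  set s₁ : State m n := State.set _ ⟨92, 8, 8⟩ _ with hs₁
  have k8 : s₁.reg 8 = 0 := h8
  have k2 : s₁.reg 2 = m := hs.dims.r2
  have k93 : s₁.arr 93 0 0 = (entryBound B + δ) * 100 := by
    simp [hs₁, State.set, State.get, RealOp.eval, h8, hs.bound, hδ]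
  have k92 : s₁.arr 92 0 0 = 0 := by
    simp [hs₁, State.set, State.get, RealOp.eval, h8]
  clear_value s₁
  refine (wp_sum hM 92 0 0 (fun _ => (entryBound B + δ) * 100) ?_ rfl rfl (by decide) ?_).conseq ?_
  · exact k2.le.trans (le_cube_of_le (by omega))
  · intro a _ s₂ hA₂ _
    have q8 : s₂.reg 8 = 0 := by rw [hA₂.reg 8 rfl, k8]
    have q93 : s₂.arr 93 0 0 = (entryBound B + δ) * 100 := by rw [hA₂.arr 93 rfl, k93]
    refine wp_realOp hM ?_
    funext x y
    simp [State.set, State.get, RealOp.eval, q8, q93]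
  · intro s' _ h
    rw [h]
    simp [k92, k2, weight]

/-- There is no assignment between real entries, so the weight is copied by adding it to a fresh
`0`. Only the last `k` rows of the array change, and the Gaussian top block survives. -/
theorem wp_fillPartite (hp : Params d k m n) {s : State m n} (hs : Dims d k m n s) {γ : ℝ}
    (hγ : s.arr 92 0 0 = γ) :
    WP ω S .fillPartite s fun s' => s'.arr 7 = fun x y =>
      if m - k ≤ x ∧ x < m - k + k ∧ y < n then (if x - (m - k) = y / (n / k) then γ else 0)
      else s.arr 7 x y := by
  have hM := hp.two_le
  have hle := hp.le
  have hkd := hp.k_le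
  refine (wp_fill hM 7 (m - k) (fun x y => if x = y / (n / k) then γ else 0) ?_ ?_ rfl rfl rfl rfl
    (by decide) ?_).conseq ?_
  · exact hs.r1.le.trans (le_cube_of_le (by omega))
  · exact hs.r3.le.trans (le_cube_of_le (by omega))
  · intro a ha b hb s₁ hA hi hj _
    rw [hs.r3] at hb
    have hs₁ := hs.of_agree hA (by decide)
    have g92 : s₁.arr 92 0 0 = γ := by rw [hA.arr 92 rfl, hγ]
    refine wp_seq hM (wp_natAdd hM (wp_seq hM ?_))
    have hs₂ := hs₁.setReg (r := 12) (v := s₁.reg 6 + s₁.reg 10) (by norm_num)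
    refine (wp_quoRem hM hs₂.r8 ?_ ?_ (by norm_num) (by norm_num) (by norm_num)
      (by norm_num)).conseq fun s₃ hA₃ h₃ => ?_
    · exact hj.le.trans (le_cube_of_le (by omega))
    · exact hs₂.r5 ▸ hp.n_div_pos
    have q20 : s₃.reg 20 = b / (n / k) := by
      rw [h₃.1, hs₂.r5]
      exact congrArg (· / (n / k)) hj
    have q10 : s₃.reg 10 = a := by rw [hA₃.reg 10 rfl]; exact hi
    have q11 : s₃.reg 11 = b := by rw [hA₃.reg 11 rfl]; exact hj
    have q8 : s₃.reg 8 = 0 := by rw [hA₃.reg 8 rfl]; exact hs₁.r8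
    have q12 : s₃.reg 12 = m - k + a := by
      rw [hA₃.reg 12 rfl]
      simp [State.setReg, hs₁.r6, hi]
    have q7 : s₃.arr 7 = s₁.arr 7 := hA₃.arr 7 rfl
    have q92 : s₃.arr 92 0 0 = γ := by rw [hA₃.arr 92 rfl]; exact g92
    refine wp_ite hM (fun hb => wp_realConst hM ?_) (fun hb => wp_ite hM
      (fun hb' => wp_realConst hM ?_) fun hb' => wp_seq hM (wp_realConst hM (wp_realOp hM ?_)))
    · simp only [Test.Holds, q10, q20] at hb
      funext x y
      simp [State.set, q11, q12, q7, hb.ne]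
    · simp only [Test.Holds, q10, q20] at hb'
      funext x y
      simp [State.set, q11, q12, q7, hb'.ne']
    · simp only [Test.Holds, q10, q20] at hb hb'
      have : a = b / (n / k) := by omega
      funext x y
      simp only [State.set, State.get, RealOp.eval, q11, q12, q7, q8, q92, ← this]
      simp +contextual
  · intro s' _ h
    rw [h, hs.r1, hs.r3]

theorem wp_fillTarget (hp : Params d k m n) {s : State m n} (hs : Dims d k m n s) {γ : ℝ}
    (hγ : s.arr 92 0 0 = γ) :
    WP ω S .fillTarget s fun s' => s'.arr 8 = fun x y =>
      if m - k ≤ x ∧ x < m - k + k ∧ y < 1 then γ else s.arr 8 x y := by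
  have hM := hp.two_le
  have hle := hp.le
  have hkd := hp.k_le
  refine (wp_fill hM 8 (m - k) (fun x y => γ) ?_ ?_ rfl rfl rfl rfl
    (by decide) ?_).conseq ?_
  · exact hs.r1.le.trans (le_cube_of_le (by omega))
  · exact hs.r7.le.trans (le_cube_of_le (by omega))
  · intro a ha b hb s₁ hA hi hj _
    have hs₁ := hs.of_agree hA (by decide)
    have g92 : s₁.arr 92 0 0 = γ := by rw [hA.arr 92 rfl, hγ]
    refine wp_seq hM (wp_natAdd hM (wp_seq hM (wp_realConst hM (wp_realOp hM ?_))))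
    funext x y
    simp only [State.set, State.get, State.setReg, RealOp.eval, hs₁.r6, hs₁.r8, hi, hj]
    simp +contextual [g92]
  · intro s' _ h
    rw [h, hs.r1, hs.r7]

theorem wp_decodeAnswer (hp : Params d k m n) {s : State m n} (hs : Dims d k m n s)
    (hG : ∀ (i : Fin d) (j : Fin n), s.arr 4 i j = gSparse d k n i j) {θ : Fin n → ℝ}
    (hθ : ∀ j : Fin n, s.arr 10 j 0 = θ j) :
    WP ω S .decodeAnswer s fun s' => ∀ i : Fin d, s'.arr 12 i 0 = decode d k θ i := by
  have hM := hp.two_le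
  have hle := hp.le
  have cd : d ≤ (n + m) ^ 3 := le_cube_of_le (by omega)
  have cn : n ≤ (n + m) ^ 3 := le_cube_of_le (by omega)
  have c1 : 1 ≤ (n + m) ^ 3 := le_cube_of_le (by omega)
  refine wp_seq hM ((wp_matMul hM (hs.r0.le.trans cd) (hs.r3.le.trans cn) (hs.r7.le.trans c1)
    (by norm_num) (by norm_num) hs.r8 (by norm_num) (by norm_num) (by norm_num) (by norm_num)
    (by norm_num)).conseq fun s₁ hA₁ h₁ => ?_)
  have hs₁ := hs.of_agree hA₁ (by decide)
  have g : ∀ i : Fin d, s₁.arr 11 i 0 = (gSparse d k n *ᵥ θ) i := by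
    intro i
    rw [h₁]
    simp [hs.r0, hs.r3, hs.r7, Matrix.mulVec, dotProduct, Finset.sum_range, hG, hθ]
  refine wp_seq hM (wp_realConst hM ?_)
  have hs₂ : Dims d k m n (s₁.set ⟨95, 8, 8⟩ ((0 : ℚ) : ℝ)) :=
    ⟨hs₁.1, hs₁.2, hs₁.3, hs₁.4, hs₁.5, hs₁.6, hs₁.7, hs₁.8, hs₁.9⟩
  refine (wp_fill hM 12 0 (fun x y => if 0 < s₁.arr 11 x y then 1 else -1) ?_ ?_ rfl rfl rfl rfl
    (by decide) ?_).conseq ?_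
  · exact hs₂.r0.le.trans cd
  · exact hs₂.r7.le.trans c1
  · intro a ha b hb s₃ hA hi hj _
    have hs₃ := hs₂.of_agree hA (by decide)
    have q95 : s₃.arr 95 0 0 = 0 := by
      rw [hA.arr 95 rfl]
      simp [State.set, hs₁.r8]
    have q11 : s₃.arr 11 = s₁.arr 11 := by
      rw [hA.arr 11 rfl]
      exact s₁.set_arr_of_ne _ _ (by decide)
    refine wp_ite hM (fun hb => wp_realConst hM ?_) (fun hb => wp_realConst hM ?_) <;>
    · simp only [Test.Holds, State.get, hs₃.r8, q95, q11, hi, hj] at hb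
      funext x y
      simp [State.set, hi, hj, hb]
  · intro s' _ h i
    rw [h, hs₂.r0, hs₂.r7]
    simp [decode, g]

theorem wp_ask (hp : Params d k m n) {s : State m n} (hs : Ready k B t ω s) {δ : ℝ}
    (hδ : s.arr 9 0 0 = δ) :
    WP ω S .ask s fun s' => Ready k B t ω s' ∧ s'.log = s.log ++ [slrQuery k m n B t ω δ] ∧
      ∀ i : Fin d, s'.arr 12 i 0 = decode d k (S (slrQuery k m n B t ω δ)) i := by
  have hM := hp.two_le
  have hle := hp.le
  have hkd := hp.k_le
  have hd := hp.d_pos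
  refine wp_seq hM ((wp_setWeight hp hs hδ).conseq fun s₁ hA₁ h₁ => ?_)
  have hs₁ := hs.of_agree hA₁ (by decide) (by decide)
  refine wp_seq hM ((wp_fillPartite hp hs₁.dims h₁).conseq fun s₂ hA₂ h₂ => ?_)
  have hs₂ := hs₁.dims.of_agree hA₂ (by decide)
  have w₂ : s₂.arr 92 0 0 = weight m B δ := by rw [hA₂.arr 92 rfl, h₁]
  refine wp_seq hM ((wp_fillTarget hp hs₂ w₂).conseq fun s₃ hA₃ h₃ => ?_)
  have hs₃ := hs₂.of_agree hA₃ (by decide)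
  have hq : s₃.readQuery 7 8 9 = slrQuery k m n B t ω δ := by
    have hX : (s₃.readQuery 7 8 9).X = (slrQuery k m n B t ω δ).X := by
      funext i j
      change s₃.arr 7 i j = stack (topBlock k m n B ω) (weight m B δ • gPartite n k) i j
      rw [hA₃.arr 7 rfl, h₂]
      by_cases hi : (i : ℕ) < m - k
      · rw [stack, dif_pos hi, ← hs₁.top]
        exact if_neg (by omega)
      · rw [stack, dif_neg hi]
        have := i.2
        have hc : m - k ≤ (i : ℕ) ∧ (i : ℕ) < m - k + k ∧ (j : ℕ) < n :=
          ⟨by omega, by omega, j.2⟩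
        simp only [hc, and_self, if_true]
        simp [gPartite]
    have hy : (s₃.readQuery 7 8 9).y = (slrQuery k m n B t ω δ).y := by
      funext i
      change s₃.arr 8 i 0 = if h : (i : ℕ) < m - k then _ else _
      rw [h₃, hA₂.arr 8 rfl]
      have := i.2
      by_cases hi : (i : ℕ) < m - k
      · rw [dif_pos hi, ← hs₁.rhs]
        exact if_neg (by omega)
      · rw [dif_neg hi]
        exact if_pos (by omega)
    have hδ' : (s₃.readQuery 7 8 9).δ = (slrQuery k m n B t ω δ).δ := by
      change s₃.arr 9 0 0 = δ
      rw [hA₃.arr 9 rfl, hA₂.arr 9 rfl, hA₁.arr 9 rfl, hδ]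
    calc s₃.readQuery 7 8 9 = ⟨(s₃.readQuery 7 8 9).X, (s₃.readQuery 7 8 9).y,
          (s₃.readQuery 7 8 9).δ⟩ := rfl
      _ = _ := by rw [hX, hy, hδ']
  have hA₄ := (Exec.query (ω := ω) (S := S) s₃ 7 8 9 10).agree
  refine wp_seq hM (wp_query hp.n_pos (by omega) ?_)
  rw [hq] at hA₄ ⊢
  set s₄ := s₃.answer (slrQuery k m n B t ω δ) 10 (S (slrQuery k m n B t ω δ)) with hs₄
  -- `Ready` constrains only the top `m - k` rows of the arrays `7` and `8`, so it survives the
  -- query. All later queries reuse the same Gaussian block.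
  have hr : Ready k B t ω s₄ := by
    refine ⟨hs₃.of_agree hA₄ (by decide), ?_, ?_, ?_, ?_, ?_, ?_⟩
    · rw [hA₄.arr 0 rfl, hA₃.arr 0 rfl, hA₂.arr 0 rfl]
      exact hs₁.mat
    · rw [hA₄.arr 1 rfl, hA₃.arr 1 rfl, hA₂.arr 1 rfl]
      exact hs₁.target
    · rw [hA₄.arr 4 rfl, hA₃.arr 4 rfl, hA₂.arr 4 rfl]
      exact hs₁.gadget
    · intro i j
      rw [hA₄.arr 7 rfl, hA₃.arr 7 rfl, h₂, ← hs₁.top]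
      have := i.2
      exact if_neg (by omega)
    · intro i
      rw [hA₄.arr 8 rfl, h₃, hA₂.arr 8 rfl, ← hs₁.rhs]
      have := i.2
      exact if_neg (by omega)
    · rw [hA₄.arr 91 rfl, hA₃.arr 91 rfl, hA₂.arr 91 rfl]
      exact hs₁.bound
  have hθ : ∀ j : Fin n, s₄.arr 10 j 0 = S (slrQuery k m n B t ω δ) j := by
    intro j
    simp [hs₄, State.answer]
  refine (wp_decodeAnswer hp hr.dims hr.gadget hθ).conseq fun s₅ hA₅ h₅ => ⟨?_, ?_, h₅⟩
  · exact hr.of_agree hA₅ (by decide) (by decide)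
  · rw [hA₅.log rfl]
    change s₃.log ++ _ = _
    rw [hA₃.log rfl, hA₂.log rfl, hA₁.log rfl]

theorem wp_copy (hp : Params d k m n) {s : State m n} (hs : Dims d k m n s) :
    WP ω S .copy s fun s' => ∀ i : Fin d, s'.arr 3 i 0 = s.arr 12 i 0 := by
  have hM := hp.two_le
  have hle := hp.le
  refine (wp_fill hM 3 0 (fun x y => s.arr 12 x y) ?_ ?_ rfl rfl rfl rfl (by decide) ?_).conseq ?_
  · exact hs.r0.le.trans (le_cube_of_le (by omega))
  · exact hs.r7.le.trans (le_cube_of_le (by omega))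
  · intro a ha b hb s₁ hA hi hj _
    have q12 : s₁.arr 12 = s.arr 12 := hA.arr 12 rfl
    refine wp_seq hM (wp_realConst hM (wp_realOp hM ?_))
    funext x y
    simp +contextual [State.set, State.get, RealOp.eval, hi, hj, q12]
  · intro s' _ h i
    rw [h, hs.r0, hs.r7]
    simp

theorem wp_instanceMap (hp : Params d k m n) (est : ℝ) :
    WP ω S .instanceMap (startState k B t est) fun s' =>
      s'.log = [slrQuery k m n B t ω (est / 6)] ∧
        s'.output d = decode d k (S (slrQuery k m n B t ω (est / 6))) := by
  have hM := hp.two_le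
  refine wp_seq hM ((wp_prepare hp est).conseq fun s₁ _ h₁ => ?_)
  have hA₂ := (Exec.seq (.realConst (ω := ω) (S := S) s₁ ⟨93, 8, 8⟩ 6)
    (.realOp _ .quot ⟨9, 8, 8⟩ ⟨2, 8, 8⟩ ⟨93, 8, 8⟩)).agree
  refine wp_seq hM (wp_realConst hM (wp_seq hM (wp_realOp hM (wp_seq hM ?_))))
  have hs₂ := h₁.1.of_agree hA₂ (by decide) (by decide)
  have h8 := h₁.1.dims.r8
  refine (wp_ask hp hs₂ (δ := est / 6) ?_).conseq fun s₃ hA₃ h₃ => ?_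
  · simp [State.set, State.get, RealOp.eval, h8, h₁.2.2]
  refine (wp_copy hp h₃.1.dims).conseq fun s₄ hA₄ h₄ => ⟨?_, ?_⟩
  · rw [hA₄.log rfl, h₃.2.1, hA₂.log rfl, h₁.2.1]
    rfl
  · funext i
    exact (h₄ i).trans (h₃.2.2 i)

end BDDtoSLR

namespace BDDtoSLR

/-! ### Residuals, the choice of the error parameter, and the improvement loop. -/

variable {m n d k : ℕ} {ω : ℕ → ℝ} {S : SLRInstance m n → Fin n → ℝ}
  {B : Matrix (Fin d) (Fin d) ℝ} {t : Fin d → ℝ}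

theorem wp_residual (hp : Params d k m n) {s : State m n} (hs : Ready k B t ω s) {Z o : ℕ}
    (hZ : Z = 3 ∨ Z = 12) (ho : o = 15 ∨ o = 17) {z : Fin d → ℝ}
    (hz : ∀ i : Fin d, s.arr Z i 0 = z i) :
    WP ω S (.residual Z o) s fun s' => Ready k B t ω s' ∧
      (∀ i : Fin d, s'.arr 13 i 0 = (B *ᵥ z - t) i) ∧ s'.arr o 0 0 = sqSum (B *ᵥ z - t) := by
  have hM := hp.two_le
  have hle := hp.le
  have cd : d ≤ (n + m) ^ 3 := le_cube_of_le (by omega)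
  have c1 : 1 ≤ (n + m) ^ 3 := le_cube_of_le (by omega)
  have hd₀ := hs.dims
  refine wp_seq hM ((wp_matMul hM (hd₀.r0.le.trans cd) (hd₀.r0.le.trans cd) (hd₀.r7.le.trans c1)
    (by norm_num) (by norm_num) hd₀.r8 (by norm_num) (by omega) (by norm_num) (by norm_num)
    (by omega)).conseq fun s₁ hA₁ h₁ => ?_)
  have hs₁ := hs.of_agree hA₁ (by rcases hZ with rfl | rfl <;> decide)
    (by rcases hZ with rfl | rfl <;> decide)
  have g13 : ∀ i : Fin d, s₁.arr 13 i 0 = (B *ᵥ z) i := by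
    intro i
    rw [h₁]
    simp [hd₀.r0, hd₀.r7, Matrix.mulVec, dotProduct, Finset.sum_range, hs.mat, hz]
  have hd₁ := hs₁.dims
  refine wp_seq hM ((wp_fill hM 13 0 (fun x y => s₁.arr 13 x y - s₁.arr 1 x y)
    (hd₁.r0.le.trans cd) (hd₁.r7.le.trans c1) rfl rfl rfl rfl (by decide) ?_).conseq
    fun s₂ hA₂ h₂ => ?_)
  · intro a ha b hb s' hA hi hj h13
    rw [zero_add] at h13
    have q1 : s'.arr 1 = s₁.arr 1 := hA.arr 1 rfl
    refine wp_realOp hM ?_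
    funext x y
    simp [State.set, State.get, RealOp.eval, hi, hj, q1, h13]
  have hs₂ := hs₁.of_agree hA₂ (by decide) (by decide)
  have hd₂ := hs₂.dims
  have v₂ : ∀ i : Fin d, s₂.arr 13 i 0 = (B *ᵥ z - t) i := by
    intro i
    rw [h₂]
    simp [hd₁.r0, hd₁.r7, g13, hs₁.target]
  have ho13 : ¬ 13 = o := by omega
  have ho90 : ¬ 90 = o := by omega
  refine wp_seq hM (wp_realConst hM ?_)
  have hA₃ := (Exec.realConst (ω := ω) (S := S) s₂ ⟨o, 8, 8⟩ 0).agree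
  have hs₃ : Ready k B t ω (s₂.set ⟨o, 8, 8⟩ ((0 : ℚ) : ℝ)) := by
    refine hs₂.of_agree hA₃ (by simp [Prog.writesReg]) ?_
    rcases ho with rfl | rfl <;> decide
  have v₃ : (s₂.set ⟨o, 8, 8⟩ ((0 : ℚ) : ℝ)).arr 13 = s₂.arr 13 := by
    simp [State.set, ho13]
  have w₃ : (s₂.set ⟨o, 8, 8⟩ ((0 : ℚ) : ℝ)).arr o 0 0 = 0 := by
    simp [State.set, hd₂.r8]
  set s₃ := s₂.set ⟨o, 8, 8⟩ ((0 : ℚ) : ℝ) with hs₃_def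
  clear_value s₃
  have hd₃ := hs₃.dims
  refine (wp_sum hM o 0 0 (fun x => s₂.arr 13 x 0 * s₂.arr 13 x 0) (hd₃.r0.le.trans cd) rfl rfl
    (by decide) ?_).conseq ?_
  · intro a ha s₄ hA₄ hi
    have hd₄ := hd₃.of_agree hA₄ (by simp [Prog.loop, Prog.writesReg]; omega)
    have v₄ : s₄.arr 13 = s₂.arr 13 := by
      rw [hA₄.arr 13 (by simp [Prog.loop, Prog.writesArr]; omega), v₃]
    refine wp_seq hM (wp_realOp hM (wp_realOp hM ?_))
    funext x y
    simp [State.set, State.get, RealOp.eval, hi, hd₄.r8, v₄, Ne.symm ho90]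
  · intro s₄ hA₄ h₄
    refine ⟨?_, ?_, ?_⟩
    · refine hs₃.of_agree hA₄ (by simp [Prog.loop, Prog.writesReg]; omega) ?_
      rcases ho with rfl | rfl <;> decide
    · rwa [hA₄.arr 13 (by simp [Prog.loop, Prog.writesArr]; omega), v₃]
    · rw [h₄, hd₃.r0]
      simp [w₃, Finset.sum_range, v₂, sqSum]

theorem wp_absSum (hp : Params d k m n) {s : State m n} (hs : Dims d k m n s) {v : Fin d → ℝ}
    (hv : ∀ i : Fin d, s.arr 13 i 0 = v i) :
    WP ω S .absSum s fun s' => s'.arr 16 0 0 = ∑ i, |v i| := by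
  have hM := hp.two_le
  have hle := hp.le
  refine wp_seq hM (wp_realConst hM (wp_seq hM (wp_realConst hM ?_)))
  set s₁ : State m n := State.set _ ⟨95, 8, 8⟩ _ with hs₁
  have hd₁ : Dims d k m n s₁ :=
    ⟨hs.1, hs.2, hs.3, hs.4, hs.5, hs.6, hs.7, hs.8, hs.9⟩
  have v₁ : s₁.arr 13 = s.arr 13 := by simp [hs₁, State.set]
  have w₁ : s₁.arr 16 0 0 = 0 := by simp [hs₁, State.set, hs.r8]
  have z₁ : s₁.arr 95 0 0 = 0 := by simp [hs₁, State.set, hs.r8]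
  clear_value s₁
  refine (wp_sum hM 16 0 0 (fun x => |s.arr 13 x 0|) ?_ rfl rfl (by decide) ?_).conseq ?_
  · exact hd₁.r0.le.trans (le_cube_of_le (by omega))
  · intro a ha s₂ hA₂ hi
    have h8 := (hd₁.of_agree hA₂ (by decide)).r8
    have v₂ : s₂.arr 13 = s.arr 13 := by rw [hA₂.arr 13 rfl, v₁]
    have z₂ : s₂.arr 95 0 0 = 0 := by rw [hA₂.arr 95 rfl, z₁]
    refine wp_ite hM (fun hb => wp_realOp hM ?_) (fun hb => wp_realOp hM ?_)
    · simp only [Test.Holds, State.get, hi, h8, v₂, z₂] at hb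
      funext x y
      simp [State.set, State.get, RealOp.eval, hi, h8, v₂, abs_of_neg hb, sub_eq_add_neg]
    · simp only [Test.Holds, State.get, hi, h8, v₂, z₂, not_lt] at hb
      funext x y
      simp [State.set, State.get, RealOp.eval, hi, h8, v₂, abs_of_nonneg hb]
  · intro s' _ h
    rw [h, hd₁.r0]
    simp [w₁, Finset.sum_range, hv]

theorem wp_halve (hp : Params d k m n) {s : State m n} (hs : Dims d k m n s) {σ w : ℝ}
    (hσ : s.arr 15 0 0 = σ) (hw : s.arr 16 0 0 = w) :
    WP ω S .halve s fun s' => s'.arr 16 0 0 = (halveIf σ)^[d] w := by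
  have hM := hp.two_le
  have hle := hp.le
  refine wp_seq hM (wp_realConst hM (wp_seq hM (wp_realOp hM (wp_seq hM (wp_realConst hM ?_)))))
  set s₁ : State m n := State.set _ ⟨98, 8, 8⟩ _ with hs₁
  have hd₁ : Dims d k m n s₁ :=
    ⟨hs.1, hs.2, hs.3, hs.4, hs.5, hs.6, hs.7, hs.8, hs.9⟩
  have v₁ : s₁.arr 97 0 0 = 4 * σ := by
    simp [hs₁, State.set, State.get, RealOp.eval, hs.r8, hσ]
  have w₁ : s₁.arr 16 0 0 = w := by simp [hs₁, State.set, hw]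
  have z₁ : s₁.arr 98 0 0 = 2 := by simp [hs₁, State.set, hs.r8]
  clear_value s₁
  refine wp_for hM (fun j s' => s'.arr 16 0 0 = (halveIf σ)^[j] w) ?_ rfl rfl (by decide)
    (by decide) (by decide) w₁ ?_ ?_
  · exact hd₁.r0.le.trans (le_cube_of_le (by omega))
  · intro j hj s₂ hA₂ hi hI
    have h8 := (hd₁.of_agree hA₂ (by decide)).r8
    have v₂ : s₂.arr 97 0 0 = 4 * σ := by rw [hA₂.arr 97 rfl, v₁]
    have z₂ : s₂.arr 98 0 0 = 2 := by rw [hA₂.arr 98 rfl, z₁]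
    refine wp_seq hM (wp_realOp hM (wp_ite hM (fun hb => wp_realOp hM ?_)
      (fun hb => wp_skip hM ?_)))
    · simp only [Test.Holds, State.get, State.set, RealOp.eval, h8, hI] at hb
      simp only [Nat.reduceEqDiff, false_and, ite_false, and_self, ite_true, v₂] at hb
      rw [Function.iterate_succ_apply', halveIf, if_pos hb]
      simp [State.setReg, State.set, State.get, RealOp.eval, h8, hI, z₂]
    · simp only [Test.Holds, State.get, State.set, RealOp.eval, h8, hI] at hb
      simp only [Nat.reduceEqDiff, false_and, ite_false, and_self, ite_true, v₂] at hb
      rw [Function.iterate_succ_apply', halveIf, if_neg hb]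
      simp [State.setReg, State.set, hI]
  · intro s' _ h
    rwa [hd₁.r0] at h

theorem wp_setErrParam (hp : Params d k m n) {s : State m n} (hs : Dims d k m n s) {v : Fin d → ℝ}
    (hv : ∀ i : Fin d, s.arr 13 i 0 = v i) (hσ : s.arr 15 0 0 = sqSum v) :
    WP ω S .setErrParam s fun s' => s'.arr 9 0 0 = errParam v := by
  have hM := hp.two_le
  refine wp_seq hM ((wp_absSum hp hs hv).conseq fun s₁ hA₁ h₁ => ?_)
  have hs₁ := hs.of_agree hA₁ (by decide)
  refine wp_seq hM ((wp_halve hp hs₁ (by rw [hA₁.arr 15 rfl, hσ]) h₁).conseq fun s₂ hA₂ h₂ => ?_)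
  have hs₂ := hs₁.of_agree hA₂ (by decide)
  have h8 := hs₂.r8
  change _ = approxNorm v at h₂
  refine wp_seq hM (wp_realConst hM (wp_ite hM
    (fun hb => wp_seq hM (wp_realConst hM (wp_realOp hM ?_))) (fun hb => wp_realConst hM ?_))) <;>
  · simp [Test.Holds, State.get, State.set, h8, h₂] at hb
    simp [State.get, State.set, RealOp.eval, h8, h₂, errParam, hb, not_lt.2]

theorem wp_improvement (hp : Params d k m n) {s : State m n} (hs : Ready k B t ω s)
    {z : Fin d → ℝ} (hz : ∀ i : Fin d, s.arr 3 i 0 = z i) :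
    WP ω S .improvement s fun s' => Ready k B t ω s' ∧
      s'.log = s.log ++ [slrQuery k m n B t ω (errParam (B *ᵥ z - t))] ∧
      ∀ i : Fin d, s'.arr 3 i 0 = improve k m n B t ω S z i := by
  have hM := hp.two_le
  refine wp_seq hM ((wp_residual hp hs (.inl rfl) (.inl rfl) hz).conseq fun s₁ hA₁ h₁ => ?_)
  obtain ⟨hs₁, v₁, w₁⟩ := h₁
  refine wp_seq hM ((wp_setErrParam hp hs₁.dims v₁ w₁).conseq fun s₂ hA₂ h₂ => ?_)
  have hs₂ := hs₁.of_agree hA₂ (by decide) (by decide)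
  refine wp_seq hM ((wp_ask hp hs₂ h₂).conseq fun s₃ hA₃ h₃ => ?_)
  obtain ⟨hs₃, l₃, z₃⟩ := h₃
  refine wp_seq hM ((wp_residual hp hs₃ (.inr rfl) (.inr rfl) z₃).conseq fun s₄ hA₄ h₄ => ?_)
  obtain ⟨hs₄, v₄, w₄⟩ := h₄
  have l₄ : s₄.log = s.log ++ [slrQuery k m n B t ω (errParam (B *ᵥ z - t))] := by
    rw [hA₄.log rfl, l₃, hA₂.log rfl, hA₁.log rfl]
  have u₄ : s₄.arr 15 0 0 = sqSum (B *ᵥ z - t) := by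
    rw [hA₄.arr 15 rfl, hA₃.arr 15 rfl, hA₂.arr 15 rfl, w₁]
  have h8 := hs₄.dims.r8
  refine wp_ite hM (fun hb => (wp_copy hp hs₄.dims).conseq fun s₅ hA₅ h₅ => ⟨?_, ?_, ?_⟩)
    (fun hb => wp_skip hM ⟨?_, l₄, ?_⟩)
  · exact hs₄.of_agree hA₅ (by decide) (by decide)
  · rw [hA₅.log rfl, l₄]
  · intro i
    simp only [Test.Holds, State.get, h8, w₄, u₄] at hb
    rw [h₅, improve, if_pos hb, ← z₃, hA₄.arr 12 rfl]
  · exact hs₄.of_agree (Exec.natConst (ω := ω) (S := S) s₄ 199 0).agree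
      (by decide) (by decide)
  · intro i
    simp only [Test.Holds, State.get, h8, w₄, u₄] at hb
    rw [improve, if_neg hb, ← hz, ← hA₁.arr 3 rfl, ← hA₂.arr 3 rfl, ← hA₃.arr 3 rfl,
      ← hA₄.arr 3 rfl]
    rfl

/-- The default `1`, used when the approximate length is not positive, makes every query of the
reduction have a positive error parameter, on bad tapes and with faulty oracles too. -/
theorem errParam_pos (v : Fin d → ℝ) : 0 < errParam v := by
  unfold errParam
  split_ifs with h
  · positivity
  · norm_num

theorem wp_reduction (hp : Params d k m n) (est : ℝ) :
    WP ω S .reduction (startState k B t est) fun s' =>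
      (∀ q ∈ s'.log, ∃ δ, 0 < δ ∧ q = slrQuery k m n B t ω δ) ∧
        s'.output d = (improve k m n B t ω S)^[m * (m * m)] fun _ => 1 := by
  have hM := hp.two_le
  have hle := hp.le
  have c1 : 1 ≤ (n + m) ^ 3 := le_cube_of_le (by omega)
  have cd : d ≤ (n + m) ^ 3 := le_cube_of_le (by omega)
  have cm : m ≤ (n + m) ^ 3 := le_cube_of_le (by omega)
  refine wp_seq hM ((wp_prepare hp est).conseq fun s₁ _ h₁ => ?_)
  obtain ⟨hs₁, l₁, -⟩ := h₁
  refine wp_seq hM ((wp_fill hM 3 0 (fun _ _ => 1) (hs₁.dims.r0.le.trans cd)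
    (hs₁.dims.r7.le.trans c1) rfl rfl rfl rfl (by decide) ?_).conseq fun s₂ hA₂ h₂ => ?_)
  · intro a _ b _ s' _ hi hj _
    refine wp_realConst hM ?_
    funext x y
    simp [State.set, hi, hj]
  have hs₂ := hs₁.of_agree hA₂ (by decide) (by decide)
  have z₂ : ∀ i : Fin d, s₂.arr 3 i 0 = 1 := by
    intro i
    rw [h₂]
    simp [hs₁.dims.r0, hs₁.dims.r7]
  refine wp_seq hM ((wp_prod hM hs₂.dims.r8 (hs₂.dims.r2.le.trans cm) (by norm_num)).conseq
    fun s₃ hA₃ h₃ => ?_)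
  have hs₃ := hs₂.of_agree hA₃ (by decide) (by decide)
  refine wp_seq hM ((wp_prod hM hs₃.dims.r8 (hs₃.dims.r2.le.trans cm) (by norm_num)).conseq
    fun s₄ hA₄ h₄ => ?_)
  have hs₄ := hs₃.of_agree hA₄ (by decide) (by decide)
  rw [h₃, hs₃.dims.r2, hs₂.dims.r2] at h₄
  -- The loop runs `m ^ 3` rounds without a stopping test: the solution is a fixed point of
  -- `improve`, so surplus rounds do no harm.
  refine wp_for hM (fun j s' => Ready k B t ω s' ∧
    (∀ q ∈ s'.log, ∃ δ, 0 < δ ∧ q = slrQuery k m n B t ω δ) ∧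
      ∀ i : Fin d, s'.arr 3 i 0 = (improve k m n B t ω S)^[j] (fun _ => 1) i) ?_ rfl rfl
      (by decide) (by decide) (by decide) ⟨?_, ?_, ?_⟩ ?_ ?_
  · rw [h₄, show m * (m * m) = m ^ 3 by ring]
    exact Nat.pow_le_pow_left (by omega) 3
  · exact hs₄.of_agree (Exec.natConst (ω := ω) (S := S) s₄ 13 0).agree (by decide) (by decide)
  · change ∀ q ∈ s₄.log, _
    rw [hA₄.log rfl, hA₃.log rfl, hA₂.log rfl, l₁]
    simp
  · change ∀ i : Fin d, s₄.arr 3 i 0 = _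
    rw [hA₄.arr 3 rfl, hA₃.arr 3 rfl]
    exact z₂
  · intro j _ s₅ _ _ hI
    obtain ⟨hs₅, l₅, z₅⟩ := hI
    refine (wp_improvement hp hs₅ z₅).conseq fun s₆ _ h₆ => ⟨?_, ?_, ?_⟩
    · exact (h₆.1.of_agree (Exec.natConst (ω := ω) (S := S) s₆ 199 1).agree (by decide)
        (by decide)).of_agree (Exec.natConst (ω := ω) (S := S) _ 13 (j + 1)).agree
        (fun r hr => by simp only [Prog.writesReg, beq_eq_false_iff_ne]; omega) fun _ _ => rfl
    · intro q hq
      change q ∈ s₆.log at hq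
      rw [h₆.2.1, List.mem_append, List.mem_singleton] at hq
      rcases hq with hq | rfl
      · exact l₅ q hq
      · exact ⟨_, errParam_pos _, rfl⟩
    · intro i
      rw [Function.iterate_succ_apply']
      exact h₆.2.2 i
  · intro s' _ h
    rw [h₄] at h
    exact ⟨h.2.1, funext h.2.2⟩

end BDDtoSLR

namespace BDDtoSLR

/-! ## The law of the Gaussian matrix -/

instance : IsProbabilityMeasure gaussianTape := by
  unfold gaussianTape
  infer_instance

/-- Distinct entries of the matrix read distinct positions of the tape; hence the entries are
independent. -/
theorem tape_index_injective (p d : ℕ) :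
    Function.Injective fun x : Fin p × Fin d => (x.1 : ℕ) * d + x.2 := by
  rintro ⟨i, j⟩ ⟨i', j'⟩ h
  simp only at h
  have hj := j.2
  have hj' := j'.2
  have h1 : (i : ℕ) = i' := by
    have := congrArg (· / d) h
    simpa [mul_comm _ d, Nat.mul_add_div (by omega : 0 < d), Nat.div_eq_of_lt] using this
  have h2 : (j : ℕ) = j' := by
    rw [h1] at h
    omega
  exact Prod.ext (Fin.ext h1) (Fin.ext h2)

theorem gaussMat_entries_law (p d : ℕ) :
    gaussianTape.map (fun ω (x : Fin p × Fin d) => gaussMat p d ω x.1 x.2) =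
      Measure.pi fun _ => gaussianReal 0 1 := by
  rw [← Measure.infinitePi_eq_pi]
  exact Measure.map_infinitePi_infinitePi_of_inj (P := fun _ : ℕ => gaussianReal 0 1)
    (tape_index_injective p d)

theorem gaussMat_law (p d : ℕ) :
    gaussianTape.map (fun ω (i : Fin p) (j : Fin d) => gaussMat p d ω i j) =
      Measure.pi fun _ => Measure.pi fun _ => gaussianReal 0 1 := by
  have h := Measure.infinitePi_map_curry (ι := Fin p) (κ := Fin d) (fun _ _ => gaussianReal 0 1)
  rw [Measure.infinitePi_eq_pi, ← gaussMat_entries_law, Measure.map_map] at h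
  · simp only [Measure.infinitePi_eq_pi] at h
    exact h
  · fun_prop
  · unfold gaussMat; fun_prop

/-- The rows of a Gaussian matrix, transformed by `f`, are independent. -/
theorem gaussMat_rows_law {E : Type*} [MeasurableSpace E] (p d : ℕ) {f : (Fin d → ℝ) → E}
    (hf : Measurable f) {ν : Measure E} [IsProbabilityMeasure ν]
    (h : (Measure.pi fun _ : Fin d => gaussianReal 0 1).map f = ν) :
    gaussianTape.map (fun ω (i : Fin p) => f (gaussMat p d ω i)) = Measure.pi fun _ => ν := by
  have h1 : (Measure.pi fun _ : Fin p => Measure.pi fun _ : Fin d => gaussianReal 0 1).map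
      (fun x i => f (x i)) = Measure.pi fun _ => ν := by
    have : SigmaFinite ((Measure.pi fun _ : Fin d => gaussianReal 0 1).map f) := by
      rw [h]; infer_instance
    rw [Measure.pi_map_pi (fun _ => hf.aemeasurable), h]
  rw [← h1, ← gaussMat_law, Measure.map_map]
  · rfl
  · fun_prop
  · unfold gaussMat; fun_prop

/-- A linear functional of a standard Gaussian vector is a centred Gaussian whose variance is the
squared norm of the functional. -/
theorem map_dotProduct_gaussian {d : ℕ} (u : Fin d → ℝ) (hu : sqSum u = 1) :
    (Measure.pi fun _ : Fin d => gaussianReal 0 1).map (fun x => x ⬝ᵥ u) = gaussianReal 0 1 := by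
  set L : StrongDual ℝ (EuclideanSpace ℝ (Fin d)) := innerSL ℝ (WithLp.toLp 2 u) with hL
  have h1 : (fun x : Fin d → ℝ => x ⬝ᵥ u) = L ∘ (WithLp.toLp 2) := by
    funext x
    simp [hL, PiLp.inner_apply, dotProduct, mul_comm]
  have h2 : ‖L‖ ^ 2 = 1 := by
    rw [hL, innerSL_apply_norm, EuclideanSpace.real_norm_sq_eq, ← hu]
    simp [sqSum, sq]
  rw [h1, ← Measure.map_map (by fun_prop) (by fun_prop), map_pi_eq_stdGaussian,
    IsGaussian.map_eq_gaussianReal, variance_dual_stdGaussian, h2,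
    integral_strongDual_stdGaussian]
  simp

/-- The characteristic function of `x ᵥ* A` at `y` is the standard one at `A *ᵥ y`, and `‖A y‖² = yᵀ
Aᵀ A y`. Working with characteristic functions rather than densities allows a singular covariance.
-/
theorem map_vecMul_gaussian {d n : ℕ} (A : Matrix (Fin d) (Fin n) ℝ) :
    (Measure.pi fun _ : Fin d => gaussianReal 0 1).map
      (fun x => (WithLp.toLp 2 (x ᵥ* A) : EuclideanSpace ℝ (Fin n))) =
        multivariateGaussian 0 (Aᵀ * A) := by
  have hps : (Aᵀ * A).PosSemidef := by
    have := Matrix.posSemidef_conjTranspose_mul_self A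
    rwa [Matrix.conjTranspose_eq_transpose_of_trivial] at this
  have h1 : Measurable fun x : Fin d → ℝ => (WithLp.toLp 2 (x ᵥ* A) : EuclideanSpace ℝ (Fin n)) := by
    unfold Matrix.vecMul dotProduct
    fun_prop
  have : IsProbabilityMeasure ((Measure.pi fun _ : Fin d => gaussianReal 0 1).map
      (fun x => (WithLp.toLp 2 (x ᵥ* A) : EuclideanSpace ℝ (Fin n)))) :=
    Measure.isProbabilityMeasure_map h1.aemeasurable
  apply Measure.ext_of_charFun (E := EuclideanSpace ℝ (Fin n))
  ext y
  rw [charFun_multivariateGaussian hps]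
  have h2 : charFun ((Measure.pi fun _ : Fin d => gaussianReal 0 1).map
      (fun x => (WithLp.toLp 2 (x ᵥ* A) : EuclideanSpace ℝ (Fin n)))) y =
      charFun (stdGaussian (EuclideanSpace ℝ (Fin d))) (WithLp.toLp 2 (A *ᵥ y.ofLp)) := by
    rw [← map_pi_eq_stdGaussian, charFun_apply, charFun_apply,
      integral_map h1.aemeasurable (by fun_prop), integral_map (by fun_prop) (by fun_prop)]
    congr 1
    funext x
    congr 3
    simp only [EuclideanSpace.inner_eq_star_dotProduct, star_trivial]
    rw [dotProduct_comm, ← Matrix.dotProduct_mulVec, dotProduct_comm]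
  rw [h2, charFun_stdGaussian, ← Complex.ofReal_pow, EuclideanSpace.real_norm_sq_eq]
  have h3 : y.ofLp ⬝ᵥ (Aᵀ * A) *ᵥ y.ofLp = ∑ i, (A *ᵥ y.ofLp) i ^ 2 := by
    rw [← Matrix.mulVec_mulVec, Matrix.mulVec_transpose, dotProduct_comm,
      ← Matrix.dotProduct_mulVec]
    simp [dotProduct, sq]
  rw [h3]
  congr 1
  simp [neg_div]

theorem hasIIDGaussianRows_topBlock {d : ℕ} (k m n : ℕ) (B : Matrix (Fin d) (Fin d) ℝ) :
    HasIIDGaussianRows (topBlock k m n B) ((gSparse d k n)ᵀ * Bᵀ * B * gSparse d k n) := by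
  have h1 : Measurable fun x : Fin d → ℝ =>
      (WithLp.toLp 2 (x ᵥ* (B * gSparse d k n)) : EuclideanSpace ℝ (Fin n)) := by
    unfold Matrix.vecMul dotProduct
    fun_prop
  have h2 : ∀ ω i, (topBlock k m n B ω) i = (gaussMat (m - k) d ω i) ᵥ* (B * gSparse d k n) := by
    intro ω i
    rw [topBlock, Matrix.mul_assoc, Matrix.mul_apply_eq_vecMul]
  constructor
  · refine Measurable.aemeasurable ?_
    simp only [h2]
    refine measurable_pi_iff.2 fun i => h1.comp ?_
    unfold gaussMat
    fun_prop
  · simp only [h2]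
    refine gaussMat_rows_law (m - k) d h1 ?_
    rw [map_vecMul_gaussian]
    simp only [Matrix.transpose_mul, Matrix.mul_assoc]

/-! ## Tail bounds -/

/-- The factor `exp (s x²)` changes the exponent of the Gaussian density to `-(1/2 - s) x²`, which
is again a Gaussian integral when `s < 1/2`. -/
theorem integrable_exp_sq_gaussian {s : ℝ} (hs : s < 1 / 2) :
    Integrable (fun x : ℝ => Real.exp (s * x ^ 2)) (gaussianReal 0 1) ∧
      ∫ x, Real.exp (s * x ^ 2) ∂gaussianReal 0 1 = (√(1 - 2 * s))⁻¹ := by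
  have h0 : ∀ x : ℝ, gaussianPDFReal 0 1 x * Real.exp (s * x ^ 2) =
      (√(2 * Real.pi))⁻¹ * Real.exp (-(1 / 2 - s) * x ^ 2) := by
    intro x
    rw [gaussianPDFReal]
    simp only [NNReal.coe_one, mul_one, sub_zero, mul_assoc, ← Real.exp_add]
    congr 2
    ring
  constructor
  · rw [gaussianReal_of_var_ne_zero 0 one_ne_zero,
      integrable_withDensity_iff_integrable_smul₀' (by fun_prop)
        (ae_of_all _ fun _ => gaussianPDF_lt_top)]
    simp only [toReal_gaussianPDF, smul_eq_mul, h0]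
    exact (integrable_exp_neg_mul_sq (by linarith)).const_mul _
  · rw [integral_gaussianReal_eq_integral_smul one_ne_zero]
    simp only [smul_eq_mul, h0]
    rw [integral_const_mul, integral_gaussian, ← Real.sqrt_inv, ← Real.sqrt_inv,
      ← Real.sqrt_mul (by positivity)]
    congr 1
    have : 1 / 2 - s ≠ 0 := by linarith
    have : 1 - 2 * s ≠ 0 := by linarith
    have := Real.pi_ne_zero
    field_simp

theorem mgf_sum_sq_gaussian {ι : Type*} [Fintype ι] {s : ℝ} (hs : s < 1 / 2) :
    Integrable (fun y : ι → ℝ => Real.exp (s * ∑ i, y i ^ 2)) (Measure.pi fun _ => gaussianReal 0 1) ∧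
      mgf (fun y : ι → ℝ => ∑ i, y i ^ 2) (Measure.pi fun _ => gaussianReal 0 1) s =
        (√(1 - 2 * s))⁻¹ ^ Fintype.card ι := by
  have h0 : (fun y : ι → ℝ => Real.exp (s * ∑ i, y i ^ 2)) =
      fun y => ∏ i, Real.exp (s * y i ^ 2) := by
    funext y
    rw [Finset.mul_sum, Real.exp_sum]
  constructor
  · rw [h0]
    exact Integrable.fintype_prod fun _ => (integrable_exp_sq_gaussian hs).1
  · rw [mgf, h0, integral_fintype_prod_eq_prod (f := fun _ x => Real.exp (s * x ^ 2))]
    simp [(integrable_exp_sq_gaussian hs).2]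

/-- Chernoff bound at `s = 1/4`: the exponent per unit of `M` is at most `-9/16 + (log 2)/2 < -1/5`.
A free `M` allows a bound in terms of `m` although there are only `m - k` rows. -/
theorem sum_sq_gaussian_upper {ι : Type*} [Fintype ι] {M : ℝ} (hM : Fintype.card ι ≤ M) :
    (Measure.pi fun _ : ι => gaussianReal 0 1).real {y | 9 / 4 * M ≤ ∑ i, y i ^ 2} ≤
      Real.exp (-(M / 5)) := by
  obtain ⟨h1, h2⟩ := mgf_sum_sq_gaussian (ι := ι) (s := 1 / 4) (by norm_num)
  refine (measure_ge_le_exp_mul_mgf (9 / 4 * M) (by norm_num) h1).trans ?_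
  have e : (√(1 - 2 * (1 / 4)))⁻¹ = Real.exp (Real.log 2 / 2) := by
    rw [← Real.sqrt_inv, Real.sqrt_eq_rpow, Real.rpow_def_of_pos (by norm_num)]
    norm_num
    ring
  rw [h2, e, ← Real.exp_nat_mul, ← Real.exp_add]
  apply Real.exp_le_exp.2
  have := Real.log_two_lt_d9
  have := Real.log_two_gt_d9
  nlinarith

/-- Chernoff bound at `s = -3/2`, where the moment generating function of one square is exactly
`1/2`. The rate `log 2 - 3/8` is large enough to beat a union bound over `2^d` vectors. -/
theorem sum_sq_gaussian_lower {ι : Type*} [Fintype ι] :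
    (Measure.pi fun _ : ι => gaussianReal 0 1).real
      {y | ∑ i, y i ^ 2 ≤ (Fintype.card ι : ℝ) / 4} ≤
        Real.exp ((3 / 8 - Real.log 2) * Fintype.card ι) := by
  obtain ⟨h1, h2⟩ := mgf_sum_sq_gaussian (ι := ι) (s := -3 / 2) (by norm_num)
  refine (measure_le_le_exp_mul_mgf _ (by norm_num) h1).trans ?_
  have e : (√(1 - 2 * (-3 / 2)))⁻¹ = Real.exp (-Real.log 2) := by
    rw [show (1 - 2 * (-3 / 2) : ℝ) = 2 ^ 2 by norm_num, Real.sqrt_sq (by norm_num), Real.exp_neg,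
      Real.exp_log (by norm_num)]
  rw [h2, e, ← Real.exp_nat_mul, ← Real.exp_add]
  apply Real.exp_le_exp.2
  linarith

variable {p d : ℕ}

theorem gaussMat_mulVec_law {u : Fin d → ℝ} (hu : sqSum u = 1) :
    gaussianTape.map (fun ω => gaussMat p d ω *ᵥ u) = Measure.pi fun _ => gaussianReal 0 1 :=
  gaussMat_rows_law p d (f := fun x => x ⬝ᵥ u) (by unfold dotProduct; fun_prop)
    (map_dotProduct_gaussian u hu)

theorem measurable_gaussMat_mulVec (v : Fin d → ℝ) :
    Measurable fun ω => gaussMat p d ω *ᵥ v := by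
  unfold gaussMat Matrix.mulVec dotProduct
  fun_prop

theorem sqSum_nonneg (v : Fin d → ℝ) : 0 ≤ sqSum v := Finset.sum_nonneg fun _ _ => mul_self_nonneg _

theorem sqSum_smul (c : ℝ) (v : Fin d → ℝ) : sqSum (c • v) = c ^ 2 * sqSum v := by
  simp only [sqSum, Finset.mul_sum, Pi.smul_apply, smul_eq_mul]
  exact Finset.sum_congr rfl fun _ _ => by ring

theorem exists_normalization {v : Fin d → ℝ} (hv : 0 < sqSum v) :
    ∃ u : Fin d → ℝ, sqSum u = 1 ∧ v = √(sqSum v) • u := by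
  have h := Real.sqrt_pos.2 hv
  refine ⟨(√(sqSum v))⁻¹ • v, ?_, ?_⟩
  · rw [sqSum_smul, inv_pow, Real.sq_sqrt hv.le, inv_mul_cancel₀ hv.ne']
  · rw [smul_smul, mul_inv_cancel₀ h.ne', one_smul]

theorem sqSum_eq (v : Fin d → ℝ) : sqSum v = ∑ i, v i ^ 2 := by simp [sqSum, sq]

theorem gaussMat_upper (v : Fin d → ℝ) {M : ℝ} (hM : p ≤ M) :
    gaussianTape.real {ω | 9 / 4 * M * sqSum v < sqSum (gaussMat p d ω *ᵥ v)} ≤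
      Real.exp (-(M / 5)) := by
  -- The zero vector cannot be normalized, but the strict inequality makes its bad event empty.
  rcases (sqSum_nonneg v).eq_or_lt with h0 | h0
  · have hv : v = 0 := by
      funext i
      have := (Finset.sum_eq_zero_iff_of_nonneg (fun i _ => mul_self_nonneg (v i))).1 h0.symm i
        (Finset.mem_univ i)
      exact mul_self_eq_zero.1 this
    have : {ω | 9 / 4 * M * sqSum v < sqSum (gaussMat p d ω *ᵥ v)} = ∅ := by
      ext ω
      simp [hv, sqSum]
    rw [this]
    simpa using (Real.exp_pos _).le
  · obtain ⟨u, hu, hv⟩ := exists_normalization h0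
    have hset : {ω | 9 / 4 * M * sqSum v < sqSum (gaussMat p d ω *ᵥ v)} ⊆
        (fun ω => gaussMat p d ω *ᵥ u) ⁻¹' {y | 9 / 4 * M ≤ ∑ i, y i ^ 2} := by
      intro ω hω
      simp only [Set.mem_ofPred_eq, Set.mem_preimage] at hω ⊢
      rw [hv, Matrix.mulVec_smul, sqSum_smul, sqSum_smul, hu, mul_one, mul_comm] at hω
      rw [← sqSum_eq]
      exact (lt_of_mul_lt_mul_left hω (sq_nonneg _)).le
    refine (measureReal_mono hset).trans ?_
    rw [← map_measureReal_apply (measurable_gaussMat_mulVec u)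
      (measurableSet_le (by fun_prop) (by fun_prop)), gaussMat_mulVec_law hu]
    exact sum_sq_gaussian_upper (by simpa using hM)

theorem gaussMat_lower (v : Fin d → ℝ) :
    gaussianTape.real {ω | sqSum (gaussMat p d ω *ᵥ v) < p / 4 * sqSum v} ≤
      Real.exp ((3 / 8 - Real.log 2) * p) := by
  rcases (sqSum_nonneg v).eq_or_lt with h0 | h0
  · have : {ω | sqSum (gaussMat p d ω *ᵥ v) < p / 4 * sqSum v} = ∅ := by
      ext ω
      simp [← h0, sqSum_nonneg]
    rw [this]
    simpa using (Real.exp_pos _).le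
  · obtain ⟨u, hu, hv⟩ := exists_normalization h0
    have hset : {ω | sqSum (gaussMat p d ω *ᵥ v) < p / 4 * sqSum v} ⊆
        (fun ω => gaussMat p d ω *ᵥ u) ⁻¹' {y | ∑ i, y i ^ 2 ≤ (Fintype.card (Fin p) : ℝ) / 4} := by
      intro ω hω
      simp only [Set.mem_ofPred_eq, Set.mem_preimage] at hω ⊢
      rw [hv, Matrix.mulVec_smul, sqSum_smul, sqSum_smul, hu, mul_one, mul_comm (_ / _)] at hω
      rw [← sqSum_eq, Fintype.card_fin]
      exact (lt_of_mul_lt_mul_left hω (sq_nonneg _)).le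
    refine (measureReal_mono hset).trans ?_
    rw [← map_measureReal_apply (measurable_gaussMat_mulVec u)
      (measurableSet_le (by fun_prop) (by fun_prop)), gaussMat_mulVec_law hu]
    exact sum_sq_gaussian_lower.trans (by simp)

/-- The squared Frobenius norm. -/
def frobSq {p d : ℕ} (R : Matrix (Fin p) (Fin d) ℝ) : ℝ := ∑ i, ∑ j, R i j ^ 2

theorem measurable_gaussMat_frobSq : Measurable fun ω => frobSq (gaussMat p d ω) := by
  unfold frobSq gaussMat
  fun_prop

theorem gaussMat_frobSq_upper {M : ℝ} (hM : (p * d : ℕ) ≤ M) :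
    gaussianTape.real {ω | 9 / 4 * M < frobSq (gaussMat p d ω)} ≤ Real.exp (-(M / 5)) := by
  have hm : Measurable fun ω (x : Fin p × Fin d) => gaussMat p d ω x.1 x.2 := by
    unfold gaussMat; fun_prop
  have hset : {ω | 9 / 4 * M < frobSq (gaussMat p d ω)} ⊆
      (fun ω (x : Fin p × Fin d) => gaussMat p d ω x.1 x.2) ⁻¹' {y | 9 / 4 * M ≤ ∑ i, y i ^ 2} := by
    intro ω hω
    simp only [Set.mem_ofPred_eq, Set.mem_preimage] at hω ⊢
    rw [Fintype.sum_prod_type]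
    exact hω.le
  refine (measureReal_mono hset).trans ?_
  rw [← map_measureReal_apply hm (measurableSet_le (by fun_prop) (by fun_prop)),
    gaussMat_entries_law]
  exact sum_sq_gaussian_upper (by simpa using hM)

end BDDtoSLR

namespace BDDtoSLR

/-! ## The good event -/

/-- The sign vector with given signs. -/
def signVec {d : ℕ} (b : Fin d → Bool) : Fin d → ℝ := fun i => if b i then 1 else -1

theorem IsSign.exists_signVec {d : ℕ} {z : Fin d → ℝ} (hz : IsSign z) : ∃ b, z = signVec b := by
  classical
  refine ⟨fun i => decide (z i = 1), funext fun i => ?_⟩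
  rcases hz i with h | h
  · norm_num [signVec, h]
  · simp [signVec, h]

variable {d k m n : ℕ}

/-- The event that the Gaussian matrix roughly preserves the length of all relevant vectors. -/
def goodEvent (k m : ℕ) (B : Matrix (Fin d) (Fin d) ℝ) (t z : Fin d → ℝ) : Set (ℕ → ℝ) :=
  {ω | sqSum (gaussMat (m - k) d ω *ᵥ (B *ᵥ z - t)) ≤ 9 / 4 * m * sqSum (B *ᵥ z - t)} ∩
    ({ω | frobSq (gaussMat (m - k) d ω) ≤ 9 / 4 * (m * d)} ∩
      ⋂ b : Fin d → Bool, {ω | ((m - k : ℕ) : ℝ) / 4 * sqSum (B *ᵥ signVec b - t) ≤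
        sqSum (gaussMat (m - k) d ω *ᵥ (B *ᵥ signVec b - t))})

theorem measurable_sqSum_gaussMat (p : ℕ) (v : Fin d → ℝ) :
    Measurable fun ω => sqSum (gaussMat p d ω *ᵥ v) := by
  have h : Measurable fun y : Fin p → ℝ => sqSum y := by
    unfold sqSum
    fun_prop
  exact h.comp (measurable_gaussMat_mulVec v)

theorem measurableSet_goodEvent (B : Matrix (Fin d) (Fin d) ℝ) (t z : Fin d → ℝ) :
    MeasurableSet (goodEvent k m B t z) :=
  (measurableSet_le (measurable_sqSum_gaussMat _ _) measurable_const).inter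
    ((measurableSet_le measurable_gaussMat_frobSq measurable_const).inter
      (MeasurableSet.iInter fun _ => measurableSet_le measurable_const
        (measurable_sqSum_gaussMat _ _)))

theorem Params.sub_bound (hp : Params d k m n) : 16 * (m : ℝ) ≤ 17 * ((m - k : ℕ) : ℝ) := by
  have := hp.k_le
  have := hp.le
  have h : 16 * m ≤ 17 * (m - k) := by omega
  exact_mod_cast h

theorem goodEvent_prob (hp : Params d k m n) (B : Matrix (Fin d) (Fin d) ℝ) (t z : Fin d → ℝ) :
    1 - Real.exp (-(1 / 10 * m)) ≤ gaussianTape.real (goodEvent k m B t z) := by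
  have hle := hp.le
  have hd := hp.d_pos
  have hsub := hp.sub_bound
  have hm17 : (17 : ℝ) * d ≤ m := by exact_mod_cast hle
  have hd1 : (1 : ℝ) ≤ d := by exact_mod_cast hd
  set A := {ω | 9 / 4 * (m : ℝ) * sqSum (B *ᵥ z - t) <
    sqSum (gaussMat (m - k) d ω *ᵥ (B *ᵥ z - t))}
  set F := {ω | 9 / 4 * ((m : ℝ) * d) < frobSq (gaussMat (m - k) d ω)}
  set L := fun b : Fin d → Bool => {ω | sqSum (gaussMat (m - k) d ω *ᵥ (B *ᵥ signVec b - t)) <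
    ((m - k : ℕ) : ℝ) / 4 * sqSum (B *ᵥ signVec b - t)}
  have hc : (goodEvent k m B t z)ᶜ = A ∪ (F ∪ ⋃ b, L b) := by
    ext ω
    simp [goodEvent, A, F, L, ← not_le]
    tauto
  have hA : gaussianTape.real A ≤ Real.exp (-(m / 5)) :=
    gaussMat_upper _ (by exact_mod_cast Nat.sub_le _ _)
  have hF : gaussianTape.real F ≤ Real.exp (-(m / 5)) := by
    refine (gaussMat_frobSq_upper (p := m - k) (d := d) (M := m * d) ?_).trans ?_
    · exact_mod_cast Nat.mul_le_mul_right d (Nat.sub_le m k)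
    · refine Real.exp_le_exp.2 ?_
      nlinarith
  have hL : gaussianTape.real (⋃ b, L b) ≤ Real.exp (-(m / 5)) := by
    refine (measureReal_iUnion_fintype_le _).trans ?_
    refine (Finset.sum_le_sum fun b _ => gaussMat_lower (p := m - k) (B *ᵥ signVec b - t)).trans ?_
    have e : ((2 : ℝ) ^ d) = Real.exp (d * Real.log 2) := by
      rw [Real.exp_nat_mul, Real.exp_log (by norm_num)]
    simp only [Finset.sum_const, Finset.card_univ, Fintype.card_fun, Fintype.card_bool,
      Fintype.card_fin, nsmul_eq_mul, Nat.cast_pow, Nat.cast_ofNat]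
    rw [e, ← Real.exp_add]
    -- The union bound costs `d log 2 ≤ (m/17) log 2`, against a gain of `(log 2 - 3/8)(m - k)` with
    -- `m - k ≥ 16m/17`. A net rate above `1/5` remains.
    refine Real.exp_le_exp.2 ?_
    have := Real.log_two_lt_d9
    have := Real.log_two_gt_d9
    nlinarith
  have hunion : gaussianTape.real (goodEvent k m B t z)ᶜ ≤ 3 * Real.exp (-(m / 5)) := by
    rw [hc]
    have h1 := measureReal_union_le (μ := gaussianTape) A (F ∪ ⋃ b, L b)
    have h2 := measureReal_union_le (μ := gaussianTape) F (⋃ b, L b)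
    linarith
  have h3 : 3 * Real.exp (-(m / 5)) ≤ Real.exp (-(1 / 10 * (m : ℝ))) := by
    have e : Real.exp (-(1 / 10 * (m : ℝ))) = Real.exp (m / 10) * Real.exp (-(m / 5)) := by
      rw [← Real.exp_add]
      congr 1
      ring
    rw [e]
    refine mul_le_mul_of_nonneg_right ?_ (Real.exp_pos _).le
    -- Since `m ≥ 17`, already `1 + x + x²/2` at `x = m/10` exceeds `3`, the number of bad events.
    have := Real.quadratic_le_exp_of_nonneg (x := (m : ℝ) / 10) (by positivity)
    nlinarith
  rw [probReal_compl_eq_one_sub (measurableSet_goodEvent B t z)] at hunion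
  linarith

/-! ## Lengths -/

theorem l2norm_sq (v : Fin d → ℝ) : l2norm v ^ 2 = sqSum v := by
  rw [l2norm, EuclideanSpace.real_norm_sq_eq, sqSum_eq]

theorem l2norm_nonneg (v : Fin d → ℝ) : 0 ≤ l2norm v := norm_nonneg _

theorem l2norm_add_le (v w : Fin d → ℝ) : l2norm (v + w) ≤ l2norm v + l2norm w := norm_add_le _ _

theorem l2norm_sub_le (v w : Fin d → ℝ) : l2norm (v - w) ≤ l2norm v + l2norm w := norm_sub_le _ _

theorem l2norm_neg (v : Fin d → ℝ) : l2norm (-v) = l2norm v := norm_neg _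

theorem l2norm_le_of_sqSum_le {v : Fin d → ℝ} {r : ℝ} (hr : 0 ≤ r) (h : sqSum v ≤ r ^ 2) :
    l2norm v ≤ r :=
  le_of_sq_le_sq (by rwa [l2norm_sq]) hr

theorem l2norm_le_sum_abs (v : Fin d → ℝ) : l2norm v ≤ ∑ i, |v i| := by
  refine l2norm_le_of_sqSum_le (Finset.sum_nonneg fun _ _ => abs_nonneg _) ?_
  rw [sqSum_eq, sq, Finset.sum_mul]
  refine Finset.sum_le_sum fun i _ => ?_
  rw [← sq_abs, sq]
  exact mul_le_mul_of_nonneg_left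
    (Finset.single_le_sum (f := fun i => |v i|) (fun _ _ => abs_nonneg _) (Finset.mem_univ i))
    (abs_nonneg _)

/-- Cauchy–Schwarz in each row. It is needed for the rounding error, which depends on the oracle's
answer and hence on `R`, so that no bound for a fixed vector applies to it. -/
theorem sqSum_mulVec_le {p : ℕ} (R : Matrix (Fin p) (Fin d) ℝ) (v : Fin d → ℝ) :
    sqSum (R *ᵥ v) ≤ frobSq R * sqSum v := by
  rw [sqSum_eq, sqSum_eq, frobSq, Finset.sum_mul]
  exact Finset.sum_le_sum fun i _ => Finset.sum_mul_sq_le_sq_mul_sq Finset.univ (R i) v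

theorem entryBound_nonneg (B : Matrix (Fin d) (Fin d) ℝ) : 0 ≤ entryBound B :=
  Finset.sum_nonneg fun _ _ => Finset.sum_nonneg fun _ _ =>
    add_nonneg zero_le_one (mul_self_nonneg _)

/-- `entryBound` dominates the sum of the `|B i j|` because `|x| ≤ 1 + x²`. A crude bound suffices,
as the weight is scaled by it. -/
theorem l2norm_mulVec_le (B : Matrix (Fin d) (Fin d) ℝ) {v : Fin d → ℝ} {ε : ℝ}
    (hv : ∀ i, |v i| ≤ ε) : l2norm (B *ᵥ v) ≤ entryBound B * ε := by
  refine (l2norm_le_sum_abs _).trans ?_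
  rw [entryBound, Finset.sum_mul]
  refine Finset.sum_le_sum fun i _ => ?_
  rw [Matrix.mulVec, dotProduct, Finset.sum_mul]
  refine (Finset.abs_sum_le_sum_abs _ _).trans (Finset.sum_le_sum fun j _ => ?_)
  rw [abs_mul]
  refine mul_le_mul ?_ (hv j) (abs_nonneg _)
    (add_nonneg zero_le_one (mul_self_nonneg _))
  nlinarith [sq_abs (B i j), sq_nonneg (|B i j| - 1)]

theorem lambdaBin_le (B : Matrix (Fin d) (Fin d) ℝ) {z z' : Fin d → ℝ} (hz : IsSign z)
    (hz' : IsSign z') (hne : z ≠ z') : lambdaBin B ≤ l2norm (B *ᵥ z - B *ᵥ z') := by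
  refine csInf_le ⟨0, ?_⟩ ⟨z, z', hz, hz', hne, rfl⟩
  rintro _ ⟨_, _, -, -, -, rfl⟩
  exact l2norm_nonneg _

/-! ## The gadgets -/

theorem isSign_decode (θ : Fin n → ℝ) : IsSign (decode d k θ) := by
  intro i
  unfold decode
  split_ifs <;> simp

theorem Params.idx_lt (hp : Params d k m n) {b c : ℕ} (hb : b < k) (hc : c < n / k) :
    b * (n / k) + c < n := by
  have h1 : (b + 1) * (n / k) ≤ k * (n / k) := Nat.mul_le_mul_right _ hb
  rw [hp.mul_n_div, add_mul, one_mul] at h1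
  omega

theorem Params.div_lt (hp : Params d k m n) {j : ℕ} (hj : j < n) : j / (n / k) < k := by
  rw [Nat.div_lt_iff_lt_mul hp.n_div_pos, hp.mul_n_div]
  exact hj

theorem Params.div_lt' (hp : Params d k m n) {i : ℕ} (hi : i < d) : i / (d / k) < k := by
  rw [Nat.div_lt_iff_lt_mul hp.div_pos, hp.mul_div]
  exact hi

theorem exists_encoding (hp : Params d k m n) {z : Fin d → ℝ} (hz : IsSign z) :
    ∃ θ : Fin n → ℝ, IsSparse k θ ∧ gSparse d k n *ᵥ θ = z ∧
      ∀ b, (gPartite n k *ᵥ θ) b = 1 := by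
  classical
  have hq := hp.div_pos
  -- `code b` is the column whose binary digits are the signs of `z` in block `b`; `θ` is the
  -- indicator vector of one such column per block.
  let code : ℕ → ℕ := fun b => Nat.ofBits fun r : Fin (d / k) =>
    decide (∃ h : b * (d / k) + r < d, z ⟨_, h⟩ = 1)
  have hcode : ∀ b, code b < n / k := fun b => by
    rw [hp.n_div]
    exact Nat.ofBits_lt_two_pow _
  let J : Fin k → Fin n := fun b => ⟨b * (n / k) + code b, hp.idx_lt b.2 (hcode b)⟩
  have hJd : ∀ b : Fin k, (J b : ℕ) / (n / k) = b := fun b => by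
    simp only [J]
    rw [mul_comm, Nat.mul_add_div hp.n_div_pos, Nat.div_eq_of_lt (hcode b), add_zero]
  have hJm : ∀ b : Fin k, (J b : ℕ) % (n / k) = code b := fun b => by
    simp only [J]
    rw [mul_comm, Nat.mul_add_mod, Nat.mod_eq_of_lt (hcode b)]
  let θ : Fin n → ℝ := fun j => ∑ b : Fin k, if j = J b then 1 else 0
  have hsum : ∀ f : Fin n → ℝ, ∑ j, f j * θ j = ∑ b, f (J b) := by
    intro f
    simp only [θ, Finset.mul_sum]
    rw [Finset.sum_comm]
    simp
  refine ⟨θ, ?_, ?_, ?_⟩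
  · have hsub : {j | θ j ≠ 0} ⊆ ((Finset.univ.image J : Finset (Fin n)) : Set (Fin n)) := by
      intro j hj
      simp only [Finset.coe_image, Finset.coe_univ, Set.image_univ, Set.mem_range]
      by_contra hne
      push Not at hne
      refine hj (Finset.sum_eq_zero fun b _ => if_neg fun h => hne b h.symm)
    refine (Set.ncard_le_ncard hsub (Finset.finite_toSet _)).trans ?_
    rw [Set.ncard_coe_finset]
    exact Finset.card_image_le.trans (by simp)
  · funext i
    rw [Matrix.mulVec, dotProduct, hsum]
    rw [Finset.sum_eq_single ⟨(i : ℕ) / (d / k), hp.div_lt' i.2⟩]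
    · have hr : (i : ℕ) % (d / k) < d / k := Nat.mod_lt _ hq
      simp only [gSparse, hJd, hJm, if_true, code]
      rw [Nat.testBit_ofBits_lt _ _ hr]
      have e : (i : ℕ) / (d / k) * (d / k) + (i : ℕ) % (d / k) = i := Nat.div_add_mod' _ _
      simp only [e, Fin.eta, Fin.is_lt, exists_true_left, decide_eq_true_eq]
      rcases hz i with h | h
      · rw [h]
        norm_num
      · simp [h]
    · intro b _ hb
      simp only [gSparse, hJd]
      refine if_neg fun h => hb (Fin.ext h.symm)
    · simp
  · intro b
    rw [Matrix.mulVec, dotProduct, hsum]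
    simp [gPartite, hJd, Fin.val_inj]

/-- Every block sum is positive, so each of the `k` blocks contains a nonzero entry; by sparsity it
contains exactly one. Its value is the block sum, so the entries of `gSparse *ᵥ θ` are this value up
to sign, and rounding moves each by at most `ε`. -/
theorem decode_close (hp : Params d k m n) {θ : Fin n → ℝ} (hθ : IsSparse k θ) {ε : ℝ} (hε : ε < 1)
    (hσ : ∀ b, |(gPartite n k *ᵥ θ) b - 1| ≤ ε) (i : Fin d) :
    |(gSparse d k n *ᵥ θ - decode d k θ) i| ≤ ε := by
  classical
  have hpos : ∀ b, 0 < (gPartite n k *ᵥ θ) b := fun b => by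
    have := abs_le.1 (hσ b)
    linarith
  have hex : ∀ b : Fin k, ∃ j : Fin n, (b : ℕ) = (j : ℕ) / (n / k) ∧ θ j ≠ 0 := by
    intro b
    by_contra hne
    push Not at hne
    refine (hpos b).ne' ?_
    rw [Matrix.mulVec, dotProduct]
    refine Finset.sum_eq_zero fun j _ => ?_
    by_cases h : (b : ℕ) = (j : ℕ) / (n / k)
    · rw [hne j h, mul_zero]
    · simp [gPartite, h]
  choose J hJ hJθ using hex
  have hinj : Function.Injective J := fun b b' h => Fin.ext (by rw [hJ, hJ, h])
  -- Here the counting happens: `k` distinct nonzero positions, and at most `k` in total.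
  have himg : Finset.univ.image J = Finset.univ.filter fun j => θ j ≠ 0 := by
    refine Finset.eq_of_subset_of_card_le ?_ ?_
    · intro j hj
      obtain ⟨b, -, rfl⟩ := Finset.mem_image.1 hj
      simpa using hJθ b
    · rw [Finset.card_image_of_injective _ hinj, Finset.card_univ, Fintype.card_fin]
      refine le_trans (le_of_eq ?_) hθ
      rw [← Set.ncard_coe_finset]
      congr 1
      ext j
      simp
  have hsum : ∀ f : Fin n → ℝ, ∑ j, f j * θ j = ∑ b, f (J b) * θ (J b) := by
    intro f
    rw [← Finset.sum_image (f := fun j => f j * θ j) (s := Finset.univ) (g := J)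
      fun _ _ _ _ h => hinj h, himg]
    refine (Finset.sum_subset (Finset.filter_subset _ _) fun j _ hj => ?_).symm
    simp only [Finset.mem_filter, Finset.mem_univ, true_and, not_not] at hj
    rw [hj, mul_zero]
  have hσJ : ∀ b, (gPartite n k *ᵥ θ) b = θ (J b) := by
    intro b
    rw [Matrix.mulVec, dotProduct, hsum]
    simp [gPartite, ← hJ, Fin.val_inj]
  set b : Fin k := ⟨(i : ℕ) / (d / k), hp.div_lt' i.2⟩ with hb
  have hG : (gSparse d k n *ᵥ θ) i = gSparse d k n i (J b) * θ (J b) := by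
    rw [Matrix.mulVec, dotProduct, hsum]
    refine Finset.sum_eq_single b (fun b' _ hb' => ?_) (by simp)
    have : ¬ (i : ℕ) / (d / k) = (J b' : ℕ) / (n / k) := by
      rw [← hJ]
      exact fun h => hb' (Fin.ext h.symm)
    simp [gSparse, this]
  have hθpos : 0 < θ (J b) := hσJ b ▸ hpos b
  have hclose := hσ b
  rw [hσJ] at hclose
  have hval : gSparse d k n i (J b) = 1 ∨ gSparse d k n i (J b) = -1 := by
    have : (i : ℕ) / (d / k) = (J b : ℕ) / (n / k) := by rw [← hJ]
    simp only [gSparse, this, if_true]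
    split_ifs <;> simp
  rw [Pi.sub_apply, decode, hG]
  rcases hval with h | h
  · rw [h, one_mul, if_pos hθpos]
    exact hclose
  · rw [h, if_neg (by linarith)]
    rw [← abs_neg]
    convert hclose using 2
    ring

/-! ## The regression instance -/

theorem sum_fin_split (hk : k ≤ m) (f : Fin m → ℝ) :
    ∑ i, f i = ∑ i : Fin (m - k), f ⟨i, by omega⟩ +
      ∑ i : Fin k, f ⟨m - k + i, by omega⟩ := by
  have h : m - k + k = m := by omega
  rw [← Fin.sum_congr' f h, Fin.sum_univ_add]
  rfl

theorem slrQuery_residual (hp : Params d k m n) (B : Matrix (Fin d) (Fin d) ℝ) (t : Fin d → ℝ)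
    (ω : ℕ → ℝ) (δ : ℝ) (θ : Fin n → ℝ) :
    l2norm ((slrQuery k m n B t ω δ).X *ᵥ θ - (slrQuery k m n B t ω δ).y) ^ 2 =
      sqSum (gaussMat (m - k) d ω *ᵥ (B *ᵥ (gSparse d k n *ᵥ θ) - t)) +
        ∑ b, (weight m B δ * ((gPartite n k *ᵥ θ) b - 1)) ^ 2 := by
  have hle := hp.le
  have hkd := hp.k_le
  rw [l2norm_sq, sqSum_eq, sqSum_eq, sum_fin_split (by omega : k ≤ m)]
  congr 1
  · refine Finset.sum_congr rfl fun i _ => ?_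
    have e1 : ((slrQuery k m n B t ω δ).X *ᵥ θ) ⟨i, by omega⟩ = (topBlock k m n B ω *ᵥ θ) i := by
      simp [Matrix.mulVec, slrQuery, stack]
    have e2 : (slrQuery k m n B t ω δ).y ⟨i, by omega⟩ = (gaussMat (m - k) d ω *ᵥ t) i := by
      simp [slrQuery]
    rw [Pi.sub_apply, e1, e2, Matrix.mulVec_sub, Pi.sub_apply, Matrix.mulVec_mulVec,
      Matrix.mulVec_mulVec, topBlock, Matrix.mul_assoc]
  · refine Finset.sum_congr rfl fun b _ => ?_
    have e1 : ((slrQuery k m n B t ω δ).X *ᵥ θ) ⟨m - k + b, by omega⟩ =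
        weight m B δ * (gPartite n k *ᵥ θ) b := by
      simp [Matrix.mulVec, slrQuery, stack, dotProduct, Finset.mul_sum, mul_assoc]
    have e2 : (slrQuery k m n B t ω δ).y ⟨m - k + b, by omega⟩ = weight m B δ := by
      simp [slrQuery]
    rw [Pi.sub_apply, e1, e2]
    ring

theorem weight_eq (B : Matrix (Fin d) (Fin d) ℝ) (δ : ℝ) :
    weight m B δ = 100 * m * (entryBound B + δ) := by
  simp [weight]
  ring

theorem weight_pos (hp : Params d k m n) (B : Matrix (Fin d) (Fin d) ℝ) {δ : ℝ} (hδ : 0 < δ) :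
    0 < weight m B δ := by
  have h1 : 0 < m := by have := hp.le; have := hp.d_pos; omega
  have h2 : (0 : ℝ) < m := by exact_mod_cast h1
  have := entryBound_nonneg B
  rw [weight_eq]
  positivity

/-- The exact encoding of `z` makes the bottom residual vanish, and the top one is at most `(9/4) m
‖B z - t‖²`; the factor `3/2` is the square root of `9/4`. -/
theorem slrQuery_isValid (hp : Params d k m n) {B : Matrix (Fin d) (Fin d) ℝ} {t z : Fin d → ℝ}
    (hz : IsSign z) {ω : ℕ → ℝ} (hω : ω ∈ goodEvent k m B t z) {δ : ℝ} (hδ : 0 < δ)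
    (he : 3 / 2 * l2norm (B *ᵥ z - t) ≤ δ) : (slrQuery k m n B t ω δ).IsValid k := by
  obtain ⟨θ, hs, hG, hσ⟩ := exists_encoding hp hz
  refine ⟨hδ, θ, hs, ?_⟩
  have h1 : 0 < m := by have := hp.le; have := hp.d_pos; omega
  have h2 : (0 : ℝ) < m := by exact_mod_cast h1
  rw [slrQuery_residual hp, hG, div_le_iff₀ h2]
  simp only [hσ, sub_self, mul_zero, ne_eq, OfNat.ofNat_ne_zero, not_false_eq_true, zero_pow,
    Finset.sum_const_zero, add_zero]
  have h0 : sqSum (gaussMat (m - k) d ω *ᵥ (B *ᵥ z - t)) ≤ 9 / 4 * m * sqSum (B *ᵥ z - t) := hω.1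
  refine h0.trans ?_
  change _ ≤ δ ^ 2 * m
  rw [← l2norm_sq]
  have h3 := pow_le_pow_left₀ (by have := l2norm_nonneg (B *ᵥ z - t); positivity) he 2
  nlinarith

/-- The bottom block forces `θ` close to an encoding of `decode d k θ`, so replacing `gSparse *ᵥ θ`
by it adds only one percent to the top residual. The lower bound of the good event for that sign
vector then removes the Gaussian matrix. -/
theorem solution_close (hp : Params d k m n) {B : Matrix (Fin d) (Fin d) ℝ} {t z : Fin d → ℝ}
    {ω : ℕ → ℝ} (hω : ω ∈ goodEvent k m B t z) {δ : ℝ} (hδ : 0 < δ) {θ : Fin n → ℝ}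
    (hθ : (slrQuery k m n B t ω δ).IsSolution k θ) :
    l2norm (B *ᵥ decode d k θ - t) ≤ 11 / 5 * δ := by
  obtain ⟨hs, hres⟩ := hθ
  obtain ⟨-, hfrob, hlow⟩ := hω
  have hle := hp.le
  have hd := hp.d_pos
  have h1 : 1 ≤ m := by omega
  have hm1 : (1 : ℝ) ≤ m := by exact_mod_cast h1
  have hm0 : (0 : ℝ) < m := by linarith
  have hmd : 17 * (d : ℝ) ≤ m := by exact_mod_cast hle
  have hB := entryBound_nonneg B
  have hγ := weight_pos hp B hδ
  have hγeq := weight_eq (m := m) B δ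
  set γ := weight m B δ with hγdef
  set N := √(m : ℝ) with hN
  have hN2 : N ^ 2 = m := Real.sq_sqrt hm0.le
  have hN0 : 0 < N := Real.sqrt_pos.2 hm0
  have hN1 : 1 ≤ N := by nlinarith
  rw [slrQuery_residual hp, div_le_iff₀ hm0] at hres
  change _ ≤ δ ^ 2 * m at hres
  have hbot : ∀ b, (γ * ((gPartite n k *ᵥ θ) b - 1)) ^ 2 ≤ (N * δ) ^ 2 := by
    intro b
    have h2 := Finset.single_le_sum (f := fun b => (γ * ((gPartite n k *ᵥ θ) b - 1)) ^ 2)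
      (fun _ _ => sq_nonneg _) (Finset.mem_univ b)
    have h3 := sqSum_nonneg (gaussMat (m - k) d ω *ᵥ (B *ᵥ (gSparse d k n *ᵥ θ) - t))
    have h4 : (N * δ) ^ 2 = δ ^ 2 * m := by rw [mul_pow, hN2]; ring
    rw [h4]
    exact h2.trans (by linarith)
  have hσ : ∀ b, |(gPartite n k *ᵥ θ) b - 1| ≤ N * δ / γ := by
    intro b
    rw [le_div_iff₀ hγ]
    have h2 := abs_le_of_sq_le_sq (hbot b) (by positivity)
    rw [abs_mul, abs_of_pos hγ] at h2
    linarith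
  have hε : N * δ / γ < 1 := by
    rw [div_lt_one hγ, hγeq]
    have h2 : N * δ ≤ m * δ := mul_le_mul_of_nonneg_right (by nlinarith) hδ.le
    nlinarith [mul_nonneg hm0.le hB, mul_pos hm0 hδ]
  have hclose := decode_close hp hs hε hσ
  -- The weight is `100 N² (entryBound B + δ)`: the summand `entryBound B` gives this estimate, and
  -- the summand `δ` gave `hε`.
  have hpert : l2norm (B *ᵥ (gSparse d k n *ᵥ θ - decode d k θ)) ≤ δ / (100 * N) := by
    refine (l2norm_mulVec_le B hclose).trans ?_
    rw [mul_div_assoc', div_le_div_iff₀ hγ (by positivity), hγeq, ← hN2]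
    have : 0 ≤ δ * (100 * N ^ 2 * δ) := by positivity
    nlinarith
  have htop : l2norm (gaussMat (m - k) d ω *ᵥ (B *ᵥ (gSparse d k n *ᵥ θ) - t)) ≤ N * δ := by
    refine l2norm_le_of_sqSum_le (by positivity) ?_
    have h2 : 0 ≤ ∑ b, (γ * ((gPartite n k *ᵥ θ) b - 1)) ^ 2 :=
      Finset.sum_nonneg fun _ _ => sq_nonneg _
    rw [mul_pow, hN2]
    linarith
  have hRpert : l2norm (gaussMat (m - k) d ω *ᵥ (B *ᵥ (gSparse d k n *ᵥ θ - decode d k θ))) ≤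
      N * δ / 100 := by
    refine l2norm_le_of_sqSum_le (by positivity) ((sqSum_mulVec_le _ _).trans ?_)
    rw [← l2norm_sq]
    have h2 : l2norm (B *ᵥ (gSparse d k n *ᵥ θ - decode d k θ)) ^ 2 ≤ (δ / (100 * N)) ^ 2 :=
      pow_le_pow_left₀ (l2norm_nonneg _) hpert 2
    have h3 : frobSq (gaussMat (m - k) d ω) ≤ 9 / 4 * (m * d) := hfrob
    refine (mul_le_mul h3 h2 (sq_nonneg _) (by positivity)).trans ?_
    rw [← hN2]
    have e : 9 / 4 * (N ^ 2 * (d : ℝ)) * (δ / (100 * N)) ^ 2 = 9 / 40000 * d * δ ^ 2 := by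
      field_simp
      ring
    rw [e]
    rw [← hN2] at hmd
    -- What remains is `9/4 * d ≤ N² = m`, a consequence of `17 d ≤ m`.
    nlinarith [sq_nonneg δ]
  have hR : l2norm (gaussMat (m - k) d ω *ᵥ (B *ᵥ decode d k θ - t)) ≤ 101 / 100 * (N * δ) := by
    have e : gaussMat (m - k) d ω *ᵥ (B *ᵥ decode d k θ - t) =
        gaussMat (m - k) d ω *ᵥ (B *ᵥ (gSparse d k n *ᵥ θ) - t) -
          gaussMat (m - k) d ω *ᵥ (B *ᵥ (gSparse d k n *ᵥ θ - decode d k θ)) := by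
      simp only [Matrix.mulVec_sub]
      abel
    rw [e]
    refine (l2norm_sub_le _ _).trans ?_
    linarith
  refine l2norm_le_of_sqSum_le (by positivity) ?_
  obtain ⟨b, hb⟩ := (isSign_decode (d := d) (k := k) θ).exists_signVec
  have hlowb := Set.mem_iInter.1 hlow b
  rw [← hb] at hlowb
  have h2 : ((m - k : ℕ) : ℝ) / 4 * sqSum (B *ᵥ decode d k θ - t) ≤
      (101 / 100 * (N * δ)) ^ 2 := by
    refine (show _ ≤ _ from hlowb).trans ?_
    rw [← l2norm_sq]
    exact pow_le_pow_left₀ (l2norm_nonneg _) hR 2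
  have h3 := hp.sub_bound
  have h4 := sqSum_nonneg (B *ᵥ decode d k θ - t)
  rw [mul_pow, mul_pow, hN2] at h2
  have h5 : 16 / 17 * (m : ℝ) / 4 * sqSum (B *ᵥ decode d k θ - t) ≤
      ((m - k : ℕ) : ℝ) / 4 * sqSum (B *ᵥ decode d k θ - t) :=
    mul_le_mul_of_nonneg_right (by linarith) h4
  have h6 : (m : ℝ) * (4 / 17 * sqSum (B *ᵥ decode d k θ - t)) ≤ m * ((101 / 100) ^ 2 * δ ^ 2) := by
    linarith
  have h7 := le_of_mul_le_mul_left h6 hm0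
  -- Numerically, `(17/4) (101/100)² < (11/5)²`.
  nlinarith [sq_nonneg δ]

end BDDtoSLR

namespace BDDtoSLR

variable {d k m n : ℕ}

/-! ## The number of scales of integer vectors -/

/-- Siegel's lemma for `d` equations in `d + 1` unknowns: its exponent `d / ((d + 1) - d)` is `d`,
and the coefficients of the system are bounded by `1`. -/
theorem exists_small_relation (hd : 0 < d) (u : Fin (d + 1) → Fin d → ℤ) (hu : ∀ i r, |u i r| ≤ 1) :
    ∃ c : Fin (d + 1) → ℤ, c ≠ 0 ∧ (∀ r, ∑ i, c i * u i r = 0) ∧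
      ∀ i, |(c i : ℝ)| ≤ ((d : ℝ) + 1) ^ d := by
  let _ := Matrix.seminormedAddCommGroup (m := Fin d) (n := Fin (d + 1)) (α := ℤ)
  obtain ⟨c, hc, hA, hn⟩ := Int.Matrix.exists_ne_zero_int_vec_norm_le (Matrix.of fun r i => u i r)
    (by simp) (by simpa using hd)
  refine ⟨c, hc, fun r => ?_, fun i => ?_⟩
  · have := congrFun hA r
    simpa [Matrix.mulVec, dotProduct, mul_comm] using this
  · have h1 : ‖(Matrix.of fun r i => u i r : Matrix (Fin d) (Fin (d + 1)) ℤ)‖ ≤ 1 := by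
      rw [Matrix.norm_le_iff zero_le_one]
      intro r i
      simp only [Matrix.of_apply, Int.norm_eq_abs]
      exact_mod_cast hu i r
    have h2 : ‖c i‖ ≤ ‖c‖ := norm_le_pi_norm c i
    rw [Int.norm_eq_abs] at h2
    refine h2.trans (hn.trans (le_of_eq ?_))
    rw [max_eq_left h1]
    simp

/-- There are no `d + 1` integer vectors in dimension `d` with entries in `{-1, 0, 1}` whose images
under a linear map have lengths of rapidly decreasing magnitude. -/
theorem no_rapid_decrease {E : Type*} [NormedAddCommGroup E] [NormedSpace ℝ E] (hd : 0 < d)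
    (f : (Fin d → ℝ) →ₗ[ℝ] E) (u : Fin (d + 1) → Fin d → ℤ) (hu : ∀ i r, |u i r| ≤ 1) {q : ℝ}
    (hpos : ∀ i, 0 < ‖f fun r => (u i r : ℝ)‖)
    (hdec : ∀ i j, i < j → ‖f fun r => (u j r : ℝ)‖ ≤ q * ‖f fun r => (u i r : ℝ)‖)
    (hq : d * ((d : ℝ) + 1) ^ d * q < 1) : False := by
  classical
  obtain ⟨c, hc, hrel, hbd⟩ := exists_small_relation hd u hu
  have hne : (Finset.univ.filter fun i => c i ≠ 0).Nonempty := by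
    obtain ⟨i, hi⟩ := Function.ne_iff.1 hc
    exact ⟨i, by simpa using hi⟩
  -- The first vector that occurs in the relation. Its coefficient is a nonzero integer, hence at
  -- least `1` in absolute value, while the other terms have total length at most `d (d + 1)^d q ‖w
  -- i₀‖ < ‖w i₀‖`.
  set i₀ := (Finset.univ.filter fun i => c i ≠ 0).min' hne with hi₀
  have hc0 : c i₀ ≠ 0 := by
    have := Finset.min'_mem _ hne
    rw [← hi₀] at this
    simpa using this
  have hlt : ∀ i, c i ≠ 0 → i ≠ i₀ → i₀ < i := fun i hi hne' =>
    lt_of_le_of_ne (Finset.min'_le _ _ (by simpa using hi)) hne'.symm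
  set w : Fin (d + 1) → E := fun i => f fun r => (u i r : ℝ) with hw
  have hsum : ∑ i, (c i : ℝ) • w i = 0 := by
    simp only [hw, ← map_smul, ← map_sum]
    have : (∑ i, (c i : ℝ) • fun r => (u i r : ℝ)) = (0 : Fin d → ℝ) := by
      funext r
      simp only [Finset.sum_apply, Pi.smul_apply, smul_eq_mul, Pi.zero_apply]
      exact_mod_cast hrel r
    rw [this, map_zero]
  have hq0 : 0 ≤ q := by
    have h1 := hdec 0 (Fin.last d) (by rw [Fin.lt_def]; simpa using hd)
    have := hpos 0
    have := hpos (Fin.last d)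
    by_contra hneg
    push Not at hneg
    nlinarith
  rw [← Finset.add_sum_erase _ _ (Finset.mem_univ i₀)] at hsum
  have h1 : ‖w i₀‖ ≤ ‖(c i₀ : ℝ) • w i₀‖ := by
    rw [norm_smul, Real.norm_eq_abs]
    have : (1 : ℝ) ≤ |(c i₀ : ℝ)| := by exact_mod_cast Int.one_le_abs hc0
    nlinarith [norm_nonneg (w i₀)]
  rw [eq_neg_of_add_eq_zero_left hsum, norm_neg] at h1
  have h2 : ‖∑ i ∈ Finset.univ.erase i₀, (c i : ℝ) • w i‖ ≤
      ∑ i ∈ (Finset.univ : Finset (Fin (d + 1))).erase i₀, ((d : ℝ) + 1) ^ d * (q * ‖w i₀‖) := by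
    refine (norm_sum_le _ _).trans (Finset.sum_le_sum fun i hi => ?_)
    rw [norm_smul, Real.norm_eq_abs]
    by_cases hci : c i = 0
    · rw [hci]
      simp only [Int.cast_zero, abs_zero, zero_mul]
      positivity
    · exact mul_le_mul (hbd i) (hdec i₀ i (hlt i hci (Finset.ne_of_mem_erase hi)))
        (norm_nonneg _) (by positivity)
  rw [Finset.sum_const, Finset.card_erase_of_mem (Finset.mem_univ _), Finset.card_univ,
    Fintype.card_fin, nsmul_eq_mul, Nat.add_sub_cancel] at h2
  have h3 : 0 < ‖w i₀‖ := hpos i₀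
  nlinarith

/-! ## The approximation of the length -/

/-- The `ℓ¹` norm lies between the length and `2^d` times the length, so `d` conditional halvings
suffice, and no square root is needed. A halving takes place only above twice the length, so the
value never falls below the length. -/
theorem approxNorm_bounds (v : Fin d → ℝ) :
    l2norm v ≤ approxNorm v ∧ approxNorm v ≤ 2 * l2norm v := by
  set l := l2norm v with hl
  have hl0 : 0 ≤ l := l2norm_nonneg v
  have hσ : sqSum v = l ^ 2 := (l2norm_sq v).symm
  have hw0 : l ≤ ∑ i, |v i| := l2norm_le_sum_abs v
  have hw1 : ∑ i, |v i| ≤ 2 ^ d * l := by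
    refine le_of_sq_le_sq ?_ (by positivity)
    have h1 := sq_sum_le_card_mul_sum_sq (s := Finset.univ) (f := fun i => |v i|)
    simp only [sq_abs, Finset.card_univ, Fintype.card_fin, ← sqSum_eq, hσ] at h1
    refine h1.trans ?_
    rw [mul_pow]
    refine mul_le_mul_of_nonneg_right ?_ (sq_nonneg _)
    have h2 : (d : ℝ) ≤ 2 ^ d := by exact_mod_cast Nat.lt_two_pow_self.le
    have h3 : (1 : ℝ) ≤ 2 ^ d := one_le_pow₀ (by norm_num)
    nlinarith
  -- Either the target range is already reached, or all `j` halvings so far have taken place.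
  have key : ∀ j, l ≤ (halveIf (sqSum v))^[j] (∑ i, |v i|) ∧
      ((halveIf (sqSum v))^[j] (∑ i, |v i|) ≤ 2 * l ∨
        (halveIf (sqSum v))^[j] (∑ i, |v i|) * 2 ^ j ≤ ∑ i, |v i|) := by
    intro j
    induction j with
    | zero => exact ⟨hw0, .inr (by simp)⟩
    | succ j ih =>
      rw [Function.iterate_succ_apply']
      set w := (halveIf (sqSum v))^[j] (∑ i, |v i|)
      unfold halveIf
      rw [hσ]
      split_ifs with h
      · refine ⟨by nlinarith, ih.2.imp (fun h => by linarith) fun h => ?_⟩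
        rw [pow_succ]
        linarith
      · exact ⟨ih.1, .inl (by nlinarith)⟩
  obtain ⟨h1, h2⟩ := key d
  refine ⟨h1, h2.elim id fun h => ?_⟩
  have h3 : (0 : ℝ) < 2 ^ d := by positivity
  have h4 : approxNorm v ≤ l := by
    refine le_of_mul_le_mul_right (a := 2 ^ d) ?_ h3
    rw [mul_comm l]
    exact h.trans hw1
  linarith

/-! ## Decoding -/

/-- The bounds on the noise in an instance of bounded distance decoding. -/
theorem IsBinaryBDD.bounds {α : ℝ} {B : Matrix (Fin d) (Fin d) ℝ} {t z : Fin d → ℝ}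
    (hα : α ≤ 1 / 10) (hB : 0 < lambdaBin B) (h : IsBinaryBDD α B t z) :
    l2norm (B *ᵥ z - t) ≤ lambdaBin B / 10 ∧
      ∀ z', IsSign z' → z' ≠ z → 9 / 10 * lambdaBin B ≤ l2norm (B *ᵥ z' - t) := by
  obtain ⟨hz, e, rfl, he⟩ := h
  have h1 : l2norm (B *ᵥ z - (B *ᵥ z + e)) ≤ lambdaBin B / 10 := by
    rw [sub_add_cancel_left, l2norm_neg]
    nlinarith
  refine ⟨h1, fun z' hz' hne => ?_⟩
  have h2 := lambdaBin_le B hz' hz hne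
  have e1 : B *ᵥ z' - B *ᵥ z = (B *ᵥ z' - (B *ᵥ z + e)) - (B *ᵥ z - (B *ᵥ z + e)) := by abel
  rw [e1] at h2
  have h3 := l2norm_sub_le (B *ᵥ z' - (B *ᵥ z + e)) (B *ᵥ z - (B *ᵥ z + e))
  linarith

/-! ### Geometric decrease of the residual and the number of rounds. -/

section descent

variable {α : ℝ} {B : Matrix (Fin d) (Fin d) ℝ} {t z : Fin d → ℝ} {ω : ℕ → ℝ}
  {S : SLRInstance m n → Fin n → ℝ}

theorem isSign_improve {z' : Fin d → ℝ} (hz' : IsSign z') :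
    IsSign (improve k m n B t ω S z') := by
  unfold improve
  split_ifs
  · exact isSign_decode _
  · exact hz'

/-- No other sign vector has a smaller residual, so whatever the oracle answers, `z` is kept. -/
theorem improve_self (hα : α ≤ 1 / 10) (hB : 0 < lambdaBin B) (h : IsBinaryBDD α B t z) :
    improve k m n B t ω S z = z := by
  obtain ⟨h1, h2⟩ := h.bounds hα hB
  unfold improve
  split_ifs with hlt
  · by_contra hne
    have h3 := h2 _ (isSign_decode _) hne
    rw [← l2norm_sq, ← l2norm_sq] at hlt
    have := lt_of_pow_lt_pow_left₀ 2 (l2norm_nonneg _) hlt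
    linarith
  · rfl

theorem improve_residual_le (hp : Params d k m n) (hα : α ≤ 1 / 10) (hB : 0 < lambdaBin B)
    (h : IsBinaryBDD α B t z) (hω : ω ∈ goodEvent k m B t z) (hS : SolvesSLR k S)
    {z' : Fin d → ℝ} (hz' : IsSign z') (hne : z' ≠ z) :
    l2norm (B *ᵥ improve k m n B t ω S z' - t) ≤ 11 / 15 * l2norm (B *ᵥ z' - t) := by
  obtain ⟨h1, h2⟩ := h.bounds hα hB
  have h3 := h2 z' hz' hne
  obtain ⟨h4, h5⟩ := approxNorm_bounds (B *ᵥ z' - t)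
  have h6 : errParam (B *ᵥ z' - t) = approxNorm (B *ᵥ z' - t) / 6 := if_pos (by linarith)
  have hδ := errParam_pos (B *ᵥ z' - t)
  -- With `r` the current residual length, `δ ≥ r/6 ≥ (3/20) lambdaBin B`, which is `3/2` times the
  -- largest possible noise. Below, `δ ≤ r/3` yields the factor `11/5 * 1/3 = 11/15`.
  have hval := slrQuery_isValid hp h.1 hω hδ (by rw [h6]; linarith)
  have hclose := solution_close hp hω hδ (hS _ hval)
  have h7 : l2norm (B *ᵥ decode d k (S (slrQuery k m n B t ω (errParam (B *ᵥ z' - t)))) - t) ≤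
      11 / 15 * l2norm (B *ᵥ z' - t) := hclose.trans (by rw [h6]; linarith)
  unfold improve
  rw [if_pos]
  · exact h7
  · rw [← l2norm_sq, ← l2norm_sq]
    exact pow_lt_pow_left₀ (by linarith) (l2norm_nonneg _) (by norm_num)

theorem exists_half_difference {x y : Fin d → ℝ} (hx : IsSign x) (hy : IsSign y) :
    ∃ u : Fin d → ℤ, (∀ r, |u r| ≤ 1) ∧ x - y = (2 : ℝ) • fun r => (u r : ℝ) := by
  have h : ∀ r, ∃ c : ℤ, |c| ≤ 1 ∧ x r - y r = 2 * c := by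
    intro r
    rcases hx r with h1 | h1 <;> rcases hy r with h2 | h2 <;> rw [h1, h2]
    · exact ⟨0, by norm_num⟩
    · exact ⟨-1, by norm_num⟩
    · exact ⟨1, by norm_num⟩
    · exact ⟨0, by norm_num⟩
  choose u hu hxy using h
  exact ⟨u, hu, funext fun r => by simpa using hxy r⟩

/-- Uses `d + 1 ≤ 2^d` and `(11/15)³ < 1/2`: the exponent is chosen so that the powers of two cancel
up to a single factor `1/2`, which leaves `5/8`. -/
theorem scale_bound (d : ℕ) :
    (d : ℝ) * ((d : ℝ) + 1) ^ d * (5 / 4 * (11 / 15) ^ (3 * (d * (d + 1) + 1))) < 1 := by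
  have h1 : (d : ℝ) + 1 ≤ 2 ^ d := by exact_mod_cast Nat.lt_two_pow_self
  have h2 : (d : ℝ) * ((d : ℝ) + 1) ^ d ≤ 2 ^ (d * (d + 1)) := by
    calc (d : ℝ) * ((d : ℝ) + 1) ^ d ≤ 2 ^ d * (2 ^ d) ^ d := by
          gcongr
          linarith
      _ = 2 ^ (d * (d + 1)) := by rw [← pow_mul, ← pow_add]; ring_nf
  have h3 : ((11 : ℝ) / 15) ^ (3 * (d * (d + 1) + 1)) ≤ (1 / 2) ^ (d * (d + 1) + 1) := by
    rw [pow_mul]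
    gcongr
    norm_num
  calc (d : ℝ) * ((d : ℝ) + 1) ^ d * (5 / 4 * (11 / 15) ^ (3 * (d * (d + 1) + 1)))
      ≤ 2 ^ (d * (d + 1)) * (5 / 4 * (1 / 2) ^ (d * (d + 1) + 1)) := by gcongr
    _ = 5 / 8 * (2 ^ (d * (d + 1)) * (1 / 2) ^ (d * (d + 1))) := by ring
    _ = 5 / 8 := by rw [← mul_pow]; norm_num
    _ < 1 := by norm_num

/-- If `z` is missed after `N` rounds it was never met, as it is a fixed point. Then the candidates
at the times `0, L, ..., d L` give `d + 1` half differences from `z` whose images under `B` shrink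
too fast for `no_rapid_decrease`. -/
theorem iterate_improve_eq (hp : Params d k m n) (hα : α ≤ 1 / 10) (hB : 0 < lambdaBin B)
    (h : IsBinaryBDD α B t z) (hω : ω ∈ goodEvent k m B t z) (hS : SolvesSLR k S)
    {z₀ : Fin d → ℝ} (hz₀ : IsSign z₀) {N : ℕ} (hN : d * (3 * (d * (d + 1) + 1)) ≤ N) :
    (improve k m n B t ω S)^[N] z₀ = z := by
  by_contra hne
  set F := improve k m n B t ω S with hF
  set L := 3 * (d * (d + 1) + 1) with hL
  obtain ⟨h1, h2⟩ := h.bounds hα hB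
  have hsign : ∀ j, IsSign (F^[j] z₀) := by
    intro j
    induction j with
    | zero => exact hz₀
    | succ j ih =>
      rw [Function.iterate_succ_apply']
      exact isSign_improve ih
  have hne' : ∀ j ≤ N, F^[j] z₀ ≠ z := by
    intro j hj hjz
    refine hne ?_
    rw [← Nat.sub_add_cancel hj, Function.iterate_add_apply, hjz]
    exact Function.iterate_fixed (improve_self hα hB h) _
  set r : ℕ → ℝ := fun j => l2norm (B *ᵥ F^[j] z₀ - t) with hr
  have hstep : ∀ j < N, r (j + 1) ≤ 11 / 15 * r j := by
    intro j hj
    simp only [hr, Function.iterate_succ_apply']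
    exact improve_residual_le hp hα hB h hω hS (hsign j) (hne' j hj.le)
  have hr0 : ∀ j, 0 ≤ r j := fun j => l2norm_nonneg _
  have hgeom : ∀ l j, j + l ≤ N → r (j + l) ≤ (11 / 15) ^ l * r j := by
    intro l
    induction l with
    | zero => intro j _; simp
    | succ l ih =>
      intro j hj
      have h3 := hstep (j + l) (by omega)
      have h4 := ih j (by omega)
      rw [pow_succ]
      rw [add_assoc] at h3
      linarith
  have hlow : ∀ j ≤ N, 9 / 10 * lambdaBin B ≤ r j := fun j hj => h2 _ (hsign j) (hne' j hj)
  choose u hu hdiff using fun i : Fin (d + 1) => exists_half_difference (hsign (i * L)) h.1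
  have hidx : ∀ i : Fin (d + 1), (i : ℕ) * L ≤ N := fun i =>
    (Nat.mul_le_mul_right L (Nat.lt_succ_iff.1 i.2)).trans hN
  let f : (Fin d → ℝ) →ₗ[ℝ] EuclideanSpace ℝ (Fin d) :=
    (WithLp.linearEquiv 2 ℝ (Fin d → ℝ)).symm.toLinearMap ∘ₗ B.mulVecLin
  have hf : ∀ i, 2 * ‖f fun x => (u i x : ℝ)‖ = l2norm (B *ᵥ F^[i * L] z₀ - B *ᵥ z) := by
    intro i
    rw [← Matrix.mulVec_sub, hdiff i, Matrix.mulVec_smul]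
    have : l2norm ((2 : ℝ) • B *ᵥ fun x => (u i x : ℝ)) =
        ‖(2 : ℝ) • f fun x => (u i x : ℝ)‖ := rfl
    rw [this, norm_smul, Real.norm_eq_abs, abs_of_pos two_pos]
  -- The noise is at most a ninth of the residual of a wrong candidate, so the residual and `‖B (z'
  -- - z)‖` agree up to the factors `8/9` and `10/9`. Their ratio is the `5/4` in `q`.
  have hup : ∀ i : Fin (d + 1), 2 * ‖f fun x => (u i x : ℝ)‖ ≤ 10 / 9 * r (i * L) := by
    intro i
    rw [hf]
    have e : B *ᵥ F^[i * L] z₀ - B *ᵥ z = (B *ᵥ F^[i * L] z₀ - t) - (B *ᵥ z - t) := by abel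
    rw [e]
    refine (l2norm_sub_le _ _).trans ?_
    have := hlow _ (hidx i)
    change r (i * L) + _ ≤ _
    linarith
  have hdown : ∀ i : Fin (d + 1), 8 / 9 * r (i * L) ≤ 2 * ‖f fun x => (u i x : ℝ)‖ := by
    intro i
    rw [hf]
    have e : B *ᵥ F^[i * L] z₀ - t = (B *ᵥ F^[i * L] z₀ - B *ᵥ z) + (B *ᵥ z - t) := by abel
    have h3 : r (i * L) ≤ _ := (le_of_eq (congrArg l2norm e)).trans (l2norm_add_le _ _)
    have := hlow _ (hidx i)
    linarith
  refine no_rapid_decrease hp.d_pos f u hu (q := 5 / 4 * (11 / 15) ^ L) ?_ ?_ (scale_bound d)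
  · intro i
    have := hlow _ (hidx i)
    have := hdown i
    linarith
  · intro i j hij
    have hij' : (i : ℕ) * L + L ≤ j * L := by
      rw [← Nat.succ_mul]
      exact Nat.mul_le_mul_right L hij
    obtain ⟨l, hl⟩ := Nat.exists_eq_add_of_le hij'
    have h3 := hgeom (L + l) (i * L) (by have := hidx j; omega)
    rw [← add_assoc, ← hl] at h3
    have h4 : ((11 : ℝ) / 15) ^ (L + l) ≤ (11 / 15) ^ L :=
      pow_le_pow_of_le_one (by norm_num) (by norm_num) (by omega)
    have h5 : (11 / 15) ^ (L + l) * r (i * L) ≤ (11 / 15) ^ L * r (i * L) :=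
      mul_le_mul_of_nonneg_right h4 (hr0 _)
    have h6 : (11 / 15) ^ L * (8 / 9 * r (i * L)) ≤
        (11 / 15) ^ L * (2 * ‖f fun x => (u i x : ℝ)‖) :=
      mul_le_mul_of_nonneg_left (hdown i) (by positivity)
    have h7 := hup j
    linarith

theorem decode_eq_of_estimate (hp : Params d k m n) (hα : α ≤ 1 / 10) (hB : 0 < lambdaBin B)
    (h : IsBinaryBDD α B t z) (hω : ω ∈ goodEvent k m B t z) {δ : ℝ} (hδ : 0 < δ)
    (hδ' : δ ≤ lambdaBin B / 3) {θ : Fin n → ℝ} (hθ : (slrQuery k m n B t ω δ).IsSolution k θ) :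
    decode d k θ = z := by
  by_contra hne
  have h1 := (h.bounds hα hB).2 _ (isSign_decode θ) hne
  have h2 := solution_close hp hω hδ hθ
  linarith

end descent

/-! ### Assembly of the two reductions. -/

theorem HaltsWithin.mono {ω : ℕ → ℝ} {S : SLRInstance m n → Fin n → ℝ} {P : Prog} {s : State m n}
    {T T' : ℕ} {Q R : State m n → Prop} (h : HaltsWithin ω S P s T Q) (hT : T ≤ T')
    (hQ : ∀ s', Q s' → R s') : HaltsWithin ω S P s T' R := by
  obtain ⟨s', T'', he, hT'', hs'⟩ := h
  exact ⟨s', T'', he, hT''.trans hT, hQ s' hs'⟩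

theorem pow_le_mul_pow {a e M : ℕ} (ha : 1 ≤ a) (he : e ≤ a) (hM : 1 ≤ M) : M ^ e ≤ a * M ^ a :=
  (Nat.pow_le_pow_right hM he).trans (Nat.le_mul_of_pos_left _ ha)

end BDDtoSLR

/-- Part 1 is the instance map, given a number `est` that estimates `lambdaBin B` up to a factor
`2`: one query, with error parameter `δ = Θ(lambdaBin B)`. Part 2 is the reduction from the bare
instance `(B, t)`, with polynomially many queries. -/
theorem mainTheorem1 :
    ∃ (a : ℕ) (c C₁ C₂ : ℝ), 0 < c ∧ 0 < C₁ ∧ 0 < C₂ ∧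
      (∃ P : Prog, ∀ d k m n : ℕ, 0 < d → k ∣ d → 17 * d ≤ m → n = k * 2 ^ (d / k) →
        (∀ (B : Matrix (Fin d) (Fin d) ℝ) (t : Fin d → ℝ) (est : ℝ)
          (ω : ℕ → ℝ) (S : SLRInstance m n → Fin n → ℝ),
          HaltsWithin ω S P (startState k B t est) (a * (n + m) ^ a) fun _ => True) ∧
        ∀ (B : Matrix (Fin d) (Fin d) ℝ) (est : ℝ), 0 < lambdaBin B →
          lambdaBin B ≤ est → est < 2 * lambdaBin B →
          ∃ (γ δ : ℝ) (X₁ : (ℕ → ℝ) → Matrix (Fin (m - k)) (Fin n) ℝ),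
            0 < γ ∧ C₁ * lambdaBin B ≤ δ ∧ δ ≤ C₂ * lambdaBin B ∧
            HasIIDGaussianRows X₁ ((gSparse d k n)ᵀ * Bᵀ * B * gSparse d k n) ∧
            ∀ (α : ℝ) (t z : Fin d → ℝ), α ≤ 1 / 10 → IsBinaryBDD α B t z →
              ∃ E : Set (ℕ → ℝ), MeasurableSet E ∧
                1 - Real.exp (-(c * m)) ≤ gaussianTape.real E ∧
                ∀ (ω : ℕ → ℝ) (S : SLRInstance m n → Fin n → ℝ),
                  HaltsWithin ω S P (startState k B t est) (a * (n + m) ^ a) fun s =>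
                    ∃ q : SLRInstance m n, s.log = [q] ∧
                      q.X = stack (X₁ ω) (γ • gPartite n k) ∧ q.δ = δ ∧
                      (ω ∈ E → q.IsValid k ∧
                        (q.IsSolution k (S q) → s.output d = z))) ∧
      (∃ P : Prog, ∀ d k m n : ℕ, 0 < d → k ∣ d → 17 * d ≤ m → n = k * 2 ^ (d / k) →
        (∀ (B : Matrix (Fin d) (Fin d) ℝ) (t : Fin d → ℝ)
          (ω : ℕ → ℝ) (S : SLRInstance m n → Fin n → ℝ),
          HaltsWithin ω S P (startState k B t 0) (a * (n + m) ^ a) fun _ => True) ∧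
        ∀ B : Matrix (Fin d) (Fin d) ℝ, 0 < lambdaBin B →
          ∃ X₁ : (ℕ → ℝ) → Matrix (Fin (m - k)) (Fin n) ℝ,
            HasIIDGaussianRows X₁ ((gSparse d k n)ᵀ * Bᵀ * B * gSparse d k n) ∧
            ∀ (α : ℝ) (t z : Fin d → ℝ), α ≤ 1 / 10 → IsBinaryBDD α B t z →
              ∃ E : Set (ℕ → ℝ), MeasurableSet E ∧
                1 - Real.exp (-(c * m)) ≤ gaussianTape.real E ∧
                ∀ (ω : ℕ → ℝ) (S : SLRInstance m n → Fin n → ℝ),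
                  HaltsWithin ω S P (startState k B t 0) (a * (n + m) ^ a) fun s =>
                    (∀ q ∈ s.log, 0 < q.δ ∧ ∃ γ : ℝ, 0 < γ ∧
                      q.X = stack (X₁ ω) (γ • gPartite n k)) ∧
                    (ω ∈ E → SolvesSLR k S → s.output d = z)) := by

  -- The error parameter is `est / 6` with `est` in `[lambdaBin B, 2 * lambdaBin B)`, whence the
  -- constants `1/6` and `1/3`; the rate `1/10` is that of `goodEvent_prob`.
  refine ⟨max Prog.instanceMap.exponent Prog.reduction.exponent + 1, 1 / 10, 1 / 6, 1 / 3,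
    by norm_num, by norm_num, by norm_num, ⟨Prog.instanceMap, ?_⟩, ⟨Prog.reduction, ?_⟩⟩
  · intro d k m n hd hk hm hn
    have hp : Params d k m n := ⟨hd, hk, hm, hn⟩
    have hT := pow_le_mul_pow (M := n + m) (Nat.le_add_left 1 _) ((le_max_left
      Prog.instanceMap.exponent Prog.reduction.exponent).trans (Nat.le_succ _))
      (by have := hp.two_le; omega)
    refine ⟨fun B t est ω S => (wp_instanceMap hp est).mono hT fun _ _ => trivial, ?_⟩
    intro B est hB hest hest'
    refine ⟨weight m B (est / 6), est / 6, topBlock k m n B, weight_pos hp B (by linarith),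
      by linarith, by linarith, hasIIDGaussianRows_topBlock k m n B, ?_⟩
    intro α t z hα hBDD
    refine ⟨goodEvent k m B t z, measurableSet_goodEvent B t z, goodEvent_prob hp B t z, ?_⟩
    intro ω S
    refine (wp_instanceMap hp est).mono hT fun s hs =>
      ⟨slrQuery k m n B t ω (est / 6), hs.1, rfl, rfl, fun hω => ⟨?_, fun hsol => ?_⟩⟩
    · have := (hBDD.bounds hα hB).1
      exact slrQuery_isValid hp hBDD.1 hω (by linarith) (by linarith)
    · rw [hs.2]
      exact decode_eq_of_estimate hp hα hB hBDD hω (by linarith) (by linarith) hsol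
  · intro d k m n hd hk hm hn
    have hp : Params d k m n := ⟨hd, hk, hm, hn⟩
    have hT := pow_le_mul_pow (M := n + m) (Nat.le_add_left 1 _) ((le_max_right
      Prog.instanceMap.exponent Prog.reduction.exponent).trans (Nat.le_succ _))
      (by have := hp.two_le; omega)
    refine ⟨fun B t ω S => (wp_reduction hp 0).mono hT fun _ _ => trivial, ?_⟩
    intro B hB
    refine ⟨topBlock k m n B, hasIIDGaussianRows_topBlock k m n B, ?_⟩
    intro α t z hα hBDD
    refine ⟨goodEvent k m B t z, measurableSet_goodEvent B t z, goodEvent_prob hp B t z, ?_⟩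
    intro ω S
    refine (wp_reduction hp 0).mono hT fun s hs => ⟨fun q hq => ?_, fun hω hS => ?_⟩
    · obtain ⟨δ, hδ, rfl⟩ := hs.1 q hq
      exact ⟨hδ, weight m B δ, weight_pos hp B hδ, rfl⟩
    · rw [hs.2]
      refine iterate_improve_eq hp hα hB hBDD hω hS (fun i => Or.inr rfl) ?_
      -- The required number of rounds is cubic in `d`, so the `m ^ 3` rounds of the program
      -- suffice.
      have h1 : d * (3 * (d * (d + 1) + 1)) ≤ (17 * d) * ((17 * d) * (17 * d)) := by nlinarith
      exact h1.trans (Nat.mul_le_mul hm (Nat.mul_le_mul hm hm))
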